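/- Let $p>3$ be a prime. For rational numbers $x,y$, the congruence $x\equiv y \pmod{p^n}$ means that $x-y\in p^n\mathbb Z_{(p)}$, where $\mathbb Z_{(p)}$ is the ring of rational numbers with denominator prime to $p$. Let $\left(\frac{\cdot}{\cdot}\right)$ be the Legendre symbol, $q_p(2)=\frac{2^{p-1}-1}{p}$, and $q_L=\frac{L_p-1}{p}$, where $F_k$ and $L_k$ are the Fibonacci and Lucas numbers ($F_0=0$, $F_1=1$, $L_0=2$, $L_1=1$, both with $a_{k+2}=a_{k+1}+a_k$). Let $B_n(x)$ be the Bernoulli polynomials, $B_n=B_n(0)$, let $E_n$ be the Euler numbers, defined by $\frac{2}{e^x+e^{-x}}=\sum_{n\ge 0}E_n\frac{x^n}{n!}$, and let $H_{n}(2)=\sum_{r=1}^{n}\frac1{r^2}$. Then the following hold. (i) Central binomial coefficients in the denominators (the first three were conjectured by Z.-W. Sun): \begin{align*} p\sum_{k=1}^{p-1}\frac{2^k}{k\binom{2k}{k}}&\equiv \left(\frac{-1}{p}\right)-1-p\,q_p(2)+p^2E_{p-3} \pmod{p^3},\\ p\sum_{k=1}^{p-1}\frac{2^k}{k^2\binom{2k}{k}}&\equiv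 -q_p(2)+\frac{p^2}{16}B_{p-3} \pmod{p^3},\\ p\sum_{k=1}^{p-1}\frac{4^k}{k^2\binom{2k}{k}}&\equiv -4q_p(2)-2p\,q_p(2)^2+p^2B_{p-3} \pmod{p^3},\\ p\sum_{k=1}^{p-1}\frac{4^k}{k^3\binom{2k}{k}}&\equiv -4q_p(2)^2+p\left(\frac43q_p(2)^3-\frac16B_{p-3}\right) \pmod{p^2},\\ p\sum_{k=1}^{p-1}\frac{4^k}{k^4\binom{2k}{k}}&\equiv -\frac43\left(2q_p(2)^3+B_{p-3}\right) \pmod{p}. \end{align*} (ii) Central binomial coefficients in the numerators: \begin{align*} \sum_{k=0}^{p-1}\binom{2k}{k}&\equiv \left(\frac p3\right)-\frac{p^2}{3}B_{p-2}\left(\tfrac13\right) \pmod{p^3},\\ \sum_{k=0}^{p-1}\frac{\binom{2k}{k}}{3^k}&\equiv \left(\frac p3\right)-\frac{2p^2}{9}B_{p-2}\left(\tfrac13\right) \pmod{p^3},\\ \sum_{k=1}^{p-1}(-2)^k\binom{2k}{k}&\equiv -\frac{4p}{3}q_p(2) \pmod{p^3},\\ \sum_{k=1}^{p-1}\frac{(-1)^k}{k}\binom{2k}{k}&\equiv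 -2q_L+p\,q_L^2 \pmod{p^2},\\ \sum_{k=1}^{p-1}\frac{\binom{2k}{k}}{k^2}&\equiv \frac12\left(\frac p3\right)B_{p-2}\left(\tfrac13\right) \pmod{p}. \end{align*} (iii) If moreover $p>5$, then \begin{align*} p\sum_{k=1}^{p-1}\frac{(-1)^kH_{k-1}(2)}{k\binom{2k}{k}}&\equiv \frac15\left(\frac p5\right)q_L^2 \pmod p,\\ p\sum_{k=1}^{p-1}\frac{(-1)^kH_{k-1}(2)}{k^2\binom{2k}{k}}&\equiv \frac4{15}\left(\frac12q_L^3+B_{p-3}\right) \pmod p,\\ p\sum_{k=1}^{p-1}\frac{(-1)^kH_{k-1}(2)}{\binom{2k}{k}}&\equiv \frac15q_L+\frac2{25}\left(\frac p5\right)q_L^2 \pmod p,\\ p\sum_{k=1}^{p-1}\frac{(-1)^k}{k\binom{2k}{k}}&\equiv \frac{1-L_pF_p}{2}+\frac{p^2}{5}\left(\frac p5\right)q_L^2 \pmod{p^3},\\ p\sum_{k=1}^{p-1}\frac{(-1)^k}{k^2\binom{2k}{k}}&\equiv \frac{1-L_p^2}{2p}+\frac{4p^2}{15}\left(\frac12q_L^3+B_{p-3}\right)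 \pmod{p^3},\\ p\sum_{k=1}^{p-1}\frac{(-1)^k}{\binom{2k}{k}}&\equiv \frac{p-L_pF_p}{5}+\frac{2p^2}{25}\left(\frac p5\right)q_L^2 \pmod{p^3},\\ \sum_{k=1}^{p-1}\binom{2k}{k}\frac{(-1)^kF_{3k-\left(\frac p5\right)}}{k}&\equiv \frac15\,p\,q_L^2 \pmod{p^2},\\ \sum_{k=1}^{p-1}\binom{2k}{k}\frac{(-1)^kL_{3k-\left(\frac p5\right)}}{k^2}&\equiv 0 \pmod p. \end{align*} -/

import Mathlib

open Finset

/-- `x ≡ y (mod p ^ n)` for rational numbers `x`, `y`, where `p` is a prime: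
the difference `x - y` lies in `p ^ n` times the ring of rationals `a / b` with `p ∤ b`. -/
def RatModEq (p n : ℕ) (x y : ℚ) : Prop :=
  ∃ a b : ℤ, ¬ (p : ℤ) ∣ b ∧ x - y = (p : ℚ) ^ n * ((a : ℚ) / (b : ℚ))

/-- The Euler numbers `E_n`, defined by `2 / (e ^ x + e ^ (-x)) = ∑ E_n x ^ n / n!`
(`E_0 = 1`, `E_2 = -1`, `E_4 = 5`, ...). The constant term of the denominator is `2`,
so the inverse is the inverse in `ℚ⟦X⟧`. -/
noncomputable def eulerNumber (n : ℕ) : ℚ :=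
  (n.factorial : ℚ) * PowerSeries.coeff n
    (2 * (PowerSeries.exp ℚ + PowerSeries.evalNegHom (PowerSeries.exp ℚ))⁻¹)

/-- The Lucas numbers `L_0 = 2`, `L_1 = 1`, `L_{n+2} = L_n + L_{n+1}`. -/
def lucasNumber : ℕ → ℕ
  | 0 => 2
  | 1 => 1
  | n + 2 => lucasNumber n + lucasNumber (n + 1)

/-- The Fermat quotient `q_p(a) = (a ^ (p - 1) - 1) / p`. -/
def fermatQuotient (p : ℕ) (a : ℚ) : ℚ := (a ^ (p - 1) - 1) / p

/-- The Lucas quotient `q_L = (L_p - 1) / p`. -/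
def lucasQuotient (p : ℕ) : ℚ := ((lucasNumber p : ℚ) - 1) / p

/-- The generalized harmonic number `H_n(d) = ∑_{r=1}^n 1 / r ^ d`. -/
def genHarmonic (n d : ℕ) : ℚ := ∑ r ∈ Icc 1 n, 1 / (r : ℚ) ^ d

/-- The value `B_n(1/3)` of the Bernoulli polynomial. -/
noncomputable def bernoulliThird (n : ℕ) : ℚ := (Polynomial.bernoulli n).eval (1 / 3)

instance factPrimeFive : Fact (Nat.Prime 5) := ⟨by norm_num⟩

/-! The sums are specialisations of functions of one parameter, and the parameter is algebraic. The
work therefore happens in a field `K` with a valuation ring `V` and a local homomorphism to a field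
`k` of characteristic `p`; in the end `K` is the algebraic closure of ℚ_p and `k` its residue field.
Each sum equals its main term plus p^n times an element of `V`, and the residue of that element is
expressed by finite polylogarithms £_d(x) = ∑_{0<i<p} x^i / i^d over `k`. Knowing the residue gives
the congruence modulo p^(n+1).

Denominators. Let t = 2 - α - α⁻¹. The numbers p t^i / (i binom(2i,i)) ∏_{0<j<i} (1 - p²/j²)
(`centralTerm`) are terms of a Chebyshev polynomial of index p, so their sums are closed forms in
α^p. Replacing the product by 1 costs p² times the sum weighted by H_{i-1}(2), which is needed only
modulo p. Expanding t^i in powers of α and telescoping over i (`sum_centralRatio_mul_harmonicSum`)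
turns this weighted sum into £_3(α) + £_3(α⁻¹) or a multiple of £_2(α) - £_2(α⁻¹). The parameters
are α = √-1 for t = 2, α = -1 for t = 4 and α = φ² for t = -1, where φ² = φ + 1. For t = 4 with i³
or i⁴, a beta integral expansion (`sum_four_pow_div`) leads to harmonic sums up to (p-1)/2 instead.

Numerators. The truncated generating function `one_sub_two_mul_sum_centralBinom` at u = x(1-x), with
the expansion of binom(p-1+i, i) in powers of p, gives the sum of binom(2i,i) u^i modulo p³; its
second-order term is £_2(1-x). Integration yields the sums divided by i modulo p² and by i² modulo
p. The points are x = ζ and x = (1+ζ)/3 with ζ² = ζ - 1, x = -1, x = φ and x = φ².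

Special values. Functional equations of £_1, £_2, £_3 come from differentiation: in characteristic p
a polynomial with zero derivative is a polynomial in X^p, so a degree bound and the values at 0 and
1 determine it (`eq_zero_of_derivative`). In weight three one more coefficient appears, and it is
B_{p-3}/3 (`finPolylogPoly_three_relation`). At the points above the functional equations become
linear systems that can be solved. Bernoulli numbers enter through a polynomial f that interpolates
m ↦ H_{m-1}(2), with f'(0) = B_{p-3} and -2 f(1/3) = B_{p-2}(1/3); the Euler number enters through
alternating sums of odd powers. -/

set_option linter.unusedSectionVars false

/-! ### Specialisation from a valuation ring to a field -/

/-- `Red ρ x a`: the element `x` of `K` lies in the valuation ring `V`, and its image under the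
specialization `ρ` to the field `k` is `a`. -/
def Red {K k : Type*} [Field K] [Field k] {V : ValuationSubring K} (ρ : V →+* k) (x : K) (a : k) :
    Prop :=
  ∃ h : x ∈ V, ρ ⟨x, h⟩ = a

namespace Red

variable {K k : Type*} [Field K] [Field k] {V : ValuationSubring K} {ρ : V →+* k} {x y : K}
  {a b : k}

theorem mem (h : Red ρ x a) : x ∈ V := h.1

theorem of_mem (h : x ∈ V) : ∃ a, Red ρ x a := ⟨_, h, rfl⟩

theorem unique (h : Red ρ x a) (h' : Red ρ x b) : a = b := by
  obtain ⟨h1, rfl⟩ := h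
  obtain ⟨h2, rfl⟩ := h'
  rfl

theorem congr (h : Red ρ x a) (hx : y = x) (ha : b = a) : Red ρ y b := by rwa [hx, ha]

theorem zero : Red ρ 0 0 := ⟨V.zero_mem, map_zero ρ⟩

theorem one : Red ρ 1 1 := ⟨V.one_mem, map_one ρ⟩

theorem add (hx : Red ρ x a) (hy : Red ρ y b) : Red ρ (x + y) (a + b) := by
  obtain ⟨h1, rfl⟩ := hx
  obtain ⟨h2, rfl⟩ := hy
  exact ⟨V.add_mem _ _ h1 h2, map_add ρ ⟨x, h1⟩ ⟨y, h2⟩⟩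

theorem mul (hx : Red ρ x a) (hy : Red ρ y b) : Red ρ (x * y) (a * b) := by
  obtain ⟨h1, rfl⟩ := hx
  obtain ⟨h2, rfl⟩ := hy
  exact ⟨V.mul_mem _ _ h1 h2, map_mul ρ ⟨x, h1⟩ ⟨y, h2⟩⟩

theorem neg (hx : Red ρ x a) : Red ρ (-x) (-a) := by
  obtain ⟨h1, rfl⟩ := hx
  exact ⟨V.neg_mem _ h1, map_neg ρ ⟨x, h1⟩⟩

theorem sub (hx : Red ρ x a) (hy : Red ρ y b) : Red ρ (x - y) (a - b) := by
  simpa only [sub_eq_add_neg] using hx.add hy.neg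

theorem pow (hx : Red ρ x a) (n : ℕ) : Red ρ (x ^ n) (a ^ n) := by
  induction n with
  | zero => simpa using one
  | succ n ih => simpa only [pow_succ] using ih.mul hx

theorem natCast (n : ℕ) : Red ρ (n : K) (n : k) := by
  induction n with
  | zero => simpa using zero
  | succ n ih => simpa using ih.add one

theorem intCast (n : ℤ) : Red ρ (n : K) (n : k) := by
  cases n with
  | ofNat n => simpa using natCast n
  | negSucc n => simpa using (natCast (ρ := ρ) (n + 1)).neg

theorem ofNat (n : ℕ) [n.AtLeastTwo] :
    Red ρ (OfNat.ofNat n : K) (OfNat.ofNat n : k) := by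
  have h := natCast (ρ := ρ) (OfNat.ofNat n)
  rwa [Nat.cast_ofNat, Nat.cast_ofNat] at h

theorem sum {ι : Type*} {s : Finset ι} {f : ι → K} {g : ι → k} (h : ∀ i ∈ s, Red ρ (f i) (g i)) :
    Red ρ (∑ i ∈ s, f i) (∑ i ∈ s, g i) := by
  classical
  induction s using Finset.induction_on with
  | empty => simpa using zero
  | insert i s hi ih =>
    rw [sum_insert hi, sum_insert hi]
    exact (h i (mem_insert_self _ _)).add (ih fun j hj => h j (mem_insert_of_mem hj))

/-- A nonzero residue is a unit, and a local homomorphism reflects units; this is the only place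
where locality of `ρ` is needed directly. -/
theorem inv [IsLocalHom ρ] (hx : Red ρ x a) (ha : a ≠ 0) : Red ρ x⁻¹ a⁻¹ := by
  obtain ⟨h1, rfl⟩ := hx
  have hu : IsUnit (⟨x, h1⟩ : V) := isUnit_of_map_unit ρ _ (isUnit_iff_ne_zero.mpr ha)
  obtain ⟨u, hu⟩ := hu
  have h2 : x * ((u⁻¹ : Vˣ) : V) = 1 := by
    have := congrArg (fun v : V => (v : K)) (u.mul_inv)
    rw [hu] at this
    simpa using this
  have h3 : x⁻¹ = ((u⁻¹ : Vˣ) : V) := (eq_inv_of_mul_eq_one_right h2).symm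
  refine ⟨h3 ▸ Subtype.mem _, ?_⟩
  have h4 : (⟨x⁻¹, h3 ▸ Subtype.mem _⟩ : V) = ((u⁻¹ : Vˣ) : V) := Subtype.ext h3
  rw [h4, ← hu]
  refine eq_inv_of_mul_eq_one_right ?_
  rw [← map_mul, u.mul_inv, map_one]

theorem div [IsLocalHom ρ] (hx : Red ρ x a) (hy : Red ρ y b) (hb : b ≠ 0) :
    Red ρ (x / y) (a / b) := by
  simpa only [div_eq_mul_inv] using hx.mul (hy.inv hb)

/-- An element satisfying `x = c + d / x` with `c`, `d` integral is itself integral. -/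
theorem exists_of_quadratic {c d : K} (hc : c ∈ V) (hd : d ∈ V) (hx : x * x = c * x + d) :
    ∃ a, Red ρ x a := by
  rcases V.mem_or_inv_mem x with h | h
  · exact of_mem h
  · refine of_mem ?_
    by_cases h0 : x = 0
    · rw [h0]; exact V.zero_mem
    · have : x = c + d * x⁻¹ := by
        field_simp
        linear_combination hx
      rw [this]
      exact V.add_mem _ _ hc (V.mul_mem _ _ hd h)

end Red

/-! ### Returning to congruences of rational numbers -/

section

variable {K k : Type*} [Field K] [Field k] [CharZero K] {V : ValuationSubring K} {ρ : V →+* k}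
  {p : ℕ} [hp : Fact p.Prime] [CharP k p]

theorem natCast_ne_zero_of_lt {i : ℕ} (h0 : 0 < i) (hi : i < p) : (i : k) ≠ 0 := by
  rw [Ne, CharP.cast_eq_zero_iff k p]
  exact Nat.not_dvd_of_pos_of_lt h0 hi

/-- A zero residue improves the exponent by one. From den · d = num the numerator has residue 0, so
p divides it, and in lowest terms p then cannot divide the denominator. -/
theorem ratModEq_of_red {x y d : ℚ} {n : ℕ} (h : x - y = (p : ℚ) ^ n * d)
    (hd : Red ρ ((d : ℚ) : K) 0) : RatModEq p (n + 1) x y := by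
  have key : (d.den : K) * ((d : ℚ) : K) = (d.num : K) := by
    exact_mod_cast Rat.den_mul_eq_num d
  have hnum : (d.num : k) = 0 := by
    have h1 := (Red.natCast (ρ := ρ) d.den).mul hd
    rw [key, mul_zero] at h1
    exact (Red.intCast (ρ := ρ) d.num).unique h1
  rw [CharP.intCast_eq_zero_iff k p] at hnum
  obtain ⟨a, ha⟩ := hnum
  refine ⟨a, d.den, fun hden => ?_, ?_⟩
  · have h1 : p ∣ d.num.natAbs := Int.natCast_dvd.mp ⟨a, ha⟩
    have h2 : p ∣ d.den := by exact_mod_cast hden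
    have := Nat.dvd_gcd h1 h2
    rw [d.reduced] at this
    exact hp.out.one_lt.ne' (Nat.dvd_one.mp this)
  · rw [h, pow_succ, mul_assoc]
    congr 1
    conv_lhs => rw [← Rat.num_div_den d, ha]
    push_cast
    ring

end

/-! ### Finite polylogarithms: inversion and duplication -/

section

open Polynomial

variable {k : Type*} [Field k] {p : ℕ}

/-- The finite polylogarithm `∑_{0 < i < p} x ^ i / i ^ d`. -/
def finPolylog {F : Type*} [Field F] (p d : ℕ) (x : F) : F := ∑ i ∈ Ico 1 p, x ^ i / (i : F) ^ d

/-- The finite polylogarithm as a polynomial. -/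
noncomputable def finPolylogPoly (k : Type*) [Field k] (p d : ℕ) : k[X] :=
  ∑ i ∈ Ico 1 p, C (1 / (i : k) ^ d) * X ^ i

/-- The polynomial `X ^ p * £_d(1 - 1 / X)`. -/
noncomputable def finPolylogTwist (k : Type*) [Field k] (p d : ℕ) : k[X] :=
  ∑ i ∈ Ico 1 p, C (1 / (i : k) ^ d) * ((X - 1) ^ i * X ^ (p - i))

theorem eval_finPolylogPoly (d : ℕ) (x : k) :
    (finPolylogPoly k p d).eval x = finPolylog p d x := by
  simp only [finPolylogPoly, finPolylog, eval_finsetSum]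
  exact sum_congr rfl fun i _ => by simp; ring

/-- Multiplying by x^p clears the denominators of 1 - 1/x, so that the third member of the orbit x,
1 - x, 1 - 1/x also becomes a polynomial that can be differentiated. -/
theorem eval_finPolylogTwist (d : ℕ) {x : k} (hx : x ≠ 0) :
    (finPolylogTwist k p d).eval x = x ^ p * finPolylog p d (1 - 1 / x) := by
  simp only [finPolylogTwist, finPolylog, eval_finsetSum, mul_sum]
  refine sum_congr rfl fun i hi => ?_
  have h : x ^ p = x ^ i * x ^ (p - i) := by
    rw [← pow_add, Nat.add_sub_cancel' (mem_Ico.mp hi).2.le]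
  have h2 : (1 - 1 / x) * x = x - 1 := by field_simp
  simp only [eval_mul, eval_C, eval_pow, eval_sub, eval_X, eval_one]
  rw [h, ← h2, mul_pow]
  ring

theorem natDegree_finPolylogPoly_lt (hp : 1 < p) (d : ℕ) :
    (finPolylogPoly k p d).natDegree ≤ p - 1 := by
  refine natDegree_sum_le_of_forall_le _ _ fun i hi => ?_
  refine (natDegree_C_mul_X_pow_le _ _).trans ?_
  have := mem_Ico.mp hi
  omega

theorem natDegree_finPolylogTwist_le (d : ℕ) : (finPolylogTwist k p d).natDegree ≤ p := by
  refine natDegree_sum_le_of_forall_le _ _ fun i hi => ?_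
  have := mem_Ico.mp hi
  refine (natDegree_C_mul_le _ _).trans (natDegree_mul_le.trans ?_)
  have h1 : ((X - 1 : k[X]) ^ i).natDegree ≤ i := by
    refine natDegree_pow_le.trans ?_
    have : (X - 1 : k[X]).natDegree ≤ 1 := by simpa using natDegree_X_sub_C_le (1 : k)
    nlinarith
  have h2 := natDegree_X_pow_le (R := k) (p - i)
  omega

variable [hp : Fact p.Prime] [CharP k p]

theorem sum_Ico_reflect_prime {M : Type*} [AddCommMonoid M] (f : ℕ → M) :
    ∑ i ∈ Ico 1 p, f (p - i) = ∑ i ∈ Ico 1 p, f i := by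
  refine sum_nbij' (fun i => p - i) (fun i => p - i) ?_ ?_ ?_ ?_ ?_ <;>
    intro i hi <;> have := mem_Ico.mp hi
  · exact mem_Ico.mpr (by omega)
  · exact mem_Ico.mpr (by omega)
  · omega
  · omega
  · rfl

omit hp in
theorem natCast_prime_sub {i : ℕ} (hi : i ≤ p) : ((p - i : ℕ) : k) = -(i : k) := by
  rw [Nat.cast_sub hi, CharP.cast_eq_zero, zero_sub]

omit hp in
theorem cast_ne_zero_of_mem_Ico {i : ℕ} (hi : i ∈ Ico 1 p) : (i : k) ≠ 0 := by
  rw [Ne, CharP.cast_eq_zero_iff k p]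
  exact Nat.not_dvd_of_pos_of_lt (mem_Ico.mp hi).1 (mem_Ico.mp hi).2

/-- Fermat's little theorem: reciprocal powers are values of polynomials, so that power sums over
the prime field apply. -/
theorem one_div_pow_eq_pow {i d : ℕ} (hi : i ∈ Ico 1 p) (hd : d ≤ p - 1) :
    1 / (i : k) ^ d = (i : k) ^ (p - 1 - d) := by
  have h0 := cast_ne_zero_of_mem_Ico (k := k) hi
  have h1 : (i : k) ^ (p - 1) = 1 := by
    have h2 : ((i : ℕ) : ZMod p) ≠ 0 := cast_ne_zero_of_mem_Ico hi
    have h3 := congrArg (ZMod.castHom (dvd_refl p) k) (ZMod.pow_card_sub_one_eq_one h2)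
    simpa using h3
  rw [div_eq_iff (pow_ne_zero _ h0), ← pow_add, Nat.sub_add_cancel hd, h1]

theorem sum_range_pow_eq_zero {r : ℕ} (hr : r < p - 1) : ∑ i ∈ range p, (i : k) ^ r = 0 := by
  have h1 : ∑ x : ZMod p, x ^ r = 0 := by
    refine FiniteField.sum_pow_lt_card_sub_one _ r ?_
    rwa [ZMod.card]
  have h2 : ∑ x : ZMod p, x ^ r = ∑ i ∈ range p, ((i : ℕ) : ZMod p) ^ r := by
    refine sum_bij' (fun x _ => x.val) (fun i _ => (i : ZMod p)) ?_ ?_ ?_ ?_ ?_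
    · intro x _; exact mem_range.mpr (ZMod.val_lt x)
    · intro i _; exact mem_univ _
    · intro x _; simp
    · intro i hi; exact ZMod.val_cast_of_lt (mem_range.mp hi)
    · intro x _; simp
  rw [h2] at h1
  simpa using congrArg (ZMod.castHom (dvd_refl p) k) h1

theorem sum_range_eval_eq_zero {f : k[X]} (hf : f.natDegree < p - 1) :
    ∑ i ∈ range p, f.eval (i : k) = 0 := by
  simp only [eval_eq_sum_range]
  rw [sum_comm]
  refine sum_eq_zero fun r hr => ?_
  rw [← mul_sum, sum_range_pow_eq_zero (by have := mem_range.mp hr; omega), mul_zero]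

theorem sum_Ico_one_div_pow_eq_zero {d : ℕ} (h0 : 0 < d) (hd : d < p - 1) :
    ∑ i ∈ Ico 1 p, 1 / (i : k) ^ d = 0 := by
  rw [sum_congr rfl fun i hi => one_div_pow_eq_pow (k := k) hi hd.le]
  have h := sum_range_pow_eq_zero (k := k) (p := p) (r := p - 1 - d) (by omega)
  rw [range_eq_Ico, sum_eq_sum_Ico_succ_bot hp.out.pos] at h
  rwa [Nat.cast_zero, zero_pow (by omega), zero_add, zero_add] at h

theorem finPolylog_one_right {d : ℕ} (h0 : 0 < d) (hd : d < p - 1) :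
    finPolylog p d (1 : k) = 0 := by
  simpa [finPolylog] using sum_Ico_one_div_pow_eq_zero (k := k) h0 hd

omit hp [CharP k p] in
theorem finPolylog_zero_right (d : ℕ) : finPolylog p d (0 : k) = 0 :=
  sum_eq_zero fun i hi => by
    rw [zero_pow (by have := mem_Ico.mp hi; omega), zero_div]

/-- Reversal i ↦ p - i, under which i^d is multiplied by (-1)^d in characteristic p. -/
theorem finPolylog_inv (d : ℕ) {x : k} (hx : x ≠ 0) :
    x ^ p * finPolylog p d (1 / x) = (-1) ^ d * finPolylog p d x := by
  rw [finPolylog, ← sum_Ico_reflect_prime, finPolylog, mul_sum, mul_sum]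
  refine sum_congr rfl fun i hi => ?_
  have h := (mem_Ico.mp hi).2.le
  rw [natCast_prime_sub h, neg_pow, one_div, inv_pow]
  have h2 : x ^ p = x ^ i * x ^ (p - i) := by rw [← pow_add, Nat.add_sub_cancel' h]
  have h3 : x ^ (p - i) ≠ 0 := pow_ne_zero _ hx
  have h4 := cast_ne_zero_of_mem_Ico (k := k) hi
  rw [h2]
  rcases neg_one_pow_eq_or k d with h5 | h5 <;> rw [h5] <;> field_simp

/-- The numbers 2i run through the even numbers between 0 and 2p. Those above p are p + i with i
odd, since p is odd. -/
theorem sum_filter_even_Ico {M : Type*} [AddCommMonoid M] (hp2 : p ≠ 2) (f : ℕ → M) :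
    ∑ i ∈ Ico 1 p, f (2 * i) = ∑ i ∈ Ico 1 p, if Even i then f i else f (p + i) := by
  have hodd : Odd p := hp.out.odd_of_ne_two hp2
  obtain ⟨n, hn⟩ := hodd
  refine sum_bij' (fun i _ => if 2 * i < p then 2 * i else 2 * i - p)
    (fun i _ => if Even i then i / 2 else (p + i) / 2) ?_ ?_ ?_ ?_ ?_ <;>
    intro i hi <;> have hi' := mem_Ico.mp hi
  · rw [mem_Ico]; split_ifs <;> omega
  · rw [mem_Ico]
    split_ifs with h
    · obtain ⟨j, rfl⟩ := h; omega
    · rw [Nat.not_even_iff_odd] at h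
      obtain ⟨j, rfl⟩ := h; omega
  · split_ifs with h1 h2 h2
    · omega
    · exact absurd (even_two_mul i) h2
    · obtain ⟨j, hj⟩ := h2; omega
    · omega
  · split_ifs with h1 h2 h2
    · obtain ⟨j, rfl⟩ := h1; omega
    · obtain ⟨j, rfl⟩ := h1; omega
    · omega
    · rw [Nat.not_even_iff_odd] at h1
      obtain ⟨j, rfl⟩ := h1; omega
  · split_ifs with h1 h2 h2
    · rfl
    · exact absurd (even_two_mul i) h2
    · obtain ⟨j, hj⟩ := h2; omega
    · congr 1; omega

/-- Doubling permutes the nonzero residues modulo p. An index p + i contributes x^p · x^i / i^d, and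
the even and odd parts of £_d(x) are half of £_d(x) ± £_d(-x). -/
theorem finPolylog_sq (hp2 : p ≠ 2) (d : ℕ) (x : k) :
    2 * finPolylog p d (x ^ 2) =
      2 ^ d * ((1 + x ^ p) * finPolylog p d x + (1 - x ^ p) * finPolylog p d (-x)) := by
  have h2 : (2 : k) ≠ 0 := by
    have : ((2 : ℕ) : k) ≠ 0 := cast_ne_zero_of_mem_Ico (p := p) (mem_Ico.mpr
      ⟨by norm_num, lt_of_le_of_ne hp.out.two_le (Ne.symm hp2)⟩)
    exact_mod_cast this
  have h1 : finPolylog p d (x ^ 2) = 2 ^ d * ∑ i ∈ Ico 1 p, x ^ (2 * i) / ((2 * i : ℕ) : k) ^ d := by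
    rw [finPolylog, mul_sum]
    refine sum_congr rfl fun i hi => ?_
    have h4 := cast_ne_zero_of_mem_Ico (k := k) hi
    push_cast
    rw [mul_pow, pow_mul]
    field_simp
  rw [h1, sum_filter_even_Ico hp2 fun i => x ^ i / (i : k) ^ d]
  simp only [finPolylog, mul_sum, ← sum_add_distrib]
  refine sum_congr rfl fun i hi => ?_
  split_ifs with h
  · rw [h.neg_pow]; ring
  · rw [Nat.not_even_iff_odd] at h
    rw [h.neg_pow, Nat.cast_add, CharP.cast_eq_zero, zero_add, pow_add]; ring

end

/-! ### Central binomial polynomials and differentiation in characteristic p -/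

section

open Polynomial

theorem one_sub_mul_sum_choose {R : Type*} [CommRing R] (x : R) (m N : ℕ) :
    (1 - x) * ∑ i ∈ range (N + 1), ((m + 1 + i).choose i : R) * x ^ i =
      ∑ i ∈ range (N + 1), ((m + i).choose i : R) * x ^ i
        - ((m + 1 + N).choose N : R) * x ^ (N + 1) := by
  induction N with
  | zero => simp
  | succ N ih =>
    rw [sum_range_succ, mul_add, ih, sum_range_succ _ (N + 1)]
    have h : ((m + 1 + (N + 1)).choose (N + 1) : R) =
        (m + 1 + N).choose N + (m + (N + 1)).choose (N + 1) := by
      rw [show m + 1 + (N + 1) = m + 1 + N + 1 by ring, Nat.choose_succ_succ,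
        show m + (N + 1) = m + 1 + N by ring]
      push_cast; ring
    rw [h]
    ring

/-- A truncated form of ∑ binom(2i,i) u^i = (1 - 4u)^(-1/2) at u = x(1-x), where the square root is
1 - 2x. For m = p - 1 the coefficients binom(p-1+i, i) with 0 < i < p are divisible by p, which
makes the right-hand side explicit modulo powers of p. -/
theorem one_sub_two_mul_sum_centralBinom {R : Type*} [CommRing R] (x : R) (m : ℕ) :
    (1 - 2 * x) * ∑ i ∈ range (m + 1), (i.centralBinom : R) * (x * (1 - x)) ^ i =
      2 * (1 - x) ^ (m + 1) * ∑ i ∈ range (m + 1), ((m + i).choose i : R) * x ^ i - 1 := by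
  induction m with
  | zero => simp; ring
  | succ m ih =>
    rw [sum_range_succ, mul_add, ih, pow_succ (1 - x) (m + 1)]
    have h := one_sub_mul_sum_choose x m (m + 1)
    rw [sum_range_succ (fun i => ((m + i).choose i : R) * x ^ i)] at h
    have h2 : ((m + 1).centralBinom : R) = 2 * ((m + (m + 1)).choose (m + 1) : R) := by
      have := Nat.succ_mul_centralBinom_succ m
      have h3 : (m + 1).centralBinom = 2 * (m + (m + 1)).choose (m + 1) := by
        rw [Nat.centralBinom, show 2 * (m + 1) = m + (m + 1) + 1 by ring, Nat.choose_succ_succ,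
          show m + (m + 1) = 2 * m + 1 by ring, Nat.choose_symm_half]
        ring
      rw [h3]; push_cast; ring
    have h4 : ((m + 1 + (m + 1)).choose (m + 1) : R) = ((m + 1).centralBinom : R) := by
      rw [Nat.centralBinom, show 2 * (m + 1) = m + 1 + (m + 1) by ring]
    rw [h4] at h
    rw [mul_pow]
    linear_combination (-2) * (1 - x) ^ (m + 1) * h + x ^ (m + 1) * (1 - x) ^ (m + 1) * h2

variable {k : Type*} [Field k] {p : ℕ}

/-- The polynomial `∑_{0 < i < p} binom(2i, i) (X (1 - X)) ^ i / i ^ d`. -/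
noncomputable def centralBinomPoly (k : Type*) [Field k] (p d : ℕ) : k[X] :=
  ∑ i ∈ Ico 1 p, C ((i.centralBinom : k) / (i : k) ^ d) * (X * (1 - X)) ^ i

theorem natDegree_centralBinomPoly_le (hp : 1 < p) (d : ℕ) :
    (centralBinomPoly k p d).natDegree ≤ 2 * p - 2 := by
  refine natDegree_sum_le_of_forall_le _ _ fun i hi => ?_
  have := mem_Ico.mp hi
  refine (natDegree_C_mul_le _ _).trans (natDegree_pow_le.trans ?_)
  have h1 : (X * (1 - X) : k[X]).natDegree ≤ 2 := by
    refine natDegree_mul_le.trans ?_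
    have h2 : (1 - X : k[X]).natDegree ≤ 1 := by
      rw [natDegree_sub]; simpa using natDegree_X_sub_C_le (1 : k)
    have h3 := natDegree_X_le (R := k)
    omega
  calc i * (X * (1 - X) : k[X]).natDegree ≤ i * 2 := Nat.mul_le_mul_left _ h1
    _ ≤ 2 * p - 2 := by omega

theorem eval_centralBinomPoly (d : ℕ) (x : k) :
    (centralBinomPoly k p d).eval x =
      ∑ i ∈ Ico 1 p, (i.centralBinom : k) * (x * (1 - x)) ^ i / (i : k) ^ d := by
  simp only [centralBinomPoly, eval_finsetSum]
  exact sum_congr rfl fun i _ => by simp; ring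

/-- The operator X(1-X) d/dX multiplies (X(1-X))^i by i(1 - 2X), so it lowers the weight by one. -/
theorem derivative_centralBinomPoly (h : ∀ i ∈ Ico 1 p, (i : k) ≠ 0) (d : ℕ) :
    X * (1 - X) * derivative (centralBinomPoly k p (d + 1)) =
      (1 - 2 * X) * centralBinomPoly k p d := by
  simp only [centralBinomPoly, derivative_sum, mul_sum]
  refine sum_congr rfl fun i hi => ?_
  have h0 := h i hi
  obtain ⟨j, rfl⟩ : ∃ j, i = j + 1 := ⟨i - 1, by have := mem_Ico.mp hi; omega⟩
  have h1 : ((j + 1 : ℕ).centralBinom : k) / ((j + 1 : ℕ) : k) ^ d =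
      ((j + 1 : ℕ).centralBinom : k) / ((j + 1 : ℕ) : k) ^ (d + 1) * ((j + 1 : ℕ) : k) := by
    field_simp
    ring
  rw [h1, derivative_C_mul, derivative_pow, C_mul]
  simp only [derivative_mul, derivative_sub, derivative_one, derivative_X, map_natCast,
    Nat.add_sub_cancel]
  ring

variable [hp : Fact p.Prime] [CharP k p]

theorem derivative_finPolylogPoly (d : ℕ) :
    X * derivative (finPolylogPoly k p (d + 1)) = finPolylogPoly k p d := by
  simp only [finPolylogPoly, derivative_sum, mul_sum]
  refine sum_congr rfl fun i hi => ?_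
  have h0 := cast_ne_zero_of_mem_Ico (k := k) hi
  obtain ⟨j, rfl⟩ : ∃ j, i = j + 1 := ⟨i - 1, by have := mem_Ico.mp hi; omega⟩
  have h1 : 1 / ((j + 1 : ℕ) : k) ^ d = 1 / ((j + 1 : ℕ) : k) ^ (d + 1) * ((j + 1 : ℕ) : k) := by
    field_simp
    ring
  rw [h1, derivative_C_mul, derivative_X_pow, C_mul]
  simp only [map_natCast, Nat.add_sub_cancel]
  ring

theorem one_sub_X_mul_finPolylogPoly_zero :
    (1 - X) * finPolylogPoly k p 0 = X - X ^ p := by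
  have h := mul_neg_geom_sum (X : k[X]) p
  rw [range_eq_Ico, sum_eq_sum_Ico_succ_bot hp.out.pos] at h
  have h1 : finPolylogPoly k p 0 = ∑ i ∈ Ico (0 + 1) p, X ^ i := by simp [finPolylogPoly]
  rw [h1]
  linear_combination h

theorem derivative_finPolylogPoly_one :
    X * (1 - X) * derivative (finPolylogPoly k p 1) = X - X ^ p := by
  have h := derivative_finPolylogPoly (k := k) (p := p) 0
  have h0 := one_sub_X_mul_finPolylogPoly_zero (k := k) (p := p)
  rw [zero_add] at h
  linear_combination (1 - X) * h + h0

theorem derivative_finPolylogPoly_comp (d : ℕ) :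
    (1 - X) * derivative ((finPolylogPoly k p (d + 1)).comp (1 - X)) =
      -(finPolylogPoly k p d).comp (1 - X) := by
  have h := congrArg (fun f => f.comp (1 - X)) (derivative_finPolylogPoly (k := k) (p := p) d)
  simp only [mul_comp, X_comp] at h
  rw [← h, derivative_comp]
  simp only [derivative_sub, derivative_one, derivative_X]
  ring

/-- The exponent p - i counts as -i, so the two terms of the product rule for (X-1)^i X^(p-i)
combine to i (X-1)^(i-1) X^(p-i-1). -/
theorem derivative_finPolylogTwist (d : ℕ) :
    X * (1 - X) * derivative (finPolylogTwist k p (d + 1)) = -finPolylogTwist k p d := by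
  simp only [finPolylogTwist, derivative_sum, mul_sum, ← sum_neg_distrib]
  refine sum_congr rfl fun i hi => ?_
  have h0 := cast_ne_zero_of_mem_Ico (k := k) hi
  have h4 := mem_Ico.mp hi
  obtain ⟨j, rfl⟩ : ∃ j, i = j + 1 := ⟨i - 1, by omega⟩
  obtain ⟨l, hl⟩ : ∃ l, p - (j + 1) = l + 1 := ⟨p - (j + 1) - 1, by omega⟩
  have h1 : 1 / ((j + 1 : ℕ) : k) ^ d = 1 / ((j + 1 : ℕ) : k) ^ (d + 1) * ((j + 1 : ℕ) : k) := by
    field_simp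
    ring
  have h5 : ((l + 1 : ℕ) : k[X]) = -((j + 1 : ℕ) : k[X]) := by
    rw [← hl, Nat.cast_sub h4.2.le, CharP.cast_eq_zero, zero_sub]
  rw [h1, derivative_C_mul, derivative_mul, derivative_pow, derivative_X_pow, C_mul, hl]
  simp only [map_natCast, Nat.add_sub_cancel, derivative_sub, derivative_one, derivative_X]
  rw [h5]
  ring

theorem finPolylogTwist_zero : finPolylogTwist k p 0 = X - X ^ p := by
  have h := (Commute.all (X - 1 : k[X]) X).geom_sum₂_mul p
  obtain ⟨n, hn⟩ : ∃ n, p = n + 1 := ⟨p - 1, by have := hp.out.pos; omega⟩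
  rw [range_eq_Ico, sum_eq_sum_Ico_succ_bot hp.out.pos] at h
  have h1 : finPolylogTwist k p 0 = X * ∑ i ∈ Ico (0 + 1) p, (X - 1) ^ i * X ^ (p - 1 - i) := by
    rw [finPolylogTwist, mul_sum]
    refine sum_congr rfl fun i hi => ?_
    have := mem_Ico.mp hi
    rw [show p - i = p - 1 - i + 1 by omega, pow_succ]
    simp; ring
  have h2 : ((X : k[X]) - 1) ^ p = X ^ p - 1 := by rw [sub_pow_char, one_pow]
  have h3 : (X : k[X]) ^ p = X * X ^ (p - 1 - 0) := by
    rw [← pow_succ', tsub_zero, Nat.sub_add_cancel hp.out.one_le]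
  rw [h2] at h
  rw [h1]
  linear_combination (-X) * h + h3

/-- A zero derivative in characteristic p leaves only exponents divisible by p; the degree bound
leaves n + 1 free coefficients. -/
theorem exists_expand_of_derivative {F : k[X]} (h : X * (1 - X) * derivative F = 0) {n : ℕ}
    (hF : F.natDegree < (n + 1) * p) : ∃ G : k[X], G.natDegree ≤ n ∧ F = expand k p G := by
  have hne : (X * (1 - X) : k[X]) ≠ 0 := by
    refine mul_ne_zero X_ne_zero fun h => ?_
    have := congrArg (eval 0) h
    simp at this
  have h1 : derivative F = 0 := (mul_eq_zero.mp h).resolve_left hne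
  have h2 := expand_contract p h1 hp.out.ne_zero
  refine ⟨contract p F, ?_, h2.symm⟩
  rw [← h2, natDegree_expand] at hF
  exact Nat.lt_succ_iff.mp (lt_of_mul_lt_mul_right hF (Nat.zero_le _))

/-- Below degree 2p only a constant and a multiple of X^p survive, and the values at 0 and 1 remove
both. The functional equations of weight one and two rest on this criterion. -/
theorem eq_zero_of_derivative {F : k[X]} (h : X * (1 - X) * derivative F = 0)
    (hF : F.natDegree < 2 * p) (h0 : F.eval 0 = 0) (h1 : F.eval 1 = 0) : F = 0 := by
  obtain ⟨G, hG, rfl⟩ := exists_expand_of_derivative (n := 1) h hF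
  rw [expand_eval, zero_pow hp.out.ne_zero] at h0
  rw [expand_eval, one_pow] at h1
  rw [eq_X_add_C_of_natDegree_le_one hG] at h0 h1 ⊢
  simp only [eval_add, eval_mul, eval_C, eval_X, mul_zero, zero_add, mul_one] at h0 h1
  rw [h0, add_zero] at h1
  rw [h0, h1]
  simp

theorem natDegree_finPolylogPoly_comp_le (d : ℕ) :
    ((finPolylogPoly k p d).comp (1 - X)).natDegree ≤ p - 1 := by
  refine natDegree_comp_le.trans ?_
  have h2 : (1 - X : k[X]).natDegree ≤ 1 := by
    rw [natDegree_sub]; simpa using natDegree_X_sub_C_le (1 : k)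
  have h1 := natDegree_finPolylogPoly_lt (k := k) hp.out.one_lt d
  calc _ ≤ (p - 1) * 1 := Nat.mul_le_mul h1 h2
    _ = p - 1 := mul_one _

theorem finPolylogTwist_eval_zero (d : ℕ) : (finPolylogTwist k p d).eval 0 = 0 := by
  simp only [finPolylogTwist, eval_finsetSum]
  refine sum_eq_zero fun i hi => ?_
  have := mem_Ico.mp hi
  simp [show p - i ≠ 0 by omega]

theorem finPolylogTwist_eval_one (d : ℕ) : (finPolylogTwist k p d).eval 1 = 0 := by
  simp only [finPolylogTwist, eval_finsetSum]
  refine sum_eq_zero fun i hi => ?_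
  have := mem_Ico.mp hi
  simp [show i ≠ 0 by omega]

/-! ### Functional equations in weights one and two -/

variable (hp3 : 3 < p)
include hp3

theorem finPolylogTwist_one : finPolylogTwist k p 1 = -finPolylogPoly k p 1 := by
  have hlt := natDegree_finPolylogPoly_lt (k := k) hp.out.one_lt 1
  have hle := natDegree_finPolylogTwist_le (k := k) (p := p) 1
  have : finPolylogTwist k p 1 + finPolylogPoly k p 1 = 0 := by
    refine eq_zero_of_derivative ?_ ?_ ?_ ?_
    · rw [derivative_add, mul_add, derivative_finPolylogTwist, derivative_finPolylogPoly_one,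
        finPolylogTwist_zero]
      ring
    · refine (natDegree_add_le _ _).trans_lt ?_
      rw [max_lt_iff]; omega
    · rw [eval_add, finPolylogTwist_eval_zero, eval_finPolylogPoly, finPolylog_zero_right, add_zero]
    · rw [eval_add, finPolylogTwist_eval_one, eval_finPolylogPoly,
        finPolylog_one_right (by omega) (by omega), add_zero]
  linear_combination this

theorem finPolylogPoly_one_comp :
    (finPolylogPoly k p 1).comp (1 - X) = finPolylogPoly k p 1 := by
  have hlt := natDegree_finPolylogPoly_lt (k := k) hp.out.one_lt 1
  have hle := natDegree_finPolylogPoly_comp_le (k := k) (p := p) 1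
  refine sub_eq_zero.mp (eq_zero_of_derivative ?_ ?_ ?_ ?_)
  · have h1 := derivative_finPolylogPoly_comp (k := k) (p := p) 0
    have h2 := congrArg (fun f => f.comp (1 - X)) (one_sub_X_mul_finPolylogPoly_zero (k := k) (p := p))
    simp only [mul_comp, sub_comp, X_comp, one_comp, pow_comp] at h2
    rw [sub_pow_char, one_pow] at h2
    rw [derivative_sub, mul_sub, derivative_finPolylogPoly_one]
    linear_combination X * h1 - h2
  · refine (natDegree_sub_le _ _).trans_lt ?_
    rw [max_lt_iff]; omega
  · simp [eval_comp, eval_finPolylogPoly, finPolylog_zero_right,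
      finPolylog_one_right (k := k) (p := p) one_pos (by omega)]
  · simp [eval_comp, eval_finPolylogPoly, finPolylog_zero_right,
      finPolylog_one_right (k := k) (p := p) one_pos (by omega)]

/-- Under X(1-X) d/dX all three terms become multiples of £_1, by the weight one symmetries under x
↦ 1 - x and x ↦ 1 - 1/x. -/
theorem finPolylogPoly_two_comp :
    (finPolylogPoly k p 2).comp (1 - X) = finPolylogPoly k p 2 - finPolylogTwist k p 2 := by
  have hlt := natDegree_finPolylogPoly_lt (k := k) hp.out.one_lt 2
  have hle := natDegree_finPolylogPoly_comp_le (k := k) (p := p) 2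
  have hle' := natDegree_finPolylogTwist_le (k := k) (p := p) 2
  refine sub_eq_zero.mp (eq_zero_of_derivative ?_ ?_ ?_ ?_)
  · have h1 := derivative_finPolylogPoly_comp (k := k) (p := p) 1
    have h2 := derivative_finPolylogTwist (k := k) (p := p) 1
    have h3 := derivative_finPolylogPoly (k := k) (p := p) 1
    rw [finPolylogPoly_one_comp hp3] at h1
    rw [finPolylogTwist_one hp3] at h2
    rw [derivative_sub, derivative_sub]
    linear_combination X * h1 - (1 - X) * h3 + h2
  · refine (natDegree_sub_le _ _).trans_lt ?_
    rw [max_lt_iff]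
    refine ⟨by omega, (natDegree_sub_le _ _).trans_lt ?_⟩
    rw [max_lt_iff]; omega
  · simp [eval_comp, eval_finPolylogPoly, finPolylog_zero_right, finPolylogTwist_eval_zero,
      finPolylog_one_right (k := k) (p := p) two_pos (by omega)]
  · simp [eval_comp, eval_finPolylogPoly, finPolylog_zero_right, finPolylogTwist_eval_one,
      finPolylog_one_right (k := k) (p := p) two_pos (by omega)]

theorem two_ne_zero_of_three_lt : (2 : k) ≠ 0 := by
  have : ((2 : ℕ) : k) ≠ 0 := cast_ne_zero_of_mem_Ico (p := p) (mem_Ico.mpr ⟨by omega, by omega⟩)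
  exact_mod_cast this

theorem three_ne_zero_of_three_lt : (3 : k) ≠ 0 := by
  have : ((3 : ℕ) : k) ≠ 0 := cast_ne_zero_of_mem_Ico (p := p) (mem_Ico.mpr ⟨by omega, by omega⟩)
  exact_mod_cast this

theorem natDegree_one_sub_X_pow_le (n : ℕ) : (1 - X ^ n : k[X]).natDegree ≤ n := by
  rw [natDegree_sub]
  simpa using natDegree_X_pow_sub_C (n := n) (r := (1 : k)) |>.le

/-- X^p is a constant for the derivation, and X(1-X) d/dX sends both sides to 2 (X - X^p) £_1. -/
theorem sq_finPolylogPoly_one :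
    finPolylogPoly k p 1 ^ 2 = -2 * ((1 - X ^ p) * (finPolylogPoly k p 2).comp (1 - X)
      + X ^ p * finPolylogPoly k p 2) := by
  have hlt := natDegree_finPolylogPoly_lt (k := k) hp.out.one_lt 1
  have hlt2 := natDegree_finPolylogPoly_lt (k := k) hp.out.one_lt 2
  have hle := natDegree_finPolylogPoly_comp_le (k := k) (p := p) 2
  refine sub_eq_zero.mp (eq_zero_of_derivative ?_ ?_ ?_ ?_)
  · have h1 := derivative_finPolylogPoly_comp (k := k) (p := p) 1
    have h2 := derivative_finPolylogPoly_one (k := k) (p := p)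
    have h3 := derivative_finPolylogPoly (k := k) (p := p) 1
    rw [finPolylogPoly_one_comp hp3] at h1
    -- The derivative of X^p carries the coefficient p, hence vanishes.
    have h4 : (C (p : k) : k[X]) = 0 := by simp
    simp only [derivative_sub, derivative_mul, derivative_add, derivative_pow, derivative_one,
      derivative_X, derivative_neg, derivative_ofNat, h4]
    simp only [Nat.cast_ofNat, C_ofNat]
    linear_combination 2 * finPolylogPoly k p 1 * h2 + 2 * X * (1 - X ^ p) * h1
      + 2 * (1 - X) * X ^ p * h3
  · refine (natDegree_sub_le _ _).trans_lt ?_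
    rw [max_lt_iff]
    constructor
    · refine natDegree_pow_le.trans_lt ?_
      have := hp.out.two_le
      omega
    · have e : (-2 : k[X]) = C (-2) := by rw [C_neg, map_ofNat]
      rw [e]
      refine (natDegree_C_mul_le _ _).trans_lt ((natDegree_add_le _ _).trans_lt ?_)
      rw [max_lt_iff]
      have h5 := natDegree_one_sub_X_pow_le (k := k) hp3 p
      have h6 := natDegree_X_pow_le (R := k) p
      constructor <;> refine natDegree_mul_le.trans_lt ?_ <;> omega
  · simp [eval_comp, eval_finPolylogPoly, finPolylog_zero_right,
      finPolylog_one_right (k := k) (p := p) two_pos (by omega), hp.out.ne_zero]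
  · simp [eval_comp, eval_finPolylogPoly, finPolylog_zero_right,
      finPolylog_one_right (k := k) (p := p) two_pos (by omega),
      finPolylog_one_right (k := k) (p := p) one_pos (by omega)]

end

/-! ### Harmonic sums modulo p and the interpolating Faulhaber polynomial -/

section

open Polynomial

/-- The generalized harmonic number `∑_{j = 1}^m 1 / j ^ d` in an arbitrary field. -/
def harmonicSum (F : Type*) [Field F] (d m : ℕ) : F := ∑ j ∈ range m, 1 / ((j + 1 : ℕ) : F) ^ d

theorem harmonicSum_zero {F : Type*} [Field F] (d : ℕ) : harmonicSum F d 0 = 0 := sum_range_zero _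

theorem harmonicSum_succ {F : Type*} [Field F] (d m : ℕ) :
    harmonicSum F d (m + 1) = harmonicSum F d m + 1 / ((m : F) + 1) ^ d := by
  rw [harmonicSum, sum_range_succ, Nat.cast_succ]; rfl

theorem harmonicSum_eq_sum_Ico {F : Type*} [Field F] (d m : ℕ) :
    harmonicSum F d m = ∑ j ∈ Ico 1 (m + 1), 1 / (j : F) ^ d := by
  rw [harmonicSum, sum_Ico_eq_sum_range]
  simp [add_comm]

variable {k : Type*} [Field k] {p : ℕ} [hp : Fact p.Prime] [CharP k p]

theorem eq_of_eval_natCast_eq {f g : k[X]} (hf : f.natDegree < p) (hg : g.natDegree < p)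
    (h : ∀ i < p, f.eval (i : k) = g.eval (i : k)) : f = g := by
  classical
  rw [← sub_eq_zero]
  by_contra hne
  have h1 : ((range p).image (fun i : ℕ => (i : k))).card = p := by
    rw [card_image_of_injOn, card_range]
    intro i hi j hj hij
    have hi' := mem_range.mp (mem_coe.mp hi)
    have hj' := mem_range.mp (mem_coe.mp hj)
    exact (CharP.natCast_injOn_Iio k p) hi' hj' hij
  have h2 : ((range p).image (fun i : ℕ => (i : k))).card ≤ (f - g).natDegree := by
    refine card_le_degree_of_subset_roots fun x hx => ?_
    obtain ⟨i, hi, rfl⟩ := mem_image.mp (mem_val.mp hx)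
    rw [mem_roots hne, IsRoot, eval_sub, h i (mem_range.mp hi), sub_self]
  have h3 := natDegree_sub_le f g
  have h4 : max f.natDegree g.natDegree < p := max_lt hf hg
  omega

/-- The polynomial `f` over a field of characteristic `p` interpolates `∑_{j < m} j ^ (p - 3)`,
and `b = f'(0)` is the reduction of the Bernoulli number of index `p - 3`. -/
structure IsFaulhaber (p : ℕ) (f : k[X]) (b : k) : Prop where
  natDegree_le : f.natDegree ≤ p - 2
  eval_natCast (m : ℕ) : f.eval (m : k) = ∑ j ∈ range m, (j : k) ^ (p - 3)
  eval_derivative_zero : (derivative f).eval 0 = b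

variable {K : Type*} [Field K] [CharZero K] {V : ValuationSubring K} {ρ : V →+* k}
  [IsLocalHom ρ]

/-- Solving the recursion for B_n divides only by n + 1 < p, so no denominator divisible by p ever
arises. -/
theorem exists_red_bernoulli {n : ℕ} (hn : n + 1 < p) : ∃ a, Red ρ ((_root_.bernoulli n : ℚ) : K) a := by
  induction n using Nat.strong_induction_on with
  | _ n ih =>
    have h := _root_.sum_bernoulli (n + 1)
    rw [sum_range_succ, Nat.choose_succ_self_right] at h
    have h0 : ((n + 1 : ℕ) : k) ≠ 0 := natCast_ne_zero_of_lt (p := p) n.succ_pos hn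
    have h0' : ((n + 1 : ℕ) : ℚ) ≠ 0 := by positivity
    have h1 : _root_.bernoulli n = ((if n + 1 = 1 then (1 : ℚ) else 0) -
        ∑ i ∈ range n, ((n + 1).choose i : ℚ) * _root_.bernoulli i) / ((n + 1 : ℕ) : ℚ) := by
      rw [eq_div_iff h0', ← h]; ring
    choose! β hβ using fun i (hi : i < n) => ih i hi (by omega)
    have h2 : Red ρ (((if n + 1 = 1 then (1 : ℚ) else 0 : ℚ)) : K)
        (if n + 1 = 1 then (1 : k) else 0) := by
      split_ifs
      · exact Red.one.congr (by simp) rfl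
      · exact Red.zero.congr (by simp) rfl
    have h3 := (h2.sub (Red.sum (s := range n) fun i hi =>
      (Red.natCast ((n + 1).choose i)).mul (hβ i (mem_range.mp hi)))).div
        (Red.natCast (n + 1)) h0
    refine ⟨_, h3.congr ?_ rfl⟩
    rw [h1]; push_cast; rfl

/-- f is the reduction of B_{p-2}(X) / (p-2). Its constant term disappears because p - 2 is odd and
greater than 1, its linear coefficient is B_{p-3}, and p - 2 = -2 in `k` accounts for the factor at
1/3. -/
theorem exists_isFaulhaber (hp3 : 3 < p) : ∃ (f : k[X]) (b : k), IsFaulhaber p f b ∧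
    Red ρ ((_root_.bernoulli (p - 3) : ℚ) : K) b ∧
    Red ρ ((bernoulliThird (p - 2) : ℚ) : K) (-2 * f.eval (1 / 3)) := by
  obtain ⟨N, hN⟩ : ∃ N, p = N + 3 := ⟨p - 3, by omega⟩
  have hN1 : p - 2 = N + 1 := by omega
  have hN2 : p - 3 = N := by omega
  rw [hN1, hN2]
  choose! β hβ using fun i (hi : i < N + 2) =>
    exists_red_bernoulli (ρ := ρ) (p := p) (n := i) (by omega)
  have hc : ((N + 1 : ℕ) : k) ≠ 0 := natCast_ne_zero_of_lt (p := p) N.succ_pos (by omega)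
  have hc' : ((N + 1 : ℕ) : k) = -2 := by
    have : ((N + 3 : ℕ) : k) = 0 := by rw [← hN, CharP.cast_eq_zero]
    push_cast at this ⊢
    linear_combination this
  have hodd : Odd (N + 1) := by
    have := hp.out.odd_of_ne_two (by omega)
    rw [hN] at this
    rcases this with ⟨t, ht⟩
    exact ⟨t - 1, by omega⟩
  have hzero : _root_.bernoulli (N + 1) = 0 := bernoulli_eq_zero_of_odd hodd (by omega)
  set f : k[X] := ∑ i ∈ range (N + 1),
    C (β i * ((N + 1).choose i : k) / ((N + 1 : ℕ) : k)) * X ^ (N + 1 - i) with hf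
  have heval : ∀ (x : ℚ) (a : k), Red ρ ((x : ℚ) : K) a →
      Red ρ (((Polynomial.bernoulli (N + 1)).eval x : ℚ) : K) (((N + 1 : ℕ) : k) * f.eval a) := by
    intro x a hx
    have h1 : (Polynomial.bernoulli (N + 1)).eval x =
        ∑ i ∈ range (N + 1), _root_.bernoulli i * ((N + 1).choose i : ℚ) * x ^ (N + 1 - i) := by
      rw [Polynomial.bernoulli, eval_finsetSum, sum_range_succ, hzero]
      simp
    have h2 : ((N + 1 : ℕ) : k) * f.eval a =
        ∑ i ∈ range (N + 1), β i * ((N + 1).choose i : k) * a ^ (N + 1 - i) := by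
      rw [hf, eval_finsetSum, mul_sum]
      refine sum_congr rfl fun i _ => ?_
      simp only [eval_mul, eval_C, eval_pow, eval_X]
      field_simp
    rw [h1, h2]
    refine Red.congr (Red.sum (s := range (N + 1)) fun i hi =>
      ((hβ i (by have := mem_range.mp hi; omega)).mul
        (Red.natCast ((N + 1).choose i))).mul (hx.pow (N + 1 - i))) ?_ rfl
    push_cast; rfl
  refine ⟨f, β N, ⟨?_, fun m => ?_, ?_⟩, hβ N (by omega), ?_⟩
  · rw [hN1]
    refine natDegree_sum_le_of_forall_le _ _ fun i hi => (natDegree_C_mul_X_pow_le _ _).trans ?_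
    omega
  · have h1 := sum_range_pow_eq_bernoulli_sub m N
    rw [Nat.succ_eq_add_one, hzero, sub_zero] at h1
    have h2 := heval m m ((Red.natCast m).congr (by push_cast; rfl) rfl)
    rw [← h1] at h2
    have h3 : Red ρ ((((N : ℚ) + 1) * ∑ j ∈ range m, (j : ℚ) ^ N : ℚ) : K)
        (((N + 1 : ℕ) : k) * ∑ j ∈ range m, (j : k) ^ N) :=
      ((Red.natCast (N + 1)).mul (Red.sum fun j _ => (Red.natCast j).pow N)).congr
        (by push_cast; rfl) rfl
    rw [hN2]
    exact mul_left_cancel₀ hc (h2.unique h3)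
  · have h1 : (derivative f).eval 0 = f.coeff 1 := by
      rw [← coeff_zero_eq_eval_zero, coeff_derivative]; simp
    rw [h1, hf, finsetSum_coeff]
    simp only [coeff_C_mul, coeff_X_pow]
    rw [sum_eq_single N]
    · simp only [Nat.add_sub_cancel_left, if_true, mul_one, Nat.choose_succ_self_right]
      field_simp
    · intro i hi hne
      have := mem_range.mp hi
      rw [if_neg (by omega), mul_zero]
    · intro h; exact absurd (mem_range.mpr (by omega)) h
  · have h3 : (3 : k) ≠ 0 := three_ne_zero_of_three_lt (p := p) hp3
    rw [bernoulliThird, ← hc']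
    exact heval _ _ ((Red.one.div (Red.ofNat 3) h3).congr (by push_cast; rfl) rfl)

variable {f : k[X]} {b : k} (hp3 : 3 < p)
include hp3

theorem harmonicSum_prime_sub_one {d : ℕ} (h0 : 0 < d) (hd : d < p - 1) :
    harmonicSum k d (p - 1) = 0 := by
  rw [harmonicSum_eq_sum_Ico, Nat.sub_add_cancel hp.out.one_le]
  exact sum_Ico_one_div_pow_eq_zero h0 hd

/-- The full sum up to p - 1 vanishes, so a lower part is minus the complementary upper part, and j
↦ p - j carries the upper part to the first m terms. -/
theorem harmonicSum_reflect {d m : ℕ} (h0 : 0 < d) (hd : d < p - 1) (hm : m < p) :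
    harmonicSum k d (p - 1 - m) = -(-1) ^ d * harmonicSum k d m := by
  induction m with
  | zero => rw [tsub_zero, harmonicSum_prime_sub_one hp3 h0 hd, harmonicSum_zero, mul_zero]
  | succ m ih =>
    have h1 := ih (by omega)
    rw [show p - 1 - m = p - 1 - (m + 1) + 1 by omega, harmonicSum_succ] at h1
    have h2 : (((p - 1 - (m + 1) : ℕ) : k) + 1) = -((m : k) + 1) := by
      rw [← Nat.cast_succ, show (p - 1 - (m + 1)).succ = p - (m + 1) by omega,
        natCast_prime_sub (by omega)]
      push_cast; ring
    have h3 : ((m : k) + 1) ≠ 0 := by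
      have := natCast_ne_zero_of_lt (k := k) (p := p) m.succ_pos hm
      push_cast at this; exact this
    rw [h2, neg_pow] at h1
    rw [harmonicSum_succ, mul_add, ← h1]
    rcases neg_one_pow_eq_or k d with h5 | h5 <;> rw [h5] <;> field_simp <;> ring

/-- For a polynomial `f` of degree below `p`, the sum of `f m / (m - c)` over the elements
`m ≠ c` of the prime field is `-f'(c)`. -/
theorem sum_eval_div_sub {g : k[X]} (hg : g.natDegree < p) {c : ℕ} (hc : c < p) :
    ∑ m ∈ (range p).erase c, g.eval (m : k) / ((m : k) - c) = -(derivative g).eval (c : k) := by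
  -- Write g - g(c) = (X - c) h. The degree of h is below p - 1, so its values over the prime field
  -- sum to 0; omitting m = c leaves -h(c), and h(c) = g'(c).
  have hroot : (g - C (g.eval (c : k))).IsRoot (c : k) := by simp
  obtain ⟨h, hh⟩ := dvd_iff_isRoot.mpr hroot
  have hdeg : h.natDegree < p - 1 := by
    by_cases h0 : h = 0
    · rw [h0, natDegree_zero]; omega
    · have h1 : (g - C (g.eval (c : k))).natDegree = 1 + h.natDegree := by
        rw [hh, natDegree_mul (X_sub_C_ne_zero _) h0, natDegree_X_sub_C]
      rw [natDegree_sub_C] at h1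
      omega
  have hderiv : (derivative g).eval (c : k) = h.eval (c : k) := by
    have := congrArg (fun q => (derivative q).eval (c : k)) hh
    simpa using this
  have hne : ∀ m ∈ (range p).erase c, (m : k) - c ≠ 0 := by
    intro m hm h0
    obtain ⟨h1, h2⟩ := mem_erase.mp hm
    exact h1 ((CharP.natCast_injOn_Iio k p) (mem_range.mp h2) hc (sub_eq_zero.mp h0))
  have hval : ∀ m ∈ (range p).erase c, g.eval (m : k) / ((m : k) - c) =
      h.eval (m : k) + g.eval (c : k) * (1 / ((m : k) - c)) := by
    intro m hm
    have h1 := congrArg (eval (m : k)) hh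
    simp only [eval_sub, eval_C, eval_mul, eval_X] at h1
    have h2 := hne m hm
    field_simp
    linear_combination h1
  have hsum := sum_range_eval_eq_zero hdeg
  rw [← add_sum_erase _ _ (mem_range.mpr hc)] at hsum
  -- Here 1/(m - c) = (m - c)^(p-2), again a polynomial of degree below p - 1, with value 0 at the
  -- omitted point.
  have hinv : ∑ m ∈ (range p).erase c, 1 / ((m : k) - c) = 0 := by
    have h1 : ∀ m ∈ (range p).erase c, 1 / ((m : k) - c) =
        (C 1 * (X - C (c : k)) ^ (p - 2)).eval (m : k) := by
      intro m hm
      have h2 := hne m hm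
      have h3 : ((m : k) - c) ^ (p - 1) = 1 := by
        have h4 : ((m : ZMod p) - (c : ZMod p)) ≠ 0 := by
          intro h5
          apply h2
          have := congrArg (ZMod.castHom (dvd_refl p) k) h5
          simpa using this
        have := congrArg (ZMod.castHom (dvd_refl p) k) (ZMod.pow_card_sub_one_eq_one h4)
        simpa using this
      simp only [C_1, one_mul, eval_pow, eval_sub, eval_X, eval_C]
      rw [div_eq_iff h2, ← pow_succ, show p - 2 + 1 = p - 1 by omega, h3]
    rw [sum_congr rfl h1]
    have h2 := sum_range_eval_eq_zero (k := k) (p := p) (f := C 1 * (X - C (c : k)) ^ (p - 2)) (by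
      rw [C_1, one_mul, natDegree_pow, natDegree_X_sub_C]; omega)
    rw [← add_sum_erase _ _ (mem_range.mpr hc)] at h2
    have h6 : p - 2 ≠ 0 := by omega
    simpa [h6] using h2
  rw [sum_congr rfl hval, sum_add_distrib, ← mul_sum, hinv, mul_zero, add_zero, hderiv]
  linear_combination hsum

namespace IsFaulhaber

variable (hf : IsFaulhaber p f b)
include hf

theorem eval_succ {m : ℕ} (hm : m < p) : f.eval ((m : k) + 1) = harmonicSum k 2 m := by
  rw [← Nat.cast_succ, hf.eval_natCast, sum_range_succ', harmonicSum, Nat.cast_zero,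
    zero_pow (by omega), add_zero]
  refine sum_congr rfl fun j hj => ?_
  have := mem_range.mp hj
  rw [one_div_pow_eq_pow (p := p) (mem_Ico.mpr ⟨by omega, by omega⟩) (by omega),
    show p - 1 - 2 = p - 3 by omega]

/-- Since f(m) = H_{m-1}(2), this is the sum of f(m)/(m - c) at c = 0, which equals -f'(0). -/
theorem sum_harmonicSum_two_div : ∑ m ∈ Ico 1 p, harmonicSum k 2 (m - 1) / (m : k) = -b := by
  have h := sum_eval_div_sub hp3 (g := f) (by have := hf.natDegree_le; omega) hp.out.pos
  rw [Nat.cast_zero, hf.eval_derivative_zero] at h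
  rw [← h]
  have h1 : (range p).erase 0 = Ico 1 p := by ext i; simp; omega
  rw [h1]
  refine sum_congr rfl fun m hm => ?_
  have := mem_Ico.mp hm
  rw [← hf.eval_succ hp3 (m := m - 1) (by omega), sub_zero, ← Nat.cast_succ]
  congr 4
  omega

theorem comp_add_one : f.comp (X + 1) = f + X ^ (p - 3) := by
  have h1 := hf.natDegree_le
  refine eq_of_eval_natCast_eq (p := p) ?_ ?_ fun i _ => ?_
  · refine natDegree_comp_le.trans_lt ?_
    have : (X + 1 : k[X]).natDegree ≤ 1 := by simpa using (natDegree_X_add_C (1 : k)).le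
    calc f.natDegree * (X + 1 : k[X]).natDegree ≤ f.natDegree * 1 := Nat.mul_le_mul_left _ this
      _ < p := by omega
  · refine (natDegree_add_le _ _).trans_lt (max_lt (by omega) ?_)
    rw [natDegree_X_pow]; omega
  · have h2 := hf.eval_natCast (i + 1)
    rw [sum_range_succ, ← hf.eval_natCast, Nat.cast_succ] at h2
    simpa [eval_comp] using h2

theorem eval_add_one (x : k) : f.eval (x + 1) = f.eval x + x ^ (p - 3) := by
  have := congrArg (eval x) (hf.comp_add_one hp3)
  simpa [eval_comp] using this

theorem eval_derivative_add_one (x : k) :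
    (derivative f).eval (x + 1) = (derivative f).eval x - 3 * x ^ (p - 4) := by
  have := congrArg (fun q => (derivative q).eval x) (hf.comp_add_one hp3)
  simp only [derivative_comp, derivative_add, derivative_X, derivative_one, add_zero, eval_mul,
    eval_comp, eval_add, eval_X, eval_one, derivative_X_pow, eval_pow,
    one_mul, eval_C] at this
  rw [this, natCast_prime_sub (by omega), show p - 3 - 1 = p - 4 by omega]
  push_cast; ring

/-- A distribution relation: since 2^(p-3) = 1/4, the polynomial f(X/2) + f((X+1)/2) - 4 f(X) is
invariant under X ↦ X + 1, hence constant. Its derivative at 0 reads (b + f'(1/2))/2 = 4b. -/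
theorem eval_derivative_half : (derivative f).eval (1 / 2 : k) = 7 * b := by
  have h2 : (2 : k) ≠ 0 := two_ne_zero_of_three_lt (p := p) hp3
  have hdeg := hf.natDegree_le
  set g : k[X] := f.comp (C (1 / 2) * X) + f.comp (C (1 / 2) * X + C (1 / 2)) - 4 * f with hg
  have hdegc : ∀ q : k[X], q.natDegree ≤ 1 → (f.comp q).natDegree < p := by
    intro q hq
    refine natDegree_comp_le.trans_lt ?_
    calc f.natDegree * q.natDegree ≤ f.natDegree * 1 := Nat.mul_le_mul_left _ hq
      _ < p := by omega
  have h4 : (2 : k) ^ (p - 3) * 4 = 1 := by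
    have h5 := one_div_pow_eq_pow (k := k) (p := p) (i := 2) (d := 2)
      (mem_Ico.mpr ⟨by omega, by omega⟩) (by omega)
    rw [show p - 1 - 2 = p - 3 by omega] at h5
    push_cast at h5
    rw [← h5]; field_simp; norm_num
  have hpow : ∀ y : k, (1 / 2 * y) ^ (p - 3) = 4 * y ^ (p - 3) := by
    intro y
    rw [mul_pow, one_div, inv_pow]
    have : (2 : k) ^ (p - 3) ≠ 0 := pow_ne_zero _ h2
    field_simp
    linear_combination (-y ^ (p - 3)) * h4
  have hstep : ∀ i : ℕ, g.eval (i : k) = g.eval 0 := by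
    intro i
    induction i with
    | zero => simp
    | succ i ih =>
      rw [← ih]
      simp only [hg, eval_add, eval_sub, eval_mul, eval_comp, eval_C, eval_X, eval_ofNat]
      have e1 : (1 / 2 * ((i + 1 : ℕ) : k) + 1 / 2) = 1 / 2 * (i : k) + 1 := by
        push_cast; field_simp; ring
      have e2 : (1 / 2 * ((i + 1 : ℕ) : k)) = 1 / 2 * (i : k) + 1 / 2 := by
        push_cast; ring
      rw [e1, e2, hf.eval_add_one hp3, Nat.cast_succ, hf.eval_add_one hp3, hpow]
      ring
  have hconst : g = C (g.eval 0) := by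
    refine eq_of_eval_natCast_eq (p := p) ?_ (by rw [natDegree_C]; omega) fun i _ => ?_
    · refine (natDegree_sub_le _ _).trans_lt (max_lt ?_ ?_)
      · refine (natDegree_add_le _ _).trans_lt (max_lt (hdegc _ ?_) (hdegc _ ?_))
        · exact (natDegree_C_mul_le _ _).trans natDegree_X_le
        · exact natDegree_linear_le
      · have e : (4 : k[X]) = C 4 := by rw [map_ofNat]
        rw [e]
        exact (natDegree_C_mul_le _ _).trans_lt (by omega)
    · rw [hstep, eval_C]
  have h6 := congrArg (fun q => (derivative q).eval 0) hconst
  simp only [hg, derivative_sub, derivative_add, derivative_comp, derivative_mul, derivative_C,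
    derivative_X, eval_sub, eval_add, eval_mul, eval_comp, eval_C, eval_X, derivative_ofNat,
    eval_ofNat, mul_zero, zero_add, add_zero, zero_mul, mul_one, Polynomial.eval_zero,
    hf.eval_derivative_zero] at h6
  field_simp at h6
  simp only [one_div]
  rw [one_div] at h6
  linear_combination h6

/-- Differentiating f(X+1) = f(X) + X^(p-3) gives f'(m+1) = b - 3 H_m(3). At m = (p-1)/2 the
argument is 1/2, where f' is 7b. -/
theorem harmonicSum_three_half {n : ℕ} (hn : p = 2 * n + 1) : harmonicSum k 3 n = -2 * b := by
  have h3 : (3 : k) ≠ 0 := three_ne_zero_of_three_lt (p := p) hp3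
  have h1 : ∀ m < p, (derivative f).eval ((m : k) + 1) = b - 3 * harmonicSum k 3 m := by
    intro m
    induction m with
    | zero =>
      intro _
      rw [hf.eval_derivative_add_one hp3, Nat.cast_zero, hf.eval_derivative_zero,
        harmonicSum_zero, zero_pow (by omega)]
      
    | succ m ih =>
      intro hm
      rw [hf.eval_derivative_add_one hp3, Nat.cast_succ, ih (by omega), harmonicSum_succ]
      have := one_div_pow_eq_pow (k := k) (p := p) (i := m + 1) (d := 3)
        (mem_Ico.mpr ⟨by omega, by omega⟩) (by omega)
      rw [show p - 1 - 3 = p - 4 by omega, Nat.cast_succ] at this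
      rw [this]; ring
  have h2 := h1 n (by omega)
  have h4 : (n : k) + 1 = 1 / 2 := by
    have h5 : ((2 * n + 1 : ℕ) : k) = 0 := by rw [← hn, CharP.cast_eq_zero]
    have h6 : (2 : k) ≠ 0 := two_ne_zero_of_three_lt (p := p) hp3
    push_cast at h5
    field_simp
    linear_combination h5
  rw [h4, hf.eval_derivative_half hp3] at h2
  apply mul_left_cancel₀ h3
  linear_combination h2

end IsFaulhaber

end

/-! ### The weight three relation, and central binomial polynomials modulo p -/

section

open Polynomial

theorem sum_harmonicSum_mul {F : Type*} [Field F] (m : ℕ) :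
    ∑ i ∈ Ico 1 (m + 1), (harmonicSum F 1 i / (i : F) ^ 2 + harmonicSum F 2 (i - 1) / (i : F)) =
      harmonicSum F 1 m * harmonicSum F 2 m := by
  induction m with
  | zero => simp [harmonicSum_zero]
  | succ m ih =>
    rw [sum_Ico_succ_top (by omega), ih, Nat.add_sub_cancel, harmonicSum_succ, harmonicSum_succ,
      Nat.cast_succ]
    ring

variable {k : Type*} [Field k] {p : ℕ} [hp : Fact p.Prime] [CharP k p]

theorem coeff_finPolylogPoly (d i : ℕ) :
    (finPolylogPoly k p d).coeff i = if i ∈ Ico 1 p then 1 / (i : k) ^ d else 0 := by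
  simp only [finPolylogPoly, finsetSum_coeff, coeff_C_mul, coeff_X_pow, mul_ite, mul_one, mul_zero]
  rw [sum_ite_eq]

/-- Partial fractions: 1/(i(m-i)) = (1/i + 1/(m-i))/m. -/
theorem coeff_finPolylogPoly_one_sq {m : ℕ} (h0 : 0 < m) (hm : m < p) :
    (finPolylogPoly k p 1 ^ 2).coeff m = 2 * harmonicSum k 1 (m - 1) / (m : k) := by
  have hm0 : (m : k) ≠ 0 := natCast_ne_zero_of_lt (p := p) h0 hm
  rw [sq, coeff_mul, Nat.sum_antidiagonal_eq_sum_range_succ_mk, sum_range_succ, range_eq_Ico,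
    sum_eq_sum_Ico_succ_bot h0]
  simp only [coeff_finPolylogPoly]
  have h1 : ∀ i ∈ Ico 1 m, ((if i ∈ Ico 1 p then 1 / (i : k) ^ 1 else 0) *
      (if m - i ∈ Ico 1 p then 1 / ((m - i : ℕ) : k) ^ 1 else 0)) =
      1 / (m : k) * (1 / (i : k) ^ 1 + 1 / ((m - i : ℕ) : k) ^ 1) := by
    intro i hi
    have h2 := mem_Ico.mp hi
    have h3 : (i : k) ≠ 0 := natCast_ne_zero_of_lt (p := p) h2.1 (by omega)
    have h4 : ((m - i : ℕ) : k) ≠ 0 := natCast_ne_zero_of_lt (p := p) (by omega) (by omega)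
    have h5 : (m : k) = i + (m - i : ℕ) := by rw [← Nat.cast_add, Nat.add_sub_cancel' h2.2.le]
    rw [if_pos (mem_Ico.mpr ⟨h2.1, by omega⟩), if_pos (mem_Ico.mpr ⟨by omega, by omega⟩)]
    field_simp
    linear_combination h5
  have h6 : ∑ i ∈ Ico 1 m, 1 / ((m - i : ℕ) : k) ^ 1 = ∑ i ∈ Ico 1 m, 1 / (i : k) ^ 1 := by
    have := sum_Ico_reflect (fun i => 1 / (i : k) ^ 1) 1 (m := m) (n := m) (by omega)
    rw [this, show m + 1 - m = 1 by omega, Nat.add_sub_cancel]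
  rw [zero_add, sum_congr rfl h1, ← mul_sum, sum_add_distrib, h6, harmonicSum_eq_sum_Ico,
    Nat.sub_add_cancel h0]
  simp
  field_simp
  ring

variable {f : k[X]} {b : k} (hp3 : 3 < p)
include hp3

/-- The coefficient is ∑ (1/i) · 2 H_{p-i-1}(1)/(p-i), and reflection turns it into -2 ∑ H_i(1)/i².
Summation by parts identifies ∑ H_i(1)/i² with -∑ H_{i-1}(2)/i = b, because H_{p-1}(1) = 0. -/
theorem coeff_finPolylogPoly_one_cube (hf : IsFaulhaber p f b) :
    (finPolylogPoly k p 1 ^ 3).coeff p = -2 * b := by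
  have h1 := hf.sum_harmonicSum_two_div hp3
  have h2 := sum_harmonicSum_mul (F := k) (p - 1)
  rw [harmonicSum_prime_sub_one hp3 one_pos (by omega), zero_mul, sum_add_distrib,
    Nat.sub_add_cancel hp.out.one_le, h1] at h2
  rw [pow_succ', coeff_mul, Nat.sum_antidiagonal_eq_sum_range_succ_mk, sum_range_succ,
    range_eq_Ico, sum_eq_sum_Ico_succ_bot hp.out.pos]
  have h3 : ∀ i ∈ Ico (0 + 1) p, (finPolylogPoly k p 1).coeff i *
      (finPolylogPoly k p 1 ^ 2).coeff (p - i) = -2 * (harmonicSum k 1 i / (i : k) ^ 2) := by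
    intro i hi
    have hi' := mem_Ico.mp hi
    have h0 := cast_ne_zero_of_mem_Ico (k := k) hi
    rw [coeff_finPolylogPoly, if_pos hi, coeff_finPolylogPoly_one_sq (by omega) (by omega),
      natCast_prime_sub hi'.2.le, show p - i - 1 = p - 1 - i by omega,
      harmonicSum_reflect hp3 one_pos (by omega) hi'.2]
    field_simp
  simp only
  rw [sum_congr rfl h3, ← mul_sum, coeff_finPolylogPoly, coeff_finPolylogPoly]
  simp
  left
  linear_combination h2

/-- The coefficient of X^p is ∑ 1/i^d = 0. The strict bound keeps the product with X^p (1 - X^p)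
below degree 3p in the weight three relation. -/
theorem natDegree_finPolylogTwist_lt {d : ℕ} (h0 : 0 < d) (hd : d < p - 1) :
    (finPolylogTwist k p d).natDegree < p := by
  have h1 : (finPolylogTwist k p d).coeff p = 0 := by
    rw [finPolylogTwist, finsetSum_coeff, ← sum_Ico_one_div_pow_eq_zero (k := k) h0 hd]
    refine sum_congr rfl fun i hi => ?_
    have hm : (X - 1 : k[X]).Monic := by simpa using monic_X_sub_C (1 : k)
    have h2 : (((X - 1 : k[X]) ^ i * X ^ (p - i)).natDegree) = p := by
      rw [Monic.natDegree_mul (hm.pow i) (monic_X_pow _)]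
      have h3 : (X - 1 : k[X]).natDegree = 1 := by simpa using natDegree_X_sub_C (1 : k)
      rw [natDegree_pow, h3, natDegree_X_pow]
      have := mem_Ico.mp hi
      omega
    have h4 : ((X - 1 : k[X]) ^ i * X ^ (p - i)).Monic :=
      (hm.pow i).mul (monic_X_pow _)
    have h5 := h4.coeff_natDegree
    rw [h2] at h5
    rw [coeff_C_mul, h5, mul_one]
  refine lt_of_le_of_ne (natDegree_finPolylogTwist_le d) fun h2 => ?_
  have h3 : (finPolylogTwist k p d).leadingCoeff = 0 := by rw [leadingCoeff, h2, h1]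
  rw [leadingCoeff_eq_zero] at h3
  rw [h3, natDegree_zero] at h2
  exact hp.out.ne_zero h2.symm

/-- By the lower weight relations the left side has zero derivative. Its degree is below 3p, so it
is a quadratic in X^p; this quadratic vanishes at 0 and 1, and its linear coefficient is the
remaining unknown. -/
theorem finPolylogPoly_three_relation (hf : IsFaulhaber p f b) :
    X ^ p * finPolylogPoly k p 3 + (1 - X ^ p) * (finPolylogPoly k p 3).comp (1 - X)
      + X ^ p * (1 - X ^ p) * finPolylogTwist k p 3 - C (1 / 6) * finPolylogPoly k p 1 ^ 3
      = C (b / 3) * (X ^ p * (1 - X ^ p)) := by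
  have hk2 : (2 : k) ≠ 0 := two_ne_zero_of_three_lt (p := p) hp3
  have hk3 : (3 : k) ≠ 0 := three_ne_zero_of_three_lt (p := p) hp3
  have hL1 := natDegree_finPolylogPoly_lt (k := k) hp.out.one_lt 1
  have hL3 := natDegree_finPolylogPoly_lt (k := k) hp.out.one_lt 3
  have hM3 := natDegree_finPolylogPoly_comp_le (k := k) (p := p) 3
  have hX := natDegree_X_pow_le (R := k) p
  have h1X := natDegree_one_sub_X_pow_le (k := k) hp3 p
  have hodd := hp.out.odd_of_ne_two (by omega)
  -- the case `p = 5` needs `∑ 1 / i ^ 3 = 0`, which holds as `3` is odd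
  have hsum : finPolylog p 3 (1 : k) = 0 := by
    rcases lt_or_ge 3 (p - 1) with h | h
    · exact finPolylog_one_right (by omega) h
    · exfalso; rcases hodd with ⟨t, ht⟩; have : p = 4 := by omega
      omega
  have hY3 : (finPolylogTwist k p 3).natDegree < p :=
    natDegree_finPolylogTwist_lt hp3 (by omega) (by rcases hodd with ⟨t, ht⟩; omega)
  obtain ⟨G, hG, hF⟩ := exists_expand_of_derivative (k := k) (p := p) (n := 2)
    (F := X ^ p * finPolylogPoly k p 3 + (1 - X ^ p) * (finPolylogPoly k p 3).comp (1 - X)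
      + X ^ p * (1 - X ^ p) * finPolylogTwist k p 3 - C (1 / 6) * finPolylogPoly k p 1 ^ 3) (by
      have h1 := derivative_finPolylogPoly_comp (k := k) (p := p) 2
      have h2 := derivative_finPolylogPoly_one (k := k) (p := p)
      have h3 := derivative_finPolylogPoly (k := k) (p := p) 2
      have h4 := derivative_finPolylogTwist (k := k) (p := p) 2
      have h5 := sq_finPolylogPoly_one (k := k) hp3
      have h6 := finPolylogPoly_two_comp (k := k) hp3
      have h7 : (C (p : k) : k[X]) = 0 := by simp
      have h8 : (C (1 / 6) * 6 : k[X]) = 1 := by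
        have : (6 : k[X]) = C 6 := by rw [map_ofNat]
        rw [this, ← C_mul, ← C_1]
        congr 1
        have : (6 : k) = 2 * 3 := by norm_num
        rw [this]; field_simp
      simp only [derivative_sub, derivative_mul, derivative_add, derivative_pow, derivative_one,
        derivative_X, derivative_C, h7]
      simp only [Nat.cast_ofNat, map_ofNat]
      have h9 : C (1 / 6) * 3 * (-2) = (-1 : k[X]) := by linear_combination -h8
      linear_combination X * (1 - X ^ p) * h1 - C (1 / 6) * 3 * finPolylogPoly k p 1 ^ 2 * h2
        + (1 - X) * X ^ p * h3 + X ^ p * (1 - X ^ p) * h4 - C (1 / 6) * 3 * (X - X ^ p) * h5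
        - ((1 - X ^ p) * (finPolylogPoly k p 2).comp (1 - X)
      + X ^ p * finPolylogPoly k p 2) * (X - X ^ p) * h9 - (X ^ p * (1 - X ^ p)) * h6) (by
      have h10 := hp.out.two_le
      refine (natDegree_sub_le _ _).trans_lt (max_lt ((natDegree_add_le _ _).trans_lt (max_lt
        ((natDegree_add_le _ _).trans_lt (max_lt ?_ ?_)) ?_)) ?_)
      · exact natDegree_mul_le.trans_lt (by omega)
      · exact natDegree_mul_le.trans_lt (by omega)
      · refine natDegree_mul_le.trans_lt ?_
        have := natDegree_mul_le (p := (X ^ p : k[X])) (q := 1 - X ^ p)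
        omega
      · refine (natDegree_C_mul_le _ _).trans_lt (natDegree_pow_le.trans_lt ?_)
        omega)
  have h0 := congrArg (eval 0) hF
  have h1 := congrArg (eval 1) hF
  have hc := congrArg (fun q => q.coeff p) hF
  simp only [expand_eval] at h0 h1
  -- Only -£_1³/6 has a nonzero coefficient at X^p, and it contributes -(-2b)/6.
  have hG1 : G.coeff 1 = b / 3 := by
    have hcoeff : (expand k p G).coeff p = G.coeff 1 := by
      have := coeff_expand_mul hp.out.pos G 1
      rwa [one_mul] at this
    rw [← hcoeff, ← hF, coeff_sub, coeff_add, coeff_add, coeff_C_mul,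
      coeff_finPolylogPoly_one_cube hp3 hf]
    have e1 : (X ^ p * finPolylogPoly k p 3).coeff p = 0 := by
      rw [coeff_X_pow_mul', if_pos le_rfl, Nat.sub_self, coeff_finPolylogPoly]; simp
    have e2 : ((1 - X ^ p) * (finPolylogPoly k p 3).comp (1 - X)).coeff p = 0 := by
      rw [sub_mul, one_mul, coeff_sub, coeff_X_pow_mul', if_pos le_rfl, Nat.sub_self,
        coeff_eq_zero_of_natDegree_lt (by omega), coeff_zero_eq_eval_zero]
      simp [eval_comp, eval_finPolylogPoly, hsum]
    have e3 : (X ^ p * (1 - X ^ p) * finPolylogTwist k p 3).coeff p = 0 := by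
      rw [mul_assoc, coeff_X_pow_mul', if_pos le_rfl, Nat.sub_self, coeff_zero_eq_eval_zero]
      simp [finPolylogTwist_eval_zero]
    rw [e1, e2, e3]
    have : (6 : k) = 2 * 3 := by norm_num
    rw [this]; field_simp; ring
  have hz : (0 : k) ^ p = 0 := zero_pow hp.out.ne_zero
  simp [eval_comp, eval_finPolylogPoly, hsum, hz, finPolylog_zero_right,
    finPolylogTwist_eval_zero] at h0
  simp [eval_comp, eval_finPolylogPoly, hsum, finPolylog_zero_right,
    finPolylog_one_right (k := k) (p := p) one_pos (by omega)] at h1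
  have hGe : G = C (b / 3) * (X * (1 - X)) := by
    rw [Polynomial.as_sum_range_C_mul_X_pow' G (n := 3) (by omega)] at h0 h1 ⊢
    simp only [sum_range_succ, range_zero, sum_empty, zero_add, hG1, pow_zero, pow_one, mul_one,
      eval_add, eval_mul, eval_C, eval_X, eval_pow] at h0 h1 ⊢
    simp only [mul_zero, add_zero, ne_eq, OfNat.ofNat_ne_zero, not_false_eq_true, zero_pow,
      one_pow, mul_one] at h0 h1
    have e4 : G.coeff 2 = -(b / 3) := by linear_combination -h1 + h0
    rw [← h0, e4, C_neg, C_0]; ring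
  rw [hF, hGe]
  simp

theorem finPolylog_three_relation (hf : IsFaulhaber p f b) {x : k} (hx : x ≠ 0) :
    x ^ p * finPolylog p 3 x + (1 - x ^ p) * finPolylog p 3 (1 - x)
      + x ^ p * (1 - x ^ p) * (x ^ p * finPolylog p 3 (1 - 1 / x)) =
      finPolylog p 1 x ^ 3 / 6 + b / 3 * (x ^ p * (1 - x ^ p)) := by
  have h := congrArg (eval x) (finPolylogPoly_three_relation hp3 hf)
  simp only [eval_add, eval_sub, eval_mul, eval_pow, eval_X, eval_one, eval_comp, eval_C,
    eval_finPolylogPoly, eval_finPolylogTwist _ hx] at h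
  linear_combination h

theorem finPolylog_two_one_sub {x : k} (hx : x ≠ 0) :
    finPolylog p 2 (1 - x) = finPolylog p 2 x - x ^ p * finPolylog p 2 (1 - 1 / x) := by
  have h := congrArg (eval x) (finPolylogPoly_two_comp (k := k) hp3)
  simpa only [eval_sub, eval_X, eval_one, eval_comp, eval_finPolylogPoly,
    eval_finPolylogTwist _ hx] using h

theorem sq_finPolylog_one (x : k) :
    finPolylog p 1 x ^ 2 =
      -2 * ((1 - x ^ p) * finPolylog p 2 (1 - x) + x ^ p * finPolylog p 2 x) := by
  have h := congrArg (eval x) (sq_finPolylogPoly_one (k := k) hp3)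
  simpa only [eval_sub, eval_X, eval_one, eval_comp, eval_finPolylogPoly, eval_pow, eval_mul,
    eval_add, eval_neg, eval_ofNat] using h

theorem finPolylog_one_one_sub (x : k) : finPolylog p 1 (1 - x) = finPolylog p 1 x := by
  have h := congrArg (eval x) (finPolylogPoly_one_comp (k := k) hp3)
  simpa only [eval_sub, eval_X, eval_one, eval_comp, eval_finPolylogPoly] using h

/-- For m = p - 1 every coefficient binom(p-1+i, i) with i > 0 vanishes modulo p, and (1-X)^p = 1 -
X^p. -/
theorem centralBinomPoly_zero :
    (1 - 2 * X) * centralBinomPoly k p 0 = 2 * X - 2 * X ^ p := by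
  have h := one_sub_two_mul_sum_centralBinom (X : k[X]) (p - 1)
  rw [Nat.sub_add_cancel hp.out.one_le, range_eq_Ico, sum_eq_sum_Ico_succ_bot hp.out.pos,
    sum_eq_sum_Ico_succ_bot hp.out.pos, sub_pow_char, one_pow] at h
  have h1 : ∀ i ∈ Ico (0 + 1) p, (((p - 1 + i).choose i : ℕ) : k[X]) * X ^ i = 0 := by
    intro i hi
    have hi' := mem_Ico.mp hi
    have h2 : p ∣ (p - 1 + i).choose i := by
      exact hp.out.dvd_choose hi'.2 (by omega) (by omega)
    have h3 : (((p - 1 + i).choose i : ℕ) : k[X]) = 0 := by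
      rw [← map_natCast (C : k →+* k[X]), (CharP.cast_eq_zero_iff k p _).mpr h2, C_0]
    rw [h3, zero_mul]
  rw [sum_eq_zero h1] at h
  have h4 : centralBinomPoly k p 0 =
      ∑ i ∈ Ico (0 + 1) p, ((i.centralBinom : ℕ) : k[X]) * (X * (1 - X)) ^ i := by
    simp [centralBinomPoly]
  rw [h4]
  simp only [add_zero, Nat.choose_zero_right, Nat.cast_one, pow_zero, mul_one,
    Nat.centralBinom_zero] at h
  linear_combination h

theorem centralBinomPoly_one : centralBinomPoly k p 1 = 2 * finPolylogPoly k p 1 := by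
  have hlt := natDegree_finPolylogPoly_lt (k := k) hp.out.one_lt 1
  have hle := natDegree_centralBinomPoly_le (k := k) hp.out.one_lt 1
  refine sub_eq_zero.mp (eq_zero_of_derivative ?_ ?_ ?_ ?_)
  · have h1 := derivative_centralBinomPoly (k := k) (p := p)
      (fun i hi => cast_ne_zero_of_mem_Ico hi) 0
    rw [centralBinomPoly_zero hp3] at h1
    have h2 := derivative_finPolylogPoly_one (k := k) (p := p)
    simp only [derivative_sub, derivative_mul, derivative_ofNat]
    rw [zero_add] at h1
    linear_combination h1 - 2 * h2
  · have e : (2 : k[X]) = C 2 := by rw [map_ofNat]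
    rw [e]
    have := hp.out.two_le
    exact (natDegree_sub_le _ _).trans_lt
      (max_lt (by omega) ((natDegree_C_mul_le _ _).trans_lt (by omega)))
  · rw [eval_sub, eval_mul, eval_finPolylogPoly, eval_centralBinomPoly, finPolylog_zero_right,
      mul_zero, sub_zero]
    exact sum_eq_zero fun i hi => by
      have := mem_Ico.mp hi
      simp [show i ≠ 0 by omega]
  · rw [eval_sub, eval_mul, eval_finPolylogPoly, eval_centralBinomPoly,
      finPolylog_one_right one_pos (by omega), mul_zero, sub_zero]
    exact sum_eq_zero fun i hi => by
      have := mem_Ico.mp hi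
      simp [show i ≠ 0 by omega]

/-- The derivative of £_2(X) + £_2(1-X) contributes the factor (1-X) - X = 1 - 2X times £_1, which
matches the derivative of the left side. -/
theorem centralBinomPoly_two :
    centralBinomPoly k p 2 = 2 * (finPolylogPoly k p 2 + (finPolylogPoly k p 2).comp (1 - X)) := by
  have hlt := natDegree_finPolylogPoly_lt (k := k) hp.out.one_lt 2
  have hlt' := natDegree_finPolylogPoly_comp_le (k := k) (p := p) 2
  have hle := natDegree_centralBinomPoly_le (k := k) hp.out.one_lt 2
  refine sub_eq_zero.mp (eq_zero_of_derivative ?_ ?_ ?_ ?_)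
  · have h1 := derivative_centralBinomPoly (k := k) (p := p)
      (fun i hi => cast_ne_zero_of_mem_Ico hi) 1
    rw [centralBinomPoly_one hp3] at h1
    have h2 := derivative_finPolylogPoly_comp (k := k) (p := p) 1
    have h3 := derivative_finPolylogPoly (k := k) (p := p) 1
    rw [finPolylogPoly_one_comp hp3] at h2
    simp only [derivative_sub, derivative_mul, derivative_ofNat, derivative_add]
    linear_combination h1 - 2 * (1 - X) * h3 - 2 * X * h2
  · have e : (2 : k[X]) = C 2 := by rw [map_ofNat]
    rw [e]
    have := hp.out.two_le
    exact (natDegree_sub_le _ _).trans_lt (max_lt (by omega) ((natDegree_C_mul_le _ _).trans_lt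
      ((natDegree_add_le _ _).trans_lt (max_lt (by omega) (by omega)))))
  · rw [eval_sub, eval_mul, eval_add, eval_comp, eval_finPolylogPoly, eval_centralBinomPoly,
      finPolylog_zero_right]
    simp only [eval_finPolylogPoly, eval_sub, eval_one, eval_X, sub_zero,
      finPolylog_one_right (k := k) (p := p) two_pos (by omega), add_zero, mul_zero]
    exact sum_eq_zero fun i hi => by
      have := mem_Ico.mp hi
      simp [show i ≠ 0 by omega]
  · rw [eval_sub, eval_mul, eval_add, eval_comp, eval_finPolylogPoly, eval_centralBinomPoly]
    simp only [eval_finPolylogPoly, eval_sub, eval_one, eval_X, sub_self,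
      finPolylog_one_right (k := k) (p := p) two_pos (by omega), add_zero, mul_zero,
      finPolylog_zero_right, sub_zero]
    exact sum_eq_zero fun i hi => by
      have := mem_Ico.mp hi
      simp [show i ≠ 0 by omega]

theorem sum_centralBinom_div_sq (x : k) :
    ∑ i ∈ Ico 1 p, (i.centralBinom : k) * (x * (1 - x)) ^ i / (i : k) ^ 2 =
      2 * (finPolylog p 2 x + finPolylog p 2 (1 - x)) := by
  rw [← eval_centralBinomPoly, centralBinomPoly_two hp3]
  simp [eval_comp, eval_finPolylogPoly]

end

/-! ### Sums with central binomial coefficients in the numerator, modulo p² and p³ -/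

section

open Polynomial

theorem one_sub_mul_sum_harmonicSum {R F : Type*} [Field F] [CommRing R] [Algebra F R] (x : R)
    (N : ℕ) :
    (1 - x) * ∑ i ∈ Ico 1 (N + 1), algebraMap F R (harmonicSum F 1 (i - 1)) * x ^ i =
      x * ∑ i ∈ Ico 1 (N + 1), algebraMap F R (1 / (i : F) ^ 1) * x ^ i
        - algebraMap F R (harmonicSum F 1 N) * x ^ (N + 1) := by
  induction N with
  | zero => simp [harmonicSum_zero]
  | succ N ih =>
    rw [sum_Ico_succ_top (by omega), mul_add, ih,
      sum_Ico_succ_top (a := 1) (b := N + 1) (f := fun i => algebraMap F R (1 / (i : F) ^ 1) * x ^ i)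
        (by omega), Nat.add_sub_cancel, harmonicSum_succ, Nat.cast_succ, map_add]
    ring

theorem sum_harmonicSum_one_div {F : Type*} [Field F] [NeZero (2 : F)] (m : ℕ) :
    ∑ i ∈ Ico 1 (m + 1), harmonicSum F 1 (i - 1) / (i : F) =
      (harmonicSum F 1 m ^ 2 - harmonicSum F 2 m) / 2 := by
  have h2 : (2 : F) ≠ 0 := NeZero.ne 2
  induction m with
  | zero => simp [harmonicSum_zero]
  | succ m ih =>
    rw [sum_Ico_succ_top (by omega), ih, Nat.add_sub_cancel, harmonicSum_succ, harmonicSum_succ,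
      Nat.cast_succ, one_div, one_div, pow_one, ← inv_pow, div_eq_mul_inv _ ((m : F) + 1),
      eq_div_iff h2, add_mul, div_mul_cancel₀ _ h2]
    ring

variable {k : Type*} [Field k] {p : ℕ} [hp : Fact p.Prime] [CharP k p]

/-- Both sides have the same derivative, and they agree at 0 and 1. At 1 the left side is the second
elementary symmetric function of the 1/j, which vanishes modulo p. -/
theorem sum_harmonicSum_one_mul_pow (hp3 : 3 < p) (x : k) :
    ∑ i ∈ Ico 1 p, harmonicSum k 1 (i - 1) / (i : k) * x ^ i = -finPolylog p 2 (1 - x) := by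
  have h2 : (2 : k) ≠ 0 := two_ne_zero_of_three_lt (p := p) hp3
  have : NeZero (2 : k) := ⟨h2⟩
  have hp1 := hp.out.two_le
  have hle := natDegree_finPolylogPoly_comp_le (k := k) (p := p) 2
  have hH1 := harmonicSum_prime_sub_one (k := k) hp3 one_pos (by omega)
  have hH2 := harmonicSum_prime_sub_one (k := k) hp3 two_pos (by omega)
  have key : (∑ i ∈ Ico 1 p, C (harmonicSum k 1 (i - 1) / (i : k)) * X ^ i : k[X])
      + (finPolylogPoly k p 2).comp (1 - X) = 0 := by
    refine eq_zero_of_derivative ?_ ?_ ?_ ?_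
    · have h1 := derivative_finPolylogPoly_comp (k := k) (p := p) 1
      rw [finPolylogPoly_one_comp hp3] at h1
      have h3 := one_sub_mul_sum_harmonicSum (F := k) (X : k[X]) (p - 1)
      rw [hH1, map_zero, zero_mul, sub_zero, Nat.sub_add_cancel hp.out.one_le] at h3
      have h4 : X * derivative (∑ i ∈ Ico 1 p, C (harmonicSum k 1 (i - 1) / (i : k)) * X ^ i : k[X])
          = ∑ i ∈ Ico 1 p, algebraMap k k[X] (harmonicSum k 1 (i - 1)) * X ^ i := by
        rw [derivative_sum, mul_sum]
        refine sum_congr rfl fun i hi => ?_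
        have h0 := cast_ne_zero_of_mem_Ico (k := k) hi
        obtain ⟨j, rfl⟩ : ∃ j, i = j + 1 := ⟨i - 1, by have := mem_Ico.mp hi; omega⟩
        rw [derivative_C_mul, derivative_X_pow, Nat.add_sub_cancel, Polynomial.algebraMap_apply,
          Algebra.algebraMap_self, RingHom.id_apply]
        have h5 : harmonicSum k 1 j = harmonicSum k 1 j / ((j + 1 : ℕ) : k) * ((j + 1 : ℕ) : k) := by
          field_simp
        conv_rhs => rw [h5, C_mul]
        ring
      have h6 : finPolylogPoly k p 1 =
          ∑ i ∈ Ico 1 p, algebraMap k k[X] (1 / (i : k) ^ 1) * X ^ i := rfl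
      rw [← h6] at h3
      rw [derivative_add]
      linear_combination (1 - X) * h4 + h3 + X * h1
    · refine (natDegree_add_le _ _).trans_lt (max_lt ?_ (by omega))
      refine (natDegree_sum_le_of_forall_le (n := p) _ _ fun i hi => ?_).trans_lt (by omega)
      exact (natDegree_C_mul_X_pow_le _ _).trans (mem_Ico.mp hi).2.le
    · simp only [eval_add, eval_finsetSum, eval_comp, eval_finPolylogPoly, eval_sub, eval_one,
        eval_X, sub_zero, finPolylog_one_right (k := k) (p := p) two_pos (by omega), add_zero]
      refine sum_eq_zero fun i hi => ?_
      have := mem_Ico.mp hi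
      simp [show i ≠ 0 by omega]
    · simp only [eval_add, eval_finsetSum, eval_comp, eval_finPolylogPoly, eval_sub, eval_one,
        eval_X, sub_self, finPolylog_zero_right, add_zero, eval_mul, eval_C, eval_pow, one_pow,
        mul_one]
      have := sum_harmonicSum_one_div (F := k) (p - 1)
      rw [Nat.sub_add_cancel hp.out.one_le, hH1, hH2] at this
      rw [this]; simp
  have h := congrArg (eval x) key
  simp only [eval_add, eval_finsetSum, eval_comp, eval_finPolylogPoly, eval_sub, eval_one,
    eval_X, eval_mul, eval_C, eval_pow, Polynomial.eval_zero] at h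
  linear_combination h

variable {K : Type*} [Field K] [CharZero K] {V : ValuationSubring K} {ρ : V →+* k}
  [IsLocalHom ρ]

theorem Red.prime (p : ℕ) [CharP k p] : Red ρ (p : K) 0 :=
  (Red.natCast p).congr rfl (CharP.cast_eq_zero k p).symm

theorem Red.one_div_pow {i : ℕ} (h0 : 0 < i) (hi : i < p) (d : ℕ) :
    Red ρ (1 / (i : K) ^ d) (1 / (i : k) ^ d) :=
  Red.one.div ((Red.natCast i).pow d) (pow_ne_zero _ (natCast_ne_zero_of_lt (p := p) h0 hi))

theorem Red.harmonicSum {m : ℕ} (hm : m < p) (d : ℕ) :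
    Red ρ (harmonicSum K d m) (harmonicSum k d m) :=
  Red.sum fun j hj => Red.one_div_pow (p := p) j.succ_pos (by have := mem_range.mp hj; omega) d

theorem Red.finPolylog {x : K} {a : k} (hx : Red ρ x a) (d : ℕ) :
    Red ρ (finPolylog p d x) (finPolylog p d a) :=
  Red.sum fun i hi => (hx.pow i).div ((Red.natCast i).pow d)
    (pow_ne_zero _ (cast_ne_zero_of_mem_Ico hi))

/-- First-order expansion of `∏_{j ≤ m} (1 + p c / j)`. -/
theorem exists_prod_one_add {c : K} {a : k} (hc : Red ρ c a) {m : ℕ} (hm : m < p) :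
    ∃ z, Red ρ z (a * _root_.harmonicSum k 1 m) ∧
      ∏ j ∈ range m, (1 + (p : K) * c / ((j + 1 : ℕ) : K)) = 1 + p * z := by
  induction m with
  | zero => exact ⟨0, Red.zero.congr rfl (by rw [harmonicSum_zero, mul_zero]), by simp⟩
  | succ m ih =>
    obtain ⟨z, hz, h⟩ := ih (by omega)
    have hi := Red.one_div_pow (ρ := ρ) (p := p) m.succ_pos hm 1
    refine ⟨z + c * (1 / ((m + 1 : ℕ) : K) ^ 1) + p * (z * (c * (1 / ((m + 1 : ℕ) : K) ^ 1))),
      ((hz.add (hc.mul hi)).add ((Red.prime p).mul (hz.mul (hc.mul hi)))).congr rfl ?_, ?_⟩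
    · rw [harmonicSum_succ, Nat.cast_succ]; ring
    · rw [prod_range_succ, h]; ring

omit hp in
theorem choose_prime_add {m : ℕ} :
    ((p + m).choose (m + 1) : K) =
      p / ((m + 1 : ℕ) : K) * ∏ j ∈ range m, (1 + (p : K) * 1 / ((j + 1 : ℕ) : K)) := by
  induction m with
  | zero => simp
  | succ m ih =>
    have h := Nat.add_one_mul_choose_eq (p + m) (m + 1)
    have h1 := congrArg (fun n : ℕ => (n : K)) h
    simp only [Nat.cast_mul] at h1
    rw [ih] at h1
    rw [prod_range_succ]
    have h2 : ((m + 1 : ℕ) : K) ≠ 0 := Nat.cast_ne_zero.mpr (by omega)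
    have h3 : ((m + 1 + 1 : ℕ) : K) ≠ 0 := Nat.cast_ne_zero.mpr (by omega)
    rw [← mul_right_inj' h3]
    have h4 : ((p + (m + 1)).choose (m + 1 + 1) : K) = ((p + m).succ.choose (m + 1).succ : K) := rfl
    rw [h4]
    rw [mul_comm, ← h1]
    field_simp
    push_cast
    ring

omit hp in
theorem choose_prime_succ {m : ℕ} (hm : m < p) :
    (p.choose (m + 1) : K) * (-1) ^ m =
      p / ((m + 1 : ℕ) : K) * ∏ j ∈ range m, (1 + (p : K) * (-1) / ((j + 1 : ℕ) : K)) := by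
  induction m with
  | zero => simp
  | succ m ih =>
    have ih := ih (by omega)
    have h := Nat.choose_succ_right_eq p (m + 1)
    have h1 := congrArg (fun n : ℕ => (n : K)) h
    simp only [Nat.cast_mul] at h1
    rw [Nat.cast_sub hm.le] at h1
    rw [prod_range_succ]
    have h2 : ((m + 1 : ℕ) : K) ≠ 0 := Nat.cast_ne_zero.mpr (by omega)
    have h3 : ((m + 1 + 1 : ℕ) : K) ≠ 0 := Nat.cast_ne_zero.mpr (by omega)
    have h5 : p / ((m + 1 + 1 : ℕ) : K) * ((∏ j ∈ range m, (1 + (p : K) * (-1) / ((j + 1 : ℕ) : K)))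
        * (1 + (p : K) * (-1) / ((m + 1 : ℕ) : K))) =
        (p / ((m + 1 : ℕ) : K) * ∏ j ∈ range m, (1 + (p : K) * (-1) / ((j + 1 : ℕ) : K))) *
        (((m + 1 : ℕ) : K) - p) / ((m + 1 + 1 : ℕ) : K) := by
      field_simp
      ring
    rw [h5, ← ih, eq_div_iff h3, pow_succ]
    linear_combination (-(-1) ^ m) * h1

/-- The two binomials are p/i times ∏(1 + p/j) and, up to sign, p/i times ∏(1 - p/j). In the sum the
terms linear in p cancel and the quadratic ones double. -/
theorem exists_choose_add_choose {i : ℕ} (hi : i ∈ Ico 1 p) :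
    ∃ z, Red ρ z (_root_.harmonicSum k 1 (i - 1) / (i : k)) ∧
      ((p - 1 + i).choose i : K) + (-1) ^ i * (p.choose i : K) = 2 * (p : K) ^ 2 * z := by
  have hi' := mem_Ico.mp hi
  obtain ⟨m, rfl⟩ : ∃ m, i = m + 1 := ⟨i - 1, by omega⟩
  obtain ⟨z, hz, h⟩ := exists_prod_one_add (ρ := ρ) (p := p) Red.one (m := m) (by omega)
  obtain ⟨w, hw, h'⟩ := exists_prod_one_add (ρ := ρ) (p := p) Red.one.neg (m := m) (by omega)
  have h0 := cast_ne_zero_of_mem_Ico (k := k) hi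
  have e1 := choose_prime_add (K := K) (p := p) (m := m)
  have e2 := choose_prime_succ (K := K) (p := p) (m := m) (by omega)
  rw [h] at e1
  rw [h'] at e2
  rw [show p - 1 + (m + 1) = p + m by omega, Nat.add_sub_cancel]
  have h2K : (2 : K) ≠ 0 := two_ne_zero
  by_cases hp2 : p = 2
  · -- here `m = 0`
    subst hp2
    obtain rfl : m = 0 := by omega
    exact ⟨0, Red.zero.congr rfl (by simp [harmonicSum_zero]), by simp⟩
  have h2 : (2 : k) ≠ 0 := by
    have : ((2 : ℕ) : k) ≠ 0 := natCast_ne_zero_of_lt (p := p) two_pos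
      (lt_of_le_of_ne hp.out.two_le (Ne.symm hp2))
    exact_mod_cast this
  refine ⟨(z - w) / 2 / ((m + 1 : ℕ) : K), (((hz.sub hw).div (Red.ofNat 2) h2).div
    (Red.natCast (m + 1)) h0).congr rfl ?_, ?_⟩
  · field_simp; ring
  · rw [e1, pow_succ]
    have h3 : ((m + 1 : ℕ) : K) ≠ 0 := Nat.cast_ne_zero.mpr (by omega)
    field_simp
    field_simp at e2
    linear_combination -e2

variable (V) in
/-- The polynomials over `K` with coefficients in `V`. -/
noncomputable def integralPolys : Subring K[X] := (mapRingHom V.subtype).range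

omit [CharZero K] in
theorem mem_integralPolys {g : K[X]} : g ∈ integralPolys V ↔ ∀ i, g.coeff i ∈ V := by
  constructor
  · rintro ⟨h, rfl⟩ i
    rw [coe_mapRingHom, coeff_map]
    exact (h.coeff i).2
  · intro h
    have : g ∈ lifts V.subtype := (lifts_iff_coeff_lifts g).mpr fun i => ⟨⟨_, h i⟩, rfl⟩
    exact this

omit [CharZero K] in
-- X only shifts coefficients and 1 - X has constant term 1, so the coefficients of `g` are
-- recovered one at a time by addition.
theorem mem_integralPolys_of_mul {g : K[X]} (h : X * (1 - X) * g ∈ integralPolys V) :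
    g ∈ integralPolys V := by
  rw [mem_integralPolys] at h ⊢
  intro i
  induction i with
  | zero =>
    have := h 1
    rw [mul_assoc, coeff_X_mul, sub_mul, one_mul, coeff_sub, coeff_X_mul_zero, sub_zero] at this
    exact this
  | succ i ih =>
    have := h (i + 2)
    rw [mul_assoc, coeff_X_mul, sub_mul, one_mul, coeff_sub, coeff_X_mul] at this
    have h2 := V.add_mem _ _ this ih
    rwa [sub_add_cancel] at h2

/-- The coefficients binom(p-1+i, i) are traded for those of (1-x)^p, up to a p² correction. The
algebra `R` allows both a point of `K` and the variable of `K[X]`. -/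
theorem exists_sum_choose_eq {R : Type*} [CommRing R] [Algebra K R] (x : R) (z : ℕ → K)
    (hz : ∀ i ∈ Ico 1 p,
      ((p - 1 + i).choose i : K) + (-1) ^ i * (p.choose i : K) = 2 * (p : K) ^ 2 * z i) (hp2 : p ≠ 2) :
    ∑ i ∈ range p, ((p - 1 + i).choose i : R) * x ^ i = 2 - x ^ p - (1 - x) ^ p
      + 2 * (p : R) ^ 2 * ∑ i ∈ Ico 1 p, algebraMap K R (z i) * x ^ i := by
  have hodd := hp.out.odd_of_ne_two hp2
  have h1 : (1 - x) ^ p = 1 + ∑ i ∈ Ico 1 p, (-1) ^ i * (p.choose i : R) * x ^ i - x ^ p := by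
    have := add_pow (-x) 1 p
    rw [neg_add_eq_sub, sum_range_succ, range_eq_Ico, sum_eq_sum_Ico_succ_bot hp.out.pos] at this
    rw [this]
    simp only [one_pow, mul_one, zero_add, pow_zero, Nat.choose_zero_right, Nat.cast_one,
      Nat.choose_self, hodd.neg_pow]
    rw [← sub_eq_add_neg]
    congr 2
    refine sum_congr rfl fun i _ => ?_
    rw [neg_pow]; ring
  rw [h1, range_eq_Ico, sum_eq_sum_Ico_succ_bot hp.out.pos]
  have h2 : ∀ i ∈ Ico 1 p, ((p - 1 + i).choose i : R) * x ^ i =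
      2 * (p : R) ^ 2 * (algebraMap K R (z i) * x ^ i) - (-1) ^ i * (p.choose i : R) * x ^ i := by
    intro i hi
    have := congrArg (algebraMap K R) (hz i hi)
    simp only [map_add, map_mul, map_pow, map_neg, map_one, map_natCast, map_ofNat] at this
    linear_combination x ^ i * this
  rw [zero_add, sum_congr rfl h2, sum_sub_distrib, ← mul_sum]
  simp only [add_zero, Nat.choose_zero_right, Nat.cast_one, pow_zero, mul_one]
  ring

/-- The sum `∑_{i < p} binom(2i, i) (x (1 - x)) ^ i` modulo `p ^ 3`. -/
theorem exists_sum_centralBinom_eq (hp3 : 3 < p) {x : K} {a : k} (hx : Red ρ x a) :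
    ∃ z, Red ρ z (_root_.finPolylog p 2 (1 - a)) ∧
      (1 - 2 * x) * ∑ i ∈ range p, (i.centralBinom : K) * (x * (1 - x)) ^ i =
        2 * (1 - x) ^ p * (2 - x ^ p - (1 - x) ^ p - 2 * (p : K) ^ 2 * z) - 1 := by
  choose! z hz h using fun i hi => exists_choose_add_choose (ρ := ρ) (p := p) (i := i) hi
  have h1 := exists_sum_choose_eq x z h (by omega)
  have h2 := one_sub_two_mul_sum_centralBinom x (p - 1)
  rw [Nat.sub_add_cancel hp.out.one_le, h1] at h2
  refine ⟨-∑ i ∈ Ico 1 p, z i * x ^ i, ?_, ?_⟩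
  · refine (Red.sum fun i hi => (hz i hi).mul (hx.pow i)).neg.congr rfl ?_
    rw [sum_harmonicSum_one_mul_pow hp3, neg_neg]
  · rw [h2]
    simp only [Algebra.algebraMap_self, RingHom.id_apply]
    ring

/-- The sum `∑_{0 < i < p} binom(2i, i) (x (1 - x)) ^ i / i` modulo `p ^ 2`, in terms of
`σ = (1 - x ^ p - (1 - x) ^ p) / p`. -/
theorem exists_sum_centralBinom_div_eq (ρ : V →+* k) [IsLocalHom ρ] (hp3 : 3 < p) {x σ : K} (hx : x ∈ V)
    (hσ : p * σ = 1 - x ^ p - (1 - x) ^ p) :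
    ∃ z ∈ V, ∑ i ∈ Ico 1 p, (i.centralBinom : K) * (x * (1 - x)) ^ i / (i : K) =
        2 * σ + p * σ ^ 2 + (p : K) ^ 2 * z := by
  have hpK : (p : K) ≠ 0 := Nat.cast_ne_zero.mpr hp.out.ne_zero
  have hodd := hp.out.odd_of_ne_two (by omega)
  choose! z hz h using fun i hi => exists_choose_add_choose (ρ := ρ) (p := p) (i := i) hi
  -- the polynomial version of `σ`
  set S : K[X] := ∑ i ∈ Ico 1 p, C (-(-1) ^ i * ((p.choose i / p : ℕ) : K)) * X ^ i with hS
  have hSeq : (p : K[X]) * S = 1 - X ^ p - (1 - X) ^ p := by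
    have := add_pow (-X : K[X]) 1 p
    rw [neg_add_eq_sub, sum_range_succ, range_eq_Ico, sum_eq_sum_Ico_succ_bot hp.out.pos] at this
    rw [this, hS, mul_sum]
    have h2 : ∀ i ∈ Ico 1 p, (p : K[X]) * (C (-(-1) ^ i * ((p.choose i / p : ℕ) : K)) * X ^ i) =
        -((-X) ^ i * 1 ^ (p - i) * (p.choose i : K[X])) := by
      intro i hi
      have hi' := mem_Ico.mp hi
      have h3 : p ∣ p.choose i := hp.out.dvd_choose_self (by omega) hi'.2
      have h4 : (p.choose i : K[X]) = (p : K[X]) * ((p.choose i / p : ℕ) : K[X]) := by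
        rw [← Nat.cast_mul, Nat.mul_div_cancel' h3]
      rw [h4, neg_pow (X : K[X]), C_mul, C_neg, C_pow, C_neg, C_1, map_natCast]
      ring
    rw [sum_congr rfl h2, sum_neg_distrib]
    simp only [one_pow, mul_one, zero_add, pow_zero, Nat.choose_zero_right, Nat.cast_one,
      Nat.choose_self, hodd.neg_pow]
    ring
  have hSmem : S ∈ integralPolys V := by
    refine Subring.sum_mem _ fun i _ => Subring.mul_mem _ ?_ (Subring.pow_mem _ ?_ _)
    · rw [C_mul, C_neg, C_pow, C_neg, C_1, map_natCast]
      exact Subring.mul_mem _ (Subring.neg_mem _ (Subring.pow_mem _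
        (Subring.neg_mem _ (Subring.one_mem _)) _)) (natCast_mem _ _)
    · exact mem_integralPolys.mpr fun i => by
        rw [coeff_X]; split_ifs
        · exact V.one_mem
        · exact V.zero_mem
  have hXmem : (X : K[X]) ∈ integralPolys V := mem_integralPolys.mpr fun i => by
    rw [coeff_X]; split_ifs
    · exact V.one_mem
    · exact V.zero_mem
  have hSdeg : S.natDegree ≤ p - 1 := by
    refine natDegree_sum_le_of_forall_le _ _ fun i hi => (natDegree_C_mul_X_pow_le _ _).trans ?_
    have := mem_Ico.mp hi
    omega
  set Z : K[X] := ∑ i ∈ Ico 1 p, C (z i) * X ^ i with hZ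
  have hZmem : Z ∈ integralPolys V := by
    refine Subring.sum_mem _ fun i hi => Subring.mul_mem _ ?_ (Subring.pow_mem _ hXmem _)
    rw [mem_integralPolys]
    intro j
    rw [coeff_C]; split_ifs
    · exact (hz i hi).mem
    · exact V.zero_mem
  have hA := exists_sum_choose_eq (X : K[X]) z h (by omega)
  have hB := one_sub_two_mul_sum_centralBinom (X : K[X]) (p - 1)
  rw [Nat.sub_add_cancel hp.out.one_le, hA, range_eq_Ico, sum_eq_sum_Ico_succ_bot hp.out.pos] at hB
  have hB' : (∑ i ∈ Ico (0 + 1) p, (i.centralBinom : K[X]) * (X * (1 - X)) ^ i) =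
      centralBinomPoly K p 0 := by
    simp [centralBinomPoly]
  have hZ' : ∑ i ∈ Ico 1 p, (algebraMap K K[X]) (z i) * X ^ i = Z := rfl
  rw [hB', hZ'] at hB
  simp only [pow_zero, mul_one, Nat.centralBinom_zero, Nat.cast_one] at hB
  have hD := derivative_centralBinomPoly (k := K) (p := p)
    (fun i hi => Nat.cast_ne_zero.mpr (by have := mem_Ico.mp hi; omega)) 0
  rw [zero_add] at hD
  have hS' : (p : K[X]) * derivative S = (p : K[X]) * ((1 - X) ^ (p - 1) - X ^ (p - 1)) := by
    have := congrArg derivative hSeq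
    simp only [derivative_mul, derivative_natCast, derivative_sub, derivative_one, derivative_pow,
      derivative_X, map_natCast] at this
    linear_combination this
  have hpKX : (p : K[X]) ≠ 0 := Nat.cast_ne_zero.mpr hp.out.ne_zero
  have hS'' := mul_left_cancel₀ hpKX hS'
  have hXp : (X : K[X]) ^ p = X * X ^ (p - 1) := by
    rw [← pow_succ', Nat.sub_add_cancel hp.out.one_le]
  have h1Xp : (1 - X : K[X]) ^ p = (1 - X) * (1 - X) ^ (p - 1) := by
    rw [← pow_succ', Nat.sub_add_cancel hp.out.one_le]
  -- The error term as a polynomial; the aim is that F / p² has coefficients in V.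
  set F : K[X] := centralBinomPoly K p 1 - 2 * S - p * S ^ 2 with hF
  -- The error is already divisible by p² after differentiation, so what remains is an integration.
  have hF' : X * (1 - X) * derivative F = (p : K[X]) ^ 2 *
      (2 * (2 * (1 - X) ^ p * Z - (1 - X) * S ^ 2)) := by
    simp only [hF, derivative_sub, derivative_mul, derivative_ofNat, derivative_natCast,
      derivative_pow, hS'', C_ofNat, Nat.cast_ofNat]
    have e : (X : K[X]) * (1 - X) * ((1 - X) ^ (p - 1) - X ^ (p - 1)) =
        (X : K[X]) * (1 - X) ^ p - (1 - X) * X ^ p := by rw [hXp, h1Xp]; ring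
    have e2 : (1 - X : K[X]) ^ p = 1 - (X : K[X]) ^ p - (p : K[X]) * S := by rw [hSeq]; ring
    rw [e2] at hB e ⊢
    linear_combination hD + hB - 2 * (1 + p * S) * e
  have hc2 : ((p : K) ^ 2) ≠ 0 := pow_ne_zero _ hpK
  have hG : C (1 / (p : K) ^ 2) * derivative F ∈ integralPolys V := by
    apply mem_integralPolys_of_mul
    have e : X * (1 - X) * (C (1 / (p : K) ^ 2) * derivative F) =
        2 * (2 * (1 - X) ^ p * Z - (1 - X) * S ^ 2) := by
      have e1 : (p : K[X]) ^ 2 = C ((p : K) ^ 2) := by simp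
      have e2 : C (1 / (p : K) ^ 2) * C ((p : K) ^ 2) = 1 := by
        rw [← C_mul, one_div_mul_cancel hc2, C_1]
      rw [e1] at hF'
      linear_combination C (1 / (p : K) ^ 2) * hF' +
        2 * (2 * (1 - X) ^ p * Z - (1 - X) * S ^ 2) * e2
    rw [e]
    have h1X : (1 - X : K[X]) ∈ integralPolys V := Subring.sub_mem _ (Subring.one_mem _) hXmem
    have h2m : (2 : K[X]) ∈ integralPolys V := by exact_mod_cast natCast_mem (integralPolys V) 2
    exact Subring.mul_mem _ h2m (Subring.sub_mem _ (Subring.mul_mem _ (Subring.mul_mem _ h2m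
      (Subring.pow_mem _ h1X _)) hZmem) (Subring.mul_mem _ h1X (Subring.pow_mem _ hSmem _)))
  have hFdeg : F.natDegree < 2 * p - 1 := by
    have h1 := natDegree_centralBinomPoly_le (k := K) hp.out.one_lt 1
    have e2 : (2 : K[X]) = C 2 := by rw [map_ofNat]
    have e3 : (p : K[X]) = C (p : K) := by rw [map_natCast]
    refine (natDegree_sub_le _ _).trans_lt (max_lt ((natDegree_sub_le _ _).trans_lt
      (max_lt (by omega) ?_)) ?_)
    · rw [e2]; exact (natDegree_C_mul_le _ _).trans_lt (by omega)
    · rw [e3]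
      refine (natDegree_C_mul_le _ _).trans_lt (natDegree_pow_le.trans_lt (by omega))
  have hS0 : S.eval 0 = 0 := by
    have := congrArg (eval 0) hSeq
    simp [hp.out.ne_zero] at this
    exact this
  have hS1 : S.eval 1 = 0 := by
    have := congrArg (eval 1) hSeq
    simp [hp.out.ne_zero] at this
    exact this
  have hF0 : F.coeff 0 = 0 := by
    rw [coeff_zero_eq_eval_zero, hF]
    simp only [eval_sub, eval_mul, hS0, eval_centralBinomPoly, eval_pow]
    rw [sum_eq_zero fun i hi => by
      have := mem_Ico.mp hi
      simp [show i ≠ 0 by omega]]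
    simp
  have hF1 : F.eval 1 = 0 := by
    simp only [hF, eval_sub, eval_mul, hS1, eval_centralBinomPoly, eval_pow]
    rw [sum_eq_zero fun i hi => by
      have := mem_Ico.mp hi
      simp [show i ≠ 0 by omega]]
    simp
  -- Integrating divides the coefficient at X^i by i. Since the degree is below 2p - 1, the only
  -- exponent divisible by p, apart from 0, is p itself.
  have hcoeff : ∀ i, i ≠ p → F.coeff i / (p : K) ^ 2 ∈ V := by
    intro i hi
    rcases i with _ | i
    · rw [hF0, zero_div]; exact V.zero_mem
    · by_cases hlt : i + 1 < 2 * p - 1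
      · have h1 := mem_integralPolys.mp hG i
        rw [coeff_C_mul, coeff_derivative] at h1
        have h2 : ((i + 1 : ℕ) : k) ≠ 0 := by
          rw [Ne, CharP.cast_eq_zero_iff k p]
          rintro ⟨c, hc⟩
          have : c < 2 := by
            by_contra h3
            have : p * 2 ≤ p * c := Nat.mul_le_mul_left _ (by omega)
            omega
          interval_cases c <;> omega
        have h3 := ((Red.natCast (ρ := ρ) (i + 1)).inv h2).mem
        have h4 := V.mul_mem _ _ h1 h3
        have h5 : ((i : K) + 1) ≠ 0 := Nat.cast_add_one_ne_zero i
        convert h4 using 1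
        push_cast
        field_simp
      · rw [coeff_eq_zero_of_natDegree_lt (by omega), zero_div]; exact V.zero_mem
  -- The exceptional coefficient is recovered from F(1) = 0, all others being under control.
  have hcoeffp : F.coeff p / (p : K) ^ 2 ∈ V := by
    rw [eval_eq_sum_range' hFdeg] at hF1
    simp only [one_pow, mul_one] at hF1
    rw [← add_sum_erase _ _ (mem_range.mpr (by omega : p < 2 * p - 1))] at hF1
    have h1 : F.coeff p / (p : K) ^ 2 =
        -∑ i ∈ (range (2 * p - 1)).erase p, F.coeff i / (p : K) ^ 2 := by
      rw [← sum_div]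
      field_simp
      linear_combination hF1
    rw [h1]
    exact V.neg_mem _ (Subring.sum_mem V.toSubring fun i hi => hcoeff i (mem_erase.mp hi).1)
  refine ⟨F.eval x / (p : K) ^ 2, ?_, ?_⟩
  · rw [eval_eq_sum_range' hFdeg, sum_div]
    refine Subring.sum_mem V.toSubring fun i _ => ?_
    rw [mul_div_right_comm]
    refine V.mul_mem _ _ ?_ (Subring.pow_mem V.toSubring hx i)
    by_cases hi : i = p
    · rw [hi]; exact hcoeffp
    · exact hcoeff i hi
  · have h1 : S.eval x = σ := by
      have := congrArg (eval x) hSeq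
      simp only [eval_mul, eval_natCast, eval_sub, eval_one, eval_pow, eval_X] at this
      rw [← hσ] at this
      exact mul_left_cancel₀ hpK this
    rw [hF]
    simp only [eval_sub, eval_mul, eval_pow, h1, eval_natCast, eval_ofNat, eval_centralBinomPoly,
      pow_one]
    field_simp
    ring

end

/-! ### Denominator sums weighted by harmonic numbers, modulo p -/

section

/-- Summation by parts: multiplication by t acts on v as minus a second difference, which is moved
to the coefficients W at the cost of boundary terms. -/
theorem mul_sum_three_term {R : Type*} [CommRing R] (t : R) (v W : ℕ → R)
    (hv : ∀ m, t * v (m + 1) = 2 * v (m + 1) - v (m + 2) - v m) (N : ℕ) :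
    t * ∑ m ∈ Ico 1 (N + 1), W m * v m =
      ∑ m ∈ Ico 1 (N + 1), (2 * W m - W (m - 1) - W (m + 1)) * v m
        + W (N + 1) * v N - W N * v (N + 1) + W 0 * v 1 - W 1 * v 0 := by
  induction N with
  | zero => simp
  | succ N ih =>
    rw [sum_Ico_succ_top (by omega), mul_add, ih,
      sum_Ico_succ_top (a := 1) (b := N + 1)
        (f := fun m => (2 * W m - W (m - 1) - W (m + 1)) * v m) (by omega), Nat.add_sub_cancel]
    linear_combination W (N + 1) * hv N

theorem choose_two_mul_add_two (k m : ℕ) :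
    (2 * (k + 1)).choose (k + 1 + (m + 1)) = (2 * k).choose (k + m) +
      2 * (2 * k).choose (k + (m + 1)) + (2 * k).choose (k + (m + 2)) := by
  rw [show 2 * (k + 1) = 2 * k + 1 + 1 by ring, show k + 1 + (m + 1) = k + m + 1 + 1 by ring,
    Nat.choose_succ_succ, Nat.choose_succ_succ, Nat.choose_succ_succ,
    show k + (m + 1) = k + m + 1 by ring, show k + (m + 2) = k + m + 1 + 1 by ring]
  ring

variable {K : Type*} [Field K]

/-- With β² = α this is the binomial expansion of (-1)^i (β - β⁻¹)^(2i), grouped by the symmetry β ↦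
β⁻¹. The common range `N` for all i permits an exchange of summations. -/
theorem sub_sub_inv_pow_eq {α : K} (hα : α ≠ 0) {i N : ℕ} (hi : i ≤ N) :
    (2 - α - α⁻¹) ^ i = (i.centralBinom : K) +
      ∑ m ∈ Ico 1 (N + 1), ((-1) ^ m * ((2 * i).choose (i + m) : K)) * (α ^ m + α⁻¹ ^ m) := by
  have hinv : α * α⁻¹ = 1 := mul_inv_cancel₀ hα
  induction i with
  | zero =>
    rw [sum_eq_zero fun m hm => by
      have := mem_Ico.mp hm
      rw [Nat.choose_eq_zero_of_lt (by omega)]; simp]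
    simp
  | succ i ih =>
    rw [pow_succ', ih (by omega), mul_add]
    have h := mul_sum_three_term (2 - α - α⁻¹) (fun m => α ^ m + α⁻¹ ^ m)
      (fun m => (-1) ^ m * ((2 * i).choose (i + m) : K)) (fun m => by
        linear_combination (-α ^ m - α⁻¹ ^ m) * hinv) N
    rw [h]
    rw [Nat.choose_eq_zero_of_lt (show 2 * i < i + (N + 1) by omega),
      Nat.choose_eq_zero_of_lt (show 2 * i < i + N by omega)]
    have h1 : ∀ m ∈ Ico 1 (N + 1), (2 * ((-1) ^ m * ((2 * i).choose (i + m) : K))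
        - (-1) ^ (m - 1) * ((2 * i).choose (i + (m - 1)) : K)
        - (-1) ^ (m + 1) * ((2 * i).choose (i + (m + 1)) : K)) * (α ^ m + α⁻¹ ^ m) =
        (-1) ^ m * ((2 * (i + 1)).choose (i + 1 + m) : K) * (α ^ m + α⁻¹ ^ m) := by
      intro m hm
      obtain ⟨l, rfl⟩ : ∃ l, m = l + 1 := ⟨m - 1, by have := mem_Ico.mp hm; omega⟩
      rw [choose_two_mul_add_two, Nat.add_sub_cancel]
      push_cast
      ring
    rw [sum_congr rfl h1]
    have h2 : ((i + 1).centralBinom : K) = 2 * i.centralBinom + 2 * ((2 * i).choose (i + 1) : K) := by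
      rw [Nat.centralBinom, Nat.centralBinom, show 2 * (i + 1) = 2 * i + 1 + 1 by ring,
        Nat.choose_succ_succ]
      have : (2 * i + 1).choose i = (2 * i + 1).choose (i + 1) := Nat.choose_symm_half i |>.symm
      rw [this, Nat.choose_succ_succ]
      push_cast; ring
    have h3 : ((2 * i).choose i : K) = i.centralBinom := rfl
    simp only [pow_zero, add_zero, pow_one, h3]
    rw [h2]
    push_cast
    ring

/-- The antisymmetric counterpart, written with differences α^m - α^(-m); it serves the sums with an
odd power of i. -/
theorem sub_sub_inv_pow_mul_eq {α : K} (hα : α ≠ 0) {i N : ℕ} (hi : i + 1 ≤ N) :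
    (2 - α - α⁻¹) ^ (i + 1) * (1 + α) = -(1 - α) * ∑ m ∈ Ico 1 (N + 1),
      ((-1) ^ m * (((2 * i + 1).choose (i + m) : K) - ((2 * i + 1).choose (i + 1 + m) : K)))
        * (α ^ m - α⁻¹ ^ m) := by
  have hinv : α * α⁻¹ = 1 := mul_inv_cancel₀ hα
  induction i with
  | zero =>
    rw [sum_eq_single 1]
    · simp
      field_simp
      ring
    · intro m hm hne
      have := mem_Ico.mp hm
      rw [Nat.choose_eq_zero_of_lt (by omega), Nat.choose_eq_zero_of_lt (by omega)]; simp
    · intro h; exact absurd (mem_Ico.mpr (by omega)) h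
  | succ i ih =>
    have h := mul_sum_three_term (2 - α - α⁻¹) (fun m => α ^ m - α⁻¹ ^ m)
      (fun m => (-1) ^ m * (((2 * i + 1).choose (i + m) : K) - ((2 * i + 1).choose (i + 1 + m) : K)))
      (fun m => by
        linear_combination (-α ^ m + α⁻¹ ^ m) * hinv) N
    have h1 : ∀ m ∈ Ico 1 (N + 1), (2 * ((-1) ^ m *
        (((2 * i + 1).choose (i + m) : K) - ((2 * i + 1).choose (i + 1 + m) : K)))
        - (-1) ^ (m - 1) *
          (((2 * i + 1).choose (i + (m - 1)) : K) - ((2 * i + 1).choose (i + 1 + (m - 1)) : K))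
        - (-1) ^ (m + 1) *
          (((2 * i + 1).choose (i + (m + 1)) : K) - ((2 * i + 1).choose (i + 1 + (m + 1)) : K)))
          * (α ^ m - α⁻¹ ^ m) =
        (-1) ^ m * (((2 * (i + 1) + 1).choose (i + 1 + m) : K)
          - ((2 * (i + 1) + 1).choose (i + 1 + 1 + m) : K)) * (α ^ m - α⁻¹ ^ m) := by
      intro m hm
      obtain ⟨l, rfl⟩ : ∃ l, m = l + 1 := ⟨m - 1, by have := mem_Ico.mp hm; omega⟩
      have e : ∀ j, (2 * (i + 1) + 1).choose (j + 2) = (2 * i + 1).choose j +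
          2 * (2 * i + 1).choose (j + 1) + (2 * i + 1).choose (j + 2) := by
        intro j
        have a1 := Nat.choose_succ_succ' (2 * i + 1 + 1) (j + 1)
        have a2 := Nat.choose_succ_succ' (2 * i + 1) j
        have a3 := Nat.choose_succ_succ' (2 * i + 1) (j + 1)
        rw [show 2 * (i + 1) + 1 = 2 * i + 1 + 1 + 1 by ring, show j + 2 = j + 1 + 1 by rfl]
        omega
      rw [show i + 1 + (l + 1) = i + l + 2 by ring, show i + 1 + 1 + (l + 1) = i + l + 1 + 2 by ring,
        e, e, Nat.add_sub_cancel, show i + (l + 1) = i + l + 1 by ring,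
        show i + 1 + l = i + l + 1 by ring, show i + (l + 1 + 1) = i + l + 2 by ring,
        show i + 1 + (l + 1 + 1) = i + l + 1 + 2 by ring,
        show i + l + 1 + 1 = i + l + 2 by ring]
      push_cast
      ring
    rw [sum_congr rfl h1] at h
    have z1 : (2 * i + 1).choose (i + (N + 1)) = 0 := Nat.choose_eq_zero_of_lt (by omega)
    have z2 : (2 * i + 1).choose (i + 1 + (N + 1)) = 0 := Nat.choose_eq_zero_of_lt (by omega)
    have z3 : (2 * i + 1).choose (i + N) = 0 := Nat.choose_eq_zero_of_lt (by omega)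
    have z4 : (2 * i + 1).choose (i + 1 + N) = 0 := Nat.choose_eq_zero_of_lt (by omega)
    have z5 : (2 * i + 1).choose (i + 0) = (2 * i + 1).choose (i + 1 + 0) := by
      rw [add_zero, add_zero]; exact Nat.choose_symm_half i |>.symm
    rw [z1, z2, z3, z4, z5] at h
    rw [pow_succ', mul_assoc, ih (by omega)]
    simp only [pow_zero, sub_self, mul_zero, zero_mul, sub_zero, add_zero, Nat.cast_zero] at h
    linear_combination (-(1 - α)) * h

variable [CharZero K]

theorem centralBinom_cast_ne_zero (i : ℕ) : (i.centralBinom : K) ≠ 0 :=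
  Nat.cast_ne_zero.mpr i.centralBinom_ne_zero

theorem centralBinom_succ_cast (i : ℕ) :
    ((i : K) + 1) * (i + 1).centralBinom = 2 * (2 * i + 1) * i.centralBinom := by
  exact_mod_cast congrArg (fun n : ℕ => (n : K)) (Nat.succ_mul_centralBinom_succ i)

/-- The ratio `binom(2i, i + m) / binom(2i, i)`. -/
def centralRatio (K : Type*) [Field K] (m i : ℕ) : K :=
  ((2 * i).choose (i + m) : K) / i.centralBinom

theorem centralRatio_step (m i : ℕ) :
    centralRatio K m i * ((i : K) + 1) ^ 2 =
      centralRatio K m (i + 1) * (((i : K) + 1) ^ 2 - (m : K) ^ 2) := by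
  have h0 := centralBinom_cast_ne_zero (K := K) i
  have h0' := centralBinom_cast_ne_zero (K := K) (i + 1)
  have h1 := centralBinom_succ_cast (K := K) i
  have hi : ((i : K) + 1) ≠ 0 := Nat.cast_add_one_ne_zero i
  have h2 : ((2 * (i + 1)).choose (i + 1 + m) : K) * ((i + 1 + m : ℕ) : K) =
      (2 * (i : K) + 2) * ((2 * i + 1).choose (i + m) : K) := by
    have := Nat.add_one_mul_choose_eq (2 * i + 1) (i + m)
    have := congrArg (fun n : ℕ => (n : K)) this
    push_cast at this ⊢
    rw [show 2 * (i + 1) = 2 * i + 1 + 1 by ring, show i + 1 + m = i + m + 1 by ring]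
    linear_combination -this
  have h3 : ((2 * i + 1).choose (i + m) : K) * ((i : K) + 1 - m) =
      (2 * (i : K) + 1) * ((2 * i).choose (i + m) : K) := by
    by_cases hm : m ≤ i + 1
    · have := Nat.choose_mul_succ_eq (2 * i) (i + m)
      have := congrArg (fun n : ℕ => (n : K)) this
      simp only [Nat.cast_mul] at this
      rw [Nat.cast_sub (by omega)] at this
      push_cast at this ⊢
      linear_combination -this
    · rw [Nat.choose_eq_zero_of_lt (by omega), Nat.choose_eq_zero_of_lt (by omega)]; simp
  rw [centralRatio, centralRatio]
  field_simp
  push_cast at h2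
  have h4 : ((2 * (i + 1)).choose (i + 1 + m) : K) * (((i : K) + 1) ^ 2 - (m : K) ^ 2) =
      (2 * (i : K) + 2) * ((2 * (i : K) + 1) * ((2 * i).choose (i + m) : K)) := by
    linear_combination ((i : K) + 1 - m) * h2 + (2 * (i : K) + 2) * h3
  linear_combination ((i : K) + 1) * ((2 * i).choose (i + m) : K) * h1
    - (i.centralBinom : K) * h4

/-- Telescoping: consecutive ratios differ by the factor 1 - m²/(i+1)², and the right-hand side is
chosen so that its increments are the summands. -/
theorem sum_centralRatio_mul_harmonicSum {m : ℕ} (hm : 0 < m) (N : ℕ) :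
    ∑ i ∈ Ico 1 (N + 1), centralRatio K m i * harmonicSum K 2 (i - 1) / (i : K) ^ 2 =
      centralRatio K m N * (harmonicSum K 2 N / (m : K) ^ 2 - 1 / (m : K) ^ 4) := by
  have hm0 : (m : K) ≠ 0 := Nat.cast_ne_zero.mpr hm.ne'
  induction N with
  | zero => simp [centralRatio, Nat.choose_eq_zero_of_lt hm]
  | succ N ih =>
    have h1 := centralRatio_step (K := K) m N
    have hN : ((N : K) + 1) ≠ 0 := Nat.cast_add_one_ne_zero N
    have h2 : centralRatio K m N =
        centralRatio K m (N + 1) * (1 - (m : K) ^ 2 / ((N : K) + 1) ^ 2) := by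
      field_simp
      linear_combination h1
    rw [sum_Ico_succ_top (by omega), ih, h2, Nat.add_sub_cancel, harmonicSum_succ, Nat.cast_succ]
    field_simp
    ring

variable {k : Type*} [Field k] {p : ℕ} [hp : Fact p.Prime] [CharP k p]
  {V : ValuationSubring K} {ρ : V →+* k} [IsLocalHom ρ]

/-- Consecutive binomials have quotient (p-1-l)/(p+l). The denominator p at l = 0 is absorbed by the
prefactor; each later quotient is -(l+1)/l modulo p, and the product of these telescopes. -/
theorem red_prime_mul_centralRatio {m : ℕ} (hm : m ∈ Ico 1 p) :
    Red ρ ((-1) ^ m * (p * centralRatio K m (p - 1))) (m : k) := by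
  obtain ⟨h1, h2⟩ := mem_Ico.mp hm
  have hcb := centralBinom_cast_ne_zero (K := K) (p - 1)
  have hpK : (p : K) ≠ 0 := Nat.cast_ne_zero.mpr hp.out.ne_zero
  have hcast : ((p - 1 : ℕ) : K) = p - 1 := by rw [Nat.cast_sub hp.out.one_le, Nat.cast_one]
  have step : ∀ l, l + 1 < p → centralRatio K (l + 1) (p - 1) * ((p : K) + l) =
      centralRatio K l (p - 1) * ((p : K) - 1 - l) := by
    intro l hl
    have := Nat.choose_succ_right_eq (2 * (p - 1)) (p - 1 + l)
    have := congrArg (fun n : ℕ => (n : K)) this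
    simp only [Nat.cast_mul] at this
    rw [show 2 * (p - 1) - (p - 1 + l) = p - (1 + l) by omega, Nat.cast_sub (by omega),
      show p - 1 + l + 1 = p + l by omega] at this
    push_cast at this
    rw [centralRatio, centralRatio, show p - 1 + (l + 1) = p + l by omega]
    field_simp
    linear_combination this
  induction m, h1 using Nat.le_induction with
  | base =>
    have h3 := step 0 (by omega)
    have h4 : centralRatio K 0 (p - 1) = 1 := by
      rw [centralRatio, add_zero]; exact div_self hcb
    rw [h4] at h3
    refine Red.congr (Red.one.sub (Red.prime p)) ?_ (by simp)
    push_cast at h3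
    linear_combination -h3
  | succ m hm1 ih =>
    have h3 := ih (mem_Ico.mpr ⟨hm1, by omega⟩) (by omega)
    have h4 := step m h2
    have h5 : (m : k) ≠ 0 := natCast_ne_zero_of_lt (p := p) hm1 (by omega)
    have h6 : ((p : K) + m) ≠ 0 := by
      have : ((p + m : ℕ) : K) ≠ 0 := Nat.cast_ne_zero.mpr (by omega)
      exact_mod_cast this
    have h7 : Red ρ ((p : K) + m) (m : k) :=
      ((Red.prime p).add (Red.natCast m)).congr rfl (by simp)
    have h8 : Red ρ (1 + (m : K) - p) ((m : k) + 1) :=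
      ((Red.one.add (Red.natCast m)).sub (Red.prime p)).congr rfl (by ring)
    refine Red.congr ((h3.mul h8).div h7 h5) ?_ (by push_cast; field_simp)
    rw [eq_div_iff h6, pow_succ]
    linear_combination (-(-1) ^ m * p) * h4

/-- The sum `p ∑ t ^ i H_{i-1}(2) / (i ^ 2 binom(2i, i))` modulo `p`, for `t = 2 - α - α⁻¹`. -/
theorem red_sum_harmonicSum_div_sq (hp3 : 3 < p) {α : K} {a : k} (hα : Red ρ α a) (ha : a ≠ 0)
    {t : K} (ht : t = 2 - α - α⁻¹) :
    Red ρ (∑ i ∈ Ico 1 p, p * t ^ i / (i.centralBinom : K) * (harmonicSum K 2 (i - 1))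
      * (1 / (i : K) ^ 2)) (-(finPolylog p 3 a + finPolylog p 3 a⁻¹)) := by
  have hα0 : α ≠ 0 := by rintro rfl; exact ha (hα.unique Red.zero)
  have hpp : p - 1 + 1 = p := Nat.sub_add_cancel hp.out.one_le
  -- Expand t^i and exchange the sums. The constant term of the expansion keeps a factor p, and for
  -- each m the sum over i telescopes.
  have e : ∑ i ∈ Ico 1 p, p * t ^ i / (i.centralBinom : K) * (harmonicSum K 2 (i - 1))
      * (1 / (i : K) ^ 2) = (p : K) * ∑ i ∈ Ico 1 p, harmonicSum K 2 (i - 1) * (1 / (i : K) ^ 2) +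
      ∑ m ∈ Ico 1 p, (α ^ m + α⁻¹ ^ m) * ((-1) ^ m * (p * centralRatio K m (p - 1)) *
        (harmonicSum K 2 (p - 1) * (1 / (m : K) ^ 2) - 1 / (m : K) ^ 4)) := by
    have h1 : ∀ m ∈ Ico 1 p, (α ^ m + α⁻¹ ^ m) * ((-1) ^ m * (p * centralRatio K m (p - 1)) *
        (harmonicSum K 2 (p - 1) * (1 / (m : K) ^ 2) - 1 / (m : K) ^ 4)) =
        ∑ i ∈ Ico 1 p, (α ^ m + α⁻¹ ^ m) * ((-1) ^ m * p *
          (centralRatio K m i * harmonicSum K 2 (i - 1) / (i : K) ^ 2)) := by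
      intro m hm
      have := sum_centralRatio_mul_harmonicSum (K := K) (mem_Ico.mp hm).1 (p - 1)
      rw [hpp] at this
      rw [← mul_sum, ← mul_sum, this]
      ring
    rw [sum_congr rfl h1, sum_comm, mul_sum, ← sum_add_distrib]
    refine sum_congr rfl fun i hi => ?_
    have h2 := sub_sub_inv_pow_eq hα0 (i := i) (N := p - 1) (by have := mem_Ico.mp hi; omega)
    have h3 := centralBinom_cast_ne_zero (K := K) i
    rw [hpp] at h2
    rw [ht, h2, mul_add, add_div, add_mul, add_mul, mul_div_cancel_right₀ _ h3, mul_sum, sum_div,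
      sum_mul, sum_mul]
    congr 1
    · ring
    · refine sum_congr rfl fun m _ => ?_
      rw [centralRatio]
      ring
  rw [e]
  -- As H_{p-1}(2) vanishes, only m · (-1/m⁴) remains as the weight of α^m + α^(-m).
  have hH := harmonicSum_prime_sub_one (k := k) hp3 two_pos (by omega)
  have h1 : Red ρ (∑ i ∈ Ico 1 p, harmonicSum K 2 (i - 1) * (1 / (i : K) ^ 2))
      (∑ i ∈ Ico 1 p, harmonicSum k 2 (i - 1) * (1 / (i : k) ^ 2)) :=
    Red.sum fun i hi => (Red.harmonicSum (p := p) (by have := mem_Ico.mp hi; omega) 2).mul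
      (Red.one_div_pow (mem_Ico.mp hi).1 (mem_Ico.mp hi).2 2)
  have h2 : Red ρ (∑ m ∈ Ico 1 p, (α ^ m + α⁻¹ ^ m) * ((-1) ^ m * (p * centralRatio K m (p - 1)) *
        (harmonicSum K 2 (p - 1) * (1 / (m : K) ^ 2) - 1 / (m : K) ^ 4)))
      (∑ m ∈ Ico 1 p, (a ^ m + a⁻¹ ^ m) * ((m : k) *
        (harmonicSum k 2 (p - 1) * (1 / (m : k) ^ 2) - 1 / (m : k) ^ 4))) :=
    Red.sum fun m hm => ((hα.pow m).add ((hα.inv ha).pow m)).mul ((red_prime_mul_centralRatio hm).mul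
      (((Red.harmonicSum (p := p) (by have := hp.out.pos; omega) 2).mul
        (Red.one_div_pow (mem_Ico.mp hm).1 (mem_Ico.mp hm).2 2)).sub
        (Red.one_div_pow (mem_Ico.mp hm).1 (mem_Ico.mp hm).2 4)))
  refine (((Red.prime p).mul h1).add h2).congr rfl ?_
  rw [zero_mul, zero_add, finPolylog, finPolylog, ← sum_add_distrib, ← sum_neg_distrib]
  refine sum_congr rfl fun m hm => ?_
  have h0 := cast_ne_zero_of_mem_Ico (k := k) hm
  rw [hH]
  field_simp
  ring

/-- The sum `p ∑ t ^ i H_{i-1}(2) / (i binom(2i, i))` modulo `p`, for `t = 2 - α - α⁻¹`. -/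
theorem red_sum_harmonicSum_div (hp3 : 3 < p) {α : K} {a : k} (hα : Red ρ α a) (ha : a ≠ 0)
    (ha1 : 1 + a ≠ 0) {t : K} (ht : t = 2 - α - α⁻¹) :
    Red ρ (∑ i ∈ Ico 1 p, p * t ^ i / (i.centralBinom : K) * (harmonicSum K 2 (i - 1))
      * (1 / (i : K))) ((1 - a) / (1 + a) * (finPolylog p 2 a - finPolylog p 2 a⁻¹)) := by
  have hα0 : α ≠ 0 := by rintro rfl; exact ha (hα.unique Red.zero)
  have hα1 : 1 + α ≠ 0 := by
    intro h
    refine ha1 ((Red.one.add hα).unique (h ▸ Red.zero))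
  have hpp : p - 1 + 1 = p := Nat.sub_add_cancel hp.out.one_le
  have e : (∑ i ∈ Ico 1 p, p * t ^ i / (i.centralBinom : K) * (harmonicSum K 2 (i - 1))
      * (1 / (i : K))) = (1 - α) / (1 + α) *
      -∑ m ∈ Ico 1 p, (α ^ m - α⁻¹ ^ m) * ((-1) ^ m * (p * centralRatio K m (p - 1)) *
        ((m : K) * (harmonicSum K 2 (p - 1) * (1 / (m : K) ^ 2) - 1 / (m : K) ^ 4))) := by
    have h1 : ∀ m ∈ Ico 1 p, (α ^ m - α⁻¹ ^ m) * ((-1) ^ m * (p * centralRatio K m (p - 1)) *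
        ((m : K) * (harmonicSum K 2 (p - 1) * (1 / (m : K) ^ 2) - 1 / (m : K) ^ 4))) =
        ∑ i ∈ Ico 1 p, (α ^ m - α⁻¹ ^ m) * ((-1) ^ m * p * m *
          (centralRatio K m i * harmonicSum K 2 (i - 1) / (i : K) ^ 2)) := by
      intro m hm
      have := sum_centralRatio_mul_harmonicSum (K := K) (mem_Ico.mp hm).1 (p - 1)
      rw [hpp] at this
      rw [← mul_sum, ← mul_sum, this]
      ring
    rw [sum_congr rfl h1, sum_comm, div_mul_eq_mul_div, eq_div_iff hα1, sum_mul, ← sum_neg_distrib,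
      mul_sum]
    refine sum_congr rfl fun i hi => ?_
    have hi' := mem_Ico.mp hi
    obtain ⟨j, rfl⟩ : ∃ j, i = j + 1 := ⟨i - 1, by omega⟩
    have h2 := sub_sub_inv_pow_mul_eq hα0 (i := j) (N := p - 1) (by omega)
    have h3 := centralBinom_cast_ne_zero (K := K) (j + 1)
    have h4 : ((j + 1 : ℕ) : K) ≠ 0 := Nat.cast_ne_zero.mpr (by omega)
    rw [hpp, ← ht] at h2
    have h5 : p * t ^ (j + 1) / ((j + 1).centralBinom : K) * (harmonicSum K 2 (j + 1 - 1))
      * (1 / ((j + 1 : ℕ) : K)) * (1 + α) = (t ^ (j + 1) * (1 + α)) *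
      (p / ((j + 1).centralBinom : K) * harmonicSum K 2 (j + 1 - 1) * (1 / ((j + 1 : ℕ) : K))) := by
      ring
    rw [h5, h2, neg_mul, neg_mul, mul_assoc, ← mul_neg, sum_mul, ← sum_neg_distrib,
      ← sum_neg_distrib]
    congr 1
    refine sum_congr rfl fun m _ => ?_
    -- The antisymmetric coefficient is m/i times the symmetric one, which supplies the second
    -- factor 1/i needed for telescoping.
    have h6 : (((2 * j + 1).choose (j + m) : K) - ((2 * j + 1).choose (j + 1 + m) : K)) *
        ((j + 1 : ℕ) : K) = m * ((2 * (j + 1)).choose (j + 1 + m) : K) := by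
      have e1 := congrArg (fun n : ℕ => (n : K)) (Nat.add_one_mul_choose_eq (2 * j + 1) (j + m))
      have e2 : ((2 * (j + 1)).choose (j + 1 + m) : K) =
          (2 * j + 1).choose (j + m) + (2 * j + 1).choose (j + 1 + m) := by
        rw [show 2 * (j + 1) = 2 * j + 1 + 1 by ring, show j + 1 + m = j + m + 1 by ring,
          Nat.choose_succ_succ]
        push_cast; ring
      rw [show 2 * j + 1 + 1 = 2 * (j + 1) by ring, show j + m + 1 = j + 1 + m by ring] at e1
      push_cast at e1 ⊢
      linear_combination e1 + (j + 1) * e2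
    rw [centralRatio]
    field_simp
    linear_combination (-(α ^ m - α⁻¹ ^ m)) * (p : K) * harmonicSum K 2 (j + 1 - 1) * h6
  rw [e]
  have hH := harmonicSum_prime_sub_one (k := k) hp3 two_pos (by omega)
  have h2 : Red ρ (∑ m ∈ Ico 1 p, (α ^ m - α⁻¹ ^ m) * ((-1) ^ m * (p * centralRatio K m (p - 1)) *
        ((m : K) * (harmonicSum K 2 (p - 1) * (1 / (m : K) ^ 2) - 1 / (m : K) ^ 4))))
      (∑ m ∈ Ico 1 p, (a ^ m - a⁻¹ ^ m) * ((m : k) *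
        ((m : k) * (harmonicSum k 2 (p - 1) * (1 / (m : k) ^ 2) - 1 / (m : k) ^ 4)))) :=
    Red.sum fun m hm => ((hα.pow m).sub ((hα.inv ha).pow m)).mul ((red_prime_mul_centralRatio hm).mul
      ((Red.natCast m).mul (((Red.harmonicSum (p := p) (by have := hp.out.pos; omega) 2).mul
        (Red.one_div_pow (mem_Ico.mp hm).1 (mem_Ico.mp hm).2 2)).sub
        (Red.one_div_pow (mem_Ico.mp hm).1 (mem_Ico.mp hm).2 4))))
  refine (((Red.one.sub hα).div (Red.one.add hα) ha1).mul h2.neg).congr rfl ?_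
  congr 1
  rw [finPolylog, finPolylog, ← sum_sub_distrib, ← sum_neg_distrib]
  refine sum_congr rfl fun m hm => ?_
  have h0 := cast_ne_zero_of_mem_Ico (k := k) hm
  rw [hH]
  field_simp
  ring

end

/-! ### Chebyshev closed forms and denominator sums modulo p³ -/

section

/-- The polynomials `∑_j binom(n + j, 2 j + 1) (-t) ^ j`, truncated at `j < N`. -/
def lucasSum {R : Type*} [CommRing R] (t : R) (N n : ℕ) : R :=
  ∑ j ∈ range N, ((n + j).choose (2 * j + 1) : R) * (-t) ^ j

/-- Pascal's rule used twice makes the second difference in n a shift in j. The bound on `n` ensures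
that the truncation discards nothing. -/
theorem lucasSum_add_two {R : Type*} [CommRing R] (t : R) {N n : ℕ} (hn : n + 2 ≤ N) :
    lucasSum t N (n + 2) = (2 - t) * lucasSum t N (n + 1) - lucasSum t N n := by
  obtain ⟨M, rfl⟩ : ∃ M, N = M + 1 := ⟨N - 1, by omega⟩
  have h1 : (-t) * lucasSum t (M + 1) (n + 1) =
      ∑ j ∈ range M, ((n + (j + 1)).choose (2 * j + 1) : R) * (-t) ^ (j + 1)
        + ((n + 1 + M).choose (2 * M + 1) : R) * (-t) ^ (M + 1) := by
    rw [lucasSum, sum_range_succ, mul_add, mul_sum]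
    congr 1
    · refine sum_congr rfl fun j _ => ?_
      rw [show n + 1 + j = n + (j + 1) by ring]
      ring
    · ring
  have h2 : lucasSum t (M + 1) (n + 2) - 2 * lucasSum t (M + 1) (n + 1) + lucasSum t (M + 1) n =
      ∑ j ∈ range M, ((n + (j + 1)).choose (2 * j + 1) : R) * (-t) ^ (j + 1) := by
    simp only [lucasSum, mul_sum]
    rw [sum_range_succ', sum_range_succ', sum_range_succ']
    have h3 : ∀ j ∈ range M, ((n + (j + 1)).choose (2 * j + 1) : R) * (-t) ^ (j + 1) =
        ((n + 2 + (j + 1)).choose (2 * (j + 1) + 1) : R) * (-t) ^ (j + 1)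
        - 2 * (((n + 1 + (j + 1)).choose (2 * (j + 1) + 1) : R) * (-t) ^ (j + 1))
        + ((n + (j + 1)).choose (2 * (j + 1) + 1) : R) * (-t) ^ (j + 1) := by
      intro j _
      have a1 := Nat.choose_succ_succ' (n + 1 + (j + 1)) (2 * (j + 1))
      have a2 := Nat.choose_succ_succ' (n + (j + 1)) (2 * (j + 1))
      have a3 := Nat.choose_succ_succ' (n + (j + 1)) (2 * j + 1)
      rw [show n + 2 + (j + 1) = n + 1 + (j + 1) + 1 by ring, a1,
        show n + 1 + (j + 1) = n + (j + 1) + 1 by ring, a2, show 2 * (j + 1) = 2 * j + 1 + 1 by ring,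
        a3]
      push_cast
      ring
    rw [sum_congr rfl h3, sum_add_distrib, sum_sub_distrib]
    simp
    ring
  rw [Nat.choose_eq_zero_of_lt (by omega), Nat.cast_zero, zero_mul, add_zero] at h1
  linear_combination h2 - h1

theorem lucasSum_zero {R : Type*} [CommRing R] (t : R) (N : ℕ) : lucasSum t N 0 = 0 :=
  sum_eq_zero fun j _ => by rw [Nat.choose_eq_zero_of_lt (by omega)]; simp

theorem lucasSum_one {R : Type*} [CommRing R] (t : R) {N : ℕ} (hN : 1 ≤ N) : lucasSum t N 1 = 1 := by
  rw [lucasSum, sum_eq_single 0]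
  · simp
  · intro j _ hj
    rw [Nat.choose_eq_zero_of_lt (by omega)]; simp
  · intro h; exact absurd (mem_range.mpr (by omega)) h

variable {K : Type*} [Field K]

/-- The recurrence has characteristic roots α and α⁻¹, with sum 2 - t and product 1; the values are
Chebyshev polynomials of the second kind. -/
theorem lucasSum_mul {α t : K} (hα : α ≠ 0) (ht : t = 2 - α - α⁻¹) {N n : ℕ} (hn : n ≤ N)
    (hN : 1 ≤ N) : (α - α⁻¹) * lucasSum t N n = α ^ n - α⁻¹ ^ n := by
  have hinv : α * α⁻¹ = 1 := mul_inv_cancel₀ hα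
  induction n using Nat.twoStepInduction with
  | zero => simp [lucasSum_zero]
  | one => simp [lucasSum_one t hN]
  | more n h1 h2 =>
    rw [lucasSum_add_two t hn, ht] at *
    linear_combination (α + α⁻¹) * h2 (by omega) - h1 (by omega) + (α ^ n - α⁻¹ ^ n) * hinv

theorem lucasSum_sub {α t : K} (hα : α ≠ 0) (ht : t = 2 - α - α⁻¹) {N n : ℕ} (hn : n + 2 ≤ N) :
    lucasSum t N (n + 2) - lucasSum t N n = α ^ (n + 1) + α⁻¹ ^ (n + 1) := by
  have hinv : α * α⁻¹ = 1 := mul_inv_cancel₀ hα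
  induction n using Nat.twoStepInduction with
  | zero => rw [lucasSum_add_two t hn, lucasSum_one t (by omega), lucasSum_zero, ht]; ring
  | one =>
    rw [lucasSum_add_two t hn, lucasSum_add_two t (by omega : 0 + 2 ≤ N), zero_add,
      lucasSum_one t (by omega), lucasSum_zero, ht]
    linear_combination 2 * hinv
  | more n h1 h2 =>
    rw [lucasSum_add_two t hn]
    conv_lhs => rw [lucasSum_add_two t (by omega : n + 2 ≤ N)]
    have h1' := h1 (by omega)
    have h2' := h2 (by omega)
    rw [lucasSum_add_two t (by omega : n + 1 + 2 ≤ N)] at h2' ⊢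
    rw [lucasSum_add_two t (by omega : n + 2 ≤ N)] at h1' h2' ⊢
    rw [ht] at *
    linear_combination (α + α⁻¹) * h2' - h1' + (α ^ (n + 1) + α⁻¹ ^ (n + 1)) * hinv

variable [CharZero K]

/-- The terms `n t ^ i / (i binom(2i, i)) ∏_{0 < j < i} (1 - n ^ 2 / j ^ 2)`, which are also equal
to `(-1) ^ (i - 1) binom(n + i - 1, 2 i - 1) t ^ i / 2`. -/
def centralTerm (n : ℕ) (t : K) (i : ℕ) : K :=
  n * t ^ i / ((i : K) * i.centralBinom) * ∏ j ∈ range (i - 1), (1 - (n : K) ^ 2 / ((j : K) + 1) ^ 2)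

theorem centralTerm_one (n : ℕ) (t : K) : centralTerm n t 1 = n * t / 2 := by
  simp [centralTerm, Nat.centralBinom, Nat.choose]

theorem centralTerm_succ (n : ℕ) (t : K) (i : ℕ) :
    (4 * (i : K) + 6) * centralTerm n t (i + 2) =
      t * (((i : K) + 1) - (n : K) ^ 2 / ((i : K) + 1)) * centralTerm n t (i + 1) := by
  have h1 := centralBinom_succ_cast (K := K) (i + 1)
  have h0 := centralBinom_cast_ne_zero (K := K) (i + 1)
  have h0' := centralBinom_cast_ne_zero (K := K) (i + 1 + 1)
  have hi : ((i : K) + 1) ≠ 0 := Nat.cast_add_one_ne_zero i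
  have hi' : ((i : K) + 1 + 1) ≠ 0 := by exact_mod_cast Nat.cast_add_one_ne_zero (R := K) (i + 1)
  rw [centralTerm, centralTerm, show i + 2 - 1 = i + 1 by omega, prod_range_succ,
    Nat.add_sub_cancel, show i + 2 = i + 1 + 1 by ring]
  push_cast at h1 ⊢
  generalize ∏ j ∈ range i, (1 - (n : K) ^ 2 / ((j : K) + 1) ^ 2) = P
  field_simp
  linear_combination (-(n : K) * t ^ 2 * t ^ i * P * (((i : K) + 1) ^ 2 - (n : K) ^ 2)) * h1

theorem centralTerm_succ_eq (n : ℕ) (t : K) (i : ℕ) :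
    2 * centralTerm n t (i + 1) = t * (((n + i).choose (2 * i + 1) : K) * (-t) ^ i) := by
  induction i with
  | zero => rw [centralTerm_one]; simp; ring
  | succ i ih =>
    have h1 := centralTerm_succ n t i
    have hi : ((i : K) + 1) ≠ 0 := Nat.cast_add_one_ne_zero i
    have h2 : (4 * (i : K) + 6) ≠ 0 := by
      have : ((4 * i + 6 : ℕ) : K) ≠ 0 := Nat.cast_ne_zero.mpr (by omega)
      exact_mod_cast this
    have h3 : ((n + (i + 1)).choose (2 * (i + 1) + 1) : K) * ((2 * i + 3) * (2 * i + 2)) =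
        ((n : K) ^ 2 - ((i : K) + 1) ^ 2) * ((n + i).choose (2 * i + 1) : K) := by
      rcases le_or_gt n i with h | h
      · rw [Nat.choose_eq_zero_of_lt (by omega), Nat.choose_eq_zero_of_lt (by omega)]; simp
      have a1 := congrArg (fun n : ℕ => (n : K)) (Nat.add_one_mul_choose_eq (n + i) (2 * i + 2))
      have a2 := congrArg (fun n : ℕ => (n : K)) (Nat.choose_succ_right_eq (n + i) (2 * i + 1))
      simp only [Nat.cast_mul] at a1 a2
      rw [Nat.cast_sub (by omega)] at a2
      push_cast at a1 a2
      rw [show n + (i + 1) = n + i + 1 by ring, show 2 * (i + 1) + 1 = 2 * i + 2 + 1 by ring]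
      rw [show 2 * i + 1 + 1 = 2 * i + 2 by ring] at a2
      linear_combination (-2 * (i : K) - 2) * a1 + ((n : K) + i + 1) * a2
    refine mul_left_cancel₀ h2 ?_
    have h4 : (4 * (i : K) + 6) * (2 * centralTerm n t (i + 1 + 1)) =
        t * (((i : K) + 1) - (n : K) ^ 2 / ((i : K) + 1)) * (2 * centralTerm n t (i + 1)) := by
      linear_combination 2 * h1
    rw [h4, ih]
    field_simp
    linear_combination (t ^ 2 * (-t) ^ i) * h3

theorem sum_centralTerm (n : ℕ) (t : K) (N : ℕ) :
    2 * ∑ i ∈ Ico 1 (N + 1), centralTerm n t i = t * lucasSum t N n := by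
  rw [sum_Ico_eq_sum_range, lucasSum, mul_sum, mul_sum, Nat.add_sub_cancel]
  refine sum_congr rfl fun i _ => ?_
  rw [add_comm 1 i, centralTerm_succ_eq]

/-- Dividing by i passes from second-kind to first-kind Chebyshev coefficients, that is, to
differences of binomials with upper indices two apart; the constant 2 is the omitted term j = 0. -/
theorem sum_centralTerm_div (n : ℕ) (t : K) (N : ℕ) :
    2 * (n + 1) * ∑ i ∈ Ico 1 (N + 1), centralTerm (n + 1) t i / (i : K) =
      2 - (lucasSum t (N + 1) (n + 2) - lucasSum t (N + 1) n) := by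
  rw [sum_Ico_eq_sum_range, lucasSum, lucasSum, mul_sum, Nat.add_sub_cancel, sum_range_succ',
    sum_range_succ']
  have h : ∀ i ∈ range N, 2 * ((n : K) + 1) * (centralTerm (n + 1) t (1 + i) / ((1 + i : ℕ) : K)) =
      ((n + (i + 1)).choose (2 * (i + 1) + 1) : K) * (-t) ^ (i + 1)
        - ((n + 2 + (i + 1)).choose (2 * (i + 1) + 1) : K) * (-t) ^ (i + 1) := by
    intro i _
    have h1 := centralTerm_succ_eq (n + 1) t i
    have hi : ((i : K) + 1) ≠ 0 := Nat.cast_add_one_ne_zero i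
    have a1 := congrArg (fun n : ℕ => (n : K))
      (Nat.choose_succ_succ' (n + 1 + (i + 1)) (2 * (i + 1)))
    have a2 := congrArg (fun n : ℕ => (n : K)) (Nat.choose_succ_succ' (n + (i + 1)) (2 * (i + 1)))
    have a3 := congrArg (fun n : ℕ => (n : K)) (Nat.choose_succ_succ' (n + (i + 1)) (2 * i + 1))
    have a4 := congrArg (fun n : ℕ => (n : K)) (Nat.choose_succ_right_eq (n + (i + 1)) (2 * i + 1))
    have a5 : ((n + (i + 1) - (2 * i + 1) : ℕ) : K) * ((n + (i + 1)).choose (2 * i + 1) : K) =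
        ((n : K) - i) * ((n + (i + 1)).choose (2 * i + 1) : K) := by
      rcases le_or_gt i n with h | h
      · rw [Nat.cast_sub (by omega)]; push_cast; ring
      · rw [Nat.choose_eq_zero_of_lt (show n + (i + 1) < 2 * i + 1 by omega)]; simp
    simp only [Nat.cast_mul] at a4
    rw [mul_comm ((n + (i + 1)).choose (2 * i + 1) : K), a5] at a4
    rw [show 1 + i = i + 1 by ring, show n + 2 + (i + 1) = n + 1 + (i + 1) + 1 by ring, a1,
      show n + 1 + (i + 1) = n + (i + 1) + 1 by ring]
    rw [show n + 1 + (i + 1) = n + (i + 1) + 1 by ring] at a1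
    rw [show n + 1 + i = n + (i + 1) by ring] at h1
    push_cast at a1 a2 a3 a4 h1 ⊢
    rw [a2]
    rw [show 2 * (i + 1) = 2 * i + 1 + 1 by ring] at *
    rw [a3]
    field_simp
    linear_combination ((n : K) + 1) * h1 - (t * (-t) ^ i) * a4
  rw [sum_congr rfl h, sum_sub_distrib]
  simp
  ring

/-- Sum the two-term recurrence `centralTerm_succ`. The upper limit may be raised by one because the
factor i - n²/i vanishes at i = n. -/
theorem sum_mul_centralTerm (n : ℕ) (t : K) :
    (4 - t) * ∑ i ∈ Ico 1 (n + 1), (i : K) * centralTerm n t i =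
      2 * ∑ i ∈ Ico 1 (n + 1), centralTerm n t i + n * t
        - t * (n : K) ^ 2 * ∑ i ∈ Ico 1 (n + 1), centralTerm n t i / (i : K) := by
  have h : ∀ N : ℕ, ∑ i ∈ Ico 1 (N + 1 + 1), (4 * (i : K) - 2) * centralTerm n t i = n * t +
      t * ∑ i ∈ Ico 1 (N + 1), ((i : K) - (n : K) ^ 2 / (i : K)) * centralTerm n t i := by
    intro N
    induction N with
    | zero => simp [centralTerm_one]; ring
    | succ N ih =>
      have h1 := centralTerm_succ n t N
      rw [sum_Ico_succ_top (by omega), ih, sum_Ico_succ_top (b := N + 1) (by omega)]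
      push_cast
      linear_combination h1
  have hn : ∀ i ∈ Ico 1 (n + 1), ((i : K) - (n : K) ^ 2 / (i : K)) * centralTerm n t i =
      (i : K) * centralTerm n t i - (n : K) ^ 2 * (centralTerm n t i / (i : K)) := by
    intro i _; ring
  have hn' : ∀ i ∈ Ico 1 (n + 1), (4 * (i : K) - 2) * centralTerm n t i =
      4 * ((i : K) * centralTerm n t i) - 2 * centralTerm n t i := by
    intro i _; ring
  rcases Nat.eq_zero_or_pos n with rfl | hpos
  · simp
  obtain ⟨N, rfl⟩ : ∃ N, n = N + 1 := ⟨n - 1, by omega⟩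
  have h1 := h N
  have h2 : ∑ i ∈ Ico 1 (N + 1), ((i : K) - ((N + 1 : ℕ) : K) ^ 2 / (i : K)) * centralTerm (N + 1) t i =
      ∑ i ∈ Ico 1 (N + 1 + 1), ((i : K) - ((N + 1 : ℕ) : K) ^ 2 / (i : K)) * centralTerm (N + 1) t i := by
    have : ((N + 1 : ℕ) : K) ≠ 0 := Nat.cast_ne_zero.mpr (by omega)
    rw [sum_Ico_succ_top (b := N + 1) (by omega)]
    field_simp
    ring
  rw [h2, sum_congr rfl hn, sum_congr rfl hn', sum_sub_distrib, sum_sub_distrib, ← mul_sum, ← mul_sum,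
    ← mul_sum] at h1
  linear_combination h1

variable {k : Type*} [Field k] {p : ℕ} [hp : Fact p.Prime] [CharP k p]
  {V : ValuationSubring K} {ρ : V →+* k} [IsLocalHom ρ]

/-- For i < p the prime p divides binom(2i, i) at most once, since 2i < p². -/
theorem exists_red_prime_div_centralBinom {i : ℕ} (hi : i < p) :
    ∃ a, Red ρ ((p : K) / (i.centralBinom : K)) a := by
  have hsq : i.centralBinom.factorization p ≤ 1 :=
    Nat.factorization_choose_le_one (by nlinarith [hp.out.two_le])
  have h0 := i.centralBinom_ne_zero
  have hnd : ∀ m : ℕ, ¬ p ∣ m → ∃ a, Red ρ ((1 : K) / (m : K)) a := fun m hm =>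
    ⟨_, Red.one.div (Red.natCast m) (by rwa [Ne, CharP.cast_eq_zero_iff k p])⟩
  have hpK : (p : K) ≠ 0 := Nat.cast_ne_zero.mpr hp.out.ne_zero
  by_cases hd : p ∣ i.centralBinom
  · obtain ⟨m, hm⟩ := hd
    have hm' : ¬ p ∣ m := by
      intro h
      have : p ^ 2 ∣ i.centralBinom := by rw [hm, pow_two]; exact Nat.mul_dvd_mul_left p h
      have := (hp.out.pow_dvd_iff_le_factorization h0).mp this
      omega
    obtain ⟨a, ha⟩ := hnd m hm'
    refine ⟨a, ha.congr ?_ rfl⟩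
    rw [hm, Nat.cast_mul, ← div_div, div_self hpK]
  · obtain ⟨a, ha⟩ := hnd _ hd
    exact ⟨_, ((Red.prime p).mul ha).congr (by ring) rfl⟩

theorem exists_prod_one_sub_sq {m : ℕ} (hm : m < p) :
    ∃ z, Red ρ z (harmonicSum k 2 m) ∧
      ∏ j ∈ range m, (1 - (p : K) ^ 2 / ((j : K) + 1) ^ 2) = 1 - (p : K) ^ 2 * z := by
  induction m with
  | zero => exact ⟨0, Red.zero.congr rfl (harmonicSum_zero 2), by simp⟩
  | succ m ih =>
    obtain ⟨z, hz, he⟩ := ih (by omega)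
    have h1 : Red ρ (1 / ((m + 1 : ℕ) : K) ^ 2) (1 / ((m + 1 : ℕ) : k) ^ 2) :=
      Red.one_div_pow (p := p) (by omega) hm 2
    refine ⟨z + 1 / ((m + 1 : ℕ) : K) ^ 2 - (p : K) * (p * (z * (1 / ((m + 1 : ℕ) : K) ^ 2))),
      ((hz.add h1).sub ((Red.prime p).mul ((Red.prime p).mul (hz.mul h1)))).congr rfl ?_, ?_⟩
    · rw [harmonicSum_succ]; push_cast; ring
    · rw [prod_range_succ, he]; push_cast; ring

/-- A sum `p ∑ t ^ i c_i / binom(2i, i)` modulo `p ^ 3`. -/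
theorem exists_sum_div_centralBinom_eq {t : K} {s : k} (ht : Red ρ t s) {c : ℕ → K} {c' : ℕ → k}
    (hc : ∀ i ∈ Ico 1 p, Red ρ (c i) (c' i)) {τ : k}
    (hT : Red ρ (∑ i ∈ Ico 1 p, p * t ^ i / (i.centralBinom : K) * harmonicSum K 2 (i - 1) * c i) τ) :
    ∃ Y, Red ρ Y τ ∧ ∑ i ∈ Ico 1 p, p * t ^ i / (i.centralBinom : K) * c i =
      ∑ i ∈ Ico 1 p, (i : K) * centralTerm p t i * c i + (p : K) ^ 2 * Y := by
  have h1 : ∀ i, ∃ z, i ∈ Ico 1 p → Red ρ z (harmonicSum k 2 (i - 1)) ∧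
      ∏ j ∈ range (i - 1), (1 - (p : K) ^ 2 / ((j : K) + 1) ^ 2) = 1 - (p : K) ^ 2 * z := by
    intro i
    by_cases hi : i ∈ Ico 1 p
    · obtain ⟨z, hz⟩ := exists_prod_one_sub_sq (K := K) (ρ := ρ) (p := p) (m := i - 1)
        (by have := mem_Ico.mp hi; omega)
      exact ⟨z, fun _ => hz⟩
    · exact ⟨0, fun h => absurd h hi⟩
  choose z hz using h1
  -- Here ∏(1 - p²/j²) = 1 - p² z_i with z_i congruent to H_{i-1}(2). As p / binom(2i,i) is
  -- integral, replacing z_i by H_{i-1}(2) does not change the residue.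
  refine ⟨∑ i ∈ Ico 1 p, p * t ^ i / (i.centralBinom : K) * z i * c i, ?_, ?_⟩
  · have h2 : Red ρ (∑ i ∈ Ico 1 p, (p * t ^ i / (i.centralBinom : K) * z i * c i
        - p * t ^ i / (i.centralBinom : K) * harmonicSum K 2 (i - 1) * c i)) (∑ i ∈ Ico 1 p, 0) := by
      refine Red.sum fun i hi => ?_
      have hi' := mem_Ico.mp hi
      obtain ⟨a, ha⟩ := exists_red_prime_div_centralBinom (K := K) (ρ := ρ) hi'.2
      have h3 : Red ρ (harmonicSum K 2 (i - 1)) (harmonicSum k 2 (i - 1)) :=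
        Red.harmonicSum (p := p) (by omega) 2
      refine (((ha.mul (ht.pow i)).mul ((hz i hi).1.sub h3)).mul (hc i hi)).congr ?_ ?_
      · ring
      · ring
    rw [sum_sub_distrib, sum_const_zero] at h2
    refine (h2.add hT).congr (by ring) (by ring)
  · rw [mul_sum, ← sum_add_distrib]
    refine sum_congr rfl fun i hi => ?_
    have hi0 : (i : K) ≠ 0 := Nat.cast_ne_zero.mpr (by have := mem_Ico.mp hi; omega)
    rw [centralTerm, (hz i hi).2]
    field_simp
    ring

/-- The closed forms include the index i = p, one more than the congruences do; this is the term to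
remove, with sign (-1)^(p-1) = 1. -/
theorem centralTerm_prime (hp2 : p ≠ 2) (t : K) : centralTerm p t p = t ^ p / 2 := by
  obtain ⟨n, hn⟩ : ∃ n, p = 2 * n + 1 := (hp.out.odd_of_ne_two hp2)
  have h := centralTerm_succ_eq p t (p - 1)
  rw [Nat.sub_add_cancel hp.out.one_le, show p + (p - 1) = 2 * (p - 1) + 1 by omega,
    Nat.choose_self, neg_pow, show p - 1 = 2 * n by omega, pow_mul (-1 : K)] at h
  have : t ^ p = t ^ (2 * n) * t := by rw [← pow_succ, ← hn]
  rw [this]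
  simp at h
  linear_combination h / 2

/-- The sum `p ∑ t ^ i / (i binom(2i, i))` modulo `p ^ 3`. -/
theorem exists_sum_div_eq (hp3 : 3 < p) {t : K} {s : k} (ht : Red ρ t s) {τ : k}
    (hT : Red ρ (∑ i ∈ Ico 1 p, p * t ^ i / (i.centralBinom : K) * harmonicSum K 2 (i - 1)
      * (1 / (i : K))) τ) :
    ∃ Y, Red ρ Y τ ∧ ∑ i ∈ Ico 1 p, p * t ^ i / (i.centralBinom : K) * (1 / (i : K)) =
      (t * lucasSum t (p + 1) p - t ^ p) / 2 + (p : K) ^ 2 * Y := by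
  obtain ⟨Y, hY, h⟩ := exists_sum_div_centralBinom_eq (c := fun i => 1 / (i : K))
    (c' := fun i => 1 / (i : k)) ht (fun i hi => by
      simpa using Red.one_div_pow (K := K) (ρ := ρ) (mem_Ico.mp hi).1 (mem_Ico.mp hi).2 1) hT
  refine ⟨Y, hY, h.trans ?_⟩
  congr 1
  have h1 := sum_centralTerm p t p
  have h2 : lucasSum t (p + 1) p = lucasSum t p p := by
    rw [lucasSum, sum_range_succ, Nat.choose_eq_zero_of_lt (by omega)]; simp [lucasSum]
  rw [sum_Ico_succ_top hp.out.one_le, centralTerm_prime (by omega)] at h1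
  rw [h2, sum_congr rfl (g := fun i => centralTerm p t i) fun i hi => by
    have hi0 : (i : K) ≠ 0 := Nat.cast_ne_zero.mpr (by have := mem_Ico.mp hi; omega)
    field_simp]
  linear_combination h1 / 2

/-- The sum `p ∑ t ^ i / (i ^ 2 binom(2i, i))` modulo `p ^ 3`, for `t = 2 - α - α⁻¹`. -/
theorem exists_sum_div_sq_eq (hp3 : 3 < p) {α : K} {a : k} (hα : Red ρ α a) (ha : a ≠ 0)
    {t : K} (ht : t = 2 - α - α⁻¹) :
    ∃ Y, Red ρ Y (-(finPolylog p 3 a + finPolylog p 3 a⁻¹)) ∧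
      ∑ i ∈ Ico 1 p, p * t ^ i / (i.centralBinom : K) * (1 / (i : K) ^ 2) =
        (2 - α ^ p - α⁻¹ ^ p - t ^ p) / (2 * p) + (p : K) ^ 2 * Y := by
  have hα0 : α ≠ 0 := by rintro rfl; exact ha (hα.unique Red.zero)
  have hpK : (p : K) ≠ 0 := Nat.cast_ne_zero.mpr hp.out.ne_zero
  obtain ⟨Y, hY, h⟩ := exists_sum_div_centralBinom_eq (c := fun i => 1 / (i : K) ^ 2)
    (c' := fun i => 1 / (i : k) ^ 2) (t := t) (((Red.ofNat 2).sub hα).sub (hα.inv ha) |>.congr ht rfl)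
    (fun i hi => Red.one_div_pow (K := K) (ρ := ρ) (mem_Ico.mp hi).1 (mem_Ico.mp hi).2 2)
    (red_sum_harmonicSum_div_sq hp3 hα ha ht)
  refine ⟨Y, hY, h.trans ?_⟩
  congr 1
  obtain ⟨n, rfl⟩ : ∃ n, p = n + 1 := ⟨p - 1, by have := hp.out.one_le; omega⟩
  have h1 := sum_centralTerm_div n t (n + 1)
  rw [lucasSum_sub hα0 ht (by omega), sum_Ico_succ_top (by omega), centralTerm_prime (by omega)] at h1
  rw [sum_congr rfl (g := fun i => centralTerm (n + 1) t i / (i : K)) fun i hi => by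
    have hi0 : (i : K) ≠ 0 := Nat.cast_ne_zero.mpr (by have := mem_Ico.mp hi; omega)
    field_simp]
  rw [eq_div_iff (mul_ne_zero two_ne_zero hpK)]
  push_cast at h1 hpK ⊢
  field_simp at h1
  linear_combination h1

theorem exists_sum_eq (hp3 : 3 < p) {α : K} {a : k} (hα : Red ρ α a) (ha : a ≠ 0)
    {t : K} (ht : t = 2 - α - α⁻¹) {τ : k}
    (hT : Red ρ (∑ i ∈ Ico 1 p, p * t ^ i / (i.centralBinom : K) * harmonicSum K 2 (i - 1)) τ) :
    ∃ Y, Red ρ Y τ ∧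
      (4 - t) * ∑ i ∈ Ico 1 p, p * t ^ i / (i.centralBinom : K) =
        t * lucasSum t (p + 1) p + p * t - t * p * (2 - α ^ p - α⁻¹ ^ p) / 2
          - (4 - t) * p * t ^ p / 2 + (4 - t) * ((p : K) ^ 2 * Y) := by
  have hα0 : α ≠ 0 := by rintro rfl; exact ha (hα.unique Red.zero)
  have hpK : (p : K) ≠ 0 := Nat.cast_ne_zero.mpr hp.out.ne_zero
  obtain ⟨Y, hY, h⟩ := exists_sum_div_centralBinom_eq (c := fun i => (1 : K))
    (c' := fun i => (1 : k)) (t := t) (((Red.ofNat 2).sub hα).sub (hα.inv ha) |>.congr ht rfl)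
    (fun i hi => Red.one) (by simpa only [mul_one] using hT)
  simp only [mul_one] at h
  refine ⟨Y, hY, ?_⟩
  have h0 := sum_mul_centralTerm p t
  have h1 := sum_centralTerm p t p
  have h2 : lucasSum t (p + 1) p = lucasSum t p p := by
    rw [lucasSum, sum_range_succ, Nat.choose_eq_zero_of_lt (by omega)]; simp [lucasSum]
  have h3 : 2 * (p : K) * ∑ i ∈ Ico 1 (p + 1), centralTerm p t i / (i : K) =
      2 - (α ^ p + α⁻¹ ^ p) := by
    obtain ⟨n, hn⟩ : ∃ n, p = n + 1 := ⟨p - 1, by have := hp.out.one_le; omega⟩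
    have := sum_centralTerm_div n t (n + 1)
    rw [lucasSum_sub hα0 ht (by omega), ← hn] at this
    rw [← this, hn]
    push_cast
    ring
  rw [h1, sum_Ico_succ_top hp.out.one_le, centralTerm_prime (by omega)] at h0
  rw [h, mul_add, h2]
  linear_combination h0 + (-t * p / 2) * h3

/-- Since (4 - 2/i)/binom(2i, i) = 1/binom(2i-2, i-1), the unweighted sum satisfies a telescoping
relation with the sums divided by i and by i². The boundary term carries H_{p-1}(2), whose residue
is 0. -/
theorem red_sum_harmonicSum (hp3 : 3 < p) {t : K} {s : k} (ht : Red ρ t s) {τ δ : k}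
    (hT : Red ρ (∑ i ∈ Ico 1 p, p * t ^ i / (i.centralBinom : K) * harmonicSum K 2 (i - 1)
      * (1 / (i : K))) τ)
    (hD : Red ρ (∑ i ∈ Ico 1 p, p * t ^ i / (i.centralBinom : K) * (1 / (i : K) ^ 2)) δ) :
    Red ρ ((4 - t) * ∑ i ∈ Ico 1 p, p * t ^ i / (i.centralBinom : K) * harmonicSum K 2 (i - 1))
      (2 * τ + s * δ) := by
  have h : ∀ N : ℕ, ∑ i ∈ Ico 1 (N + 1 + 1), (4 - 2 * (1 / (i : K))) *
        (p * t ^ i / (i.centralBinom : K) * harmonicSum K 2 (i - 1)) =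
      t * ∑ i ∈ Ico 1 (N + 1), p * t ^ i / (i.centralBinom : K) *
        (harmonicSum K 2 (i - 1) + 1 / (i : K) ^ 2) := by
    intro N
    induction N with
    | zero => simp [harmonicSum_zero]
    | succ N ih =>
      have h1 := centralBinom_succ_cast (K := K) (N + 1)
      have h0 := centralBinom_cast_ne_zero (K := K) (N + 1)
      have h0' := centralBinom_cast_ne_zero (K := K) (N + 1 + 1)
      have hi : ((N : K) + 1) ≠ 0 := Nat.cast_add_one_ne_zero N
      have hi' : ((N : K) + 2) ≠ 0 := by exact_mod_cast Nat.cast_add_one_ne_zero (R := K) (N + 1)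
      rw [sum_Ico_succ_top (by omega), ih, sum_Ico_succ_top (b := N + 1) (by omega), mul_add,
        show N + 2 - 1 = N + 1 by omega, harmonicSum_succ]
      push_cast at h1 ⊢
      congr 1
      generalize harmonicSum K 2 N = H
      field_simp
      linear_combination (-(p : K) * t ^ 2 * t ^ N * (H * ((N : K) + 1) ^ 2 + 1)) * h1
  obtain ⟨N, hN⟩ : ∃ N, p = N + 1 + 1 := ⟨p - 2, by omega⟩
  have h1 := h N
  have h2 : ∑ i ∈ Ico 1 (N + 1 + 1), p * t ^ i / (i.centralBinom : K) *
        (harmonicSum K 2 (i - 1) + 1 / (i : K) ^ 2) =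
      ∑ i ∈ Ico 1 (N + 1), p * t ^ i / (i.centralBinom : K) *
        (harmonicSum K 2 (i - 1) + 1 / (i : K) ^ 2) +
      t ^ (p - 1) * (p / ((p - 1).centralBinom : K)) * harmonicSum K 2 (p - 1) := by
    rw [sum_Ico_succ_top (by omega), show p - 1 = N + 1 by omega, Nat.add_sub_cancel,
      harmonicSum_succ]
    push_cast
    ring
  have h3 : ∀ n : ℕ, ∑ i ∈ Ico 1 n, (4 - 2 * (1 / (i : K))) *
        (p * t ^ i / (i.centralBinom : K) * harmonicSum K 2 (i - 1)) =
      4 * ∑ i ∈ Ico 1 n, p * t ^ i / (i.centralBinom : K) * harmonicSum K 2 (i - 1) -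
      2 * ∑ i ∈ Ico 1 n, p * t ^ i / (i.centralBinom : K) * harmonicSum K 2 (i - 1)
        * (1 / (i : K)) := by
    intro n
    rw [mul_sum, mul_sum, ← sum_sub_distrib]
    exact sum_congr rfl fun i _ => by ring
  simp only [mul_add, sum_add_distrib] at h1 h2
  rw [h3, ← hN] at h1
  rw [← hN] at h2
  obtain ⟨a, ha⟩ := exists_red_prime_div_centralBinom (K := K) (ρ := ρ) (p := p) (i := p - 1)
    (by omega)
  have h4 : Red ρ (harmonicSum K 2 (p - 1)) 0 :=
    (Red.harmonicSum (p := p) (by omega) 2).congr rfl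
      (harmonicSum_prime_sub_one hp3 two_pos (by omega)).symm
  refine ((((Red.ofNat 2).mul hT).add (ht.mul hD)).sub
    (ht.mul (((ht.pow (p - 1)).mul ha).mul h4))).congr ?_ (by ring)
  linear_combination h1 - t * h2

end

/-! ### Special values of finite polylogarithms: -1, 2 and √-1 -/

section

open Polynomial

/-- The alternating sum is twice its even part minus the full sum. -/
theorem finPolylog_neg_one_eq {F : Type*} [Field F] (h2 : (2 : F) ≠ 0) (d n : ℕ) :
    finPolylog (2 * n + 1) d (-1 : F) =
      2 / 2 ^ d * harmonicSum F d n - harmonicSum F d (2 * n) := by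
  induction n with
  | zero => simp [finPolylog, harmonicSum_zero]
  | succ n ih =>
    have e : (((2 * n + 1 : ℕ) : F) + 1) = 2 * ((n : F) + 1) := by push_cast; ring
    rw [finPolylog] at *
    rw [show 2 * (n + 1) + 1 = 2 * n + 1 + 1 + 1 by ring, show 2 * (n + 1) = 2 * n + 1 + 1 by ring,
      sum_Ico_succ_top (by omega), sum_Ico_succ_top (by omega), ih, harmonicSum_succ,
      harmonicSum_succ, harmonicSum_succ, show (-1 : F) ^ (2 * n + 1) = -1 by simp [pow_succ, pow_mul],
      show (-1 : F) ^ (2 * n + 1 + 1) = 1 by simp [pow_succ, pow_mul], Nat.cast_succ (2 * n + 1), e,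
      mul_pow]
    push_cast
    field_simp
    ring

variable {k : Type*} [Field k] {p : ℕ} [hp : Fact p.Prime] [CharP k p] (hp3 : 3 < p)
include hp3

theorem finPolylog_inv_of_mul_eq_one (d : ℕ) {x y : k} (h : x * y = 1) :
    x ^ p * finPolylog p d y = (-1) ^ d * finPolylog p d x := by
  have hx : x ≠ 0 := left_ne_zero_of_mul_eq_one h
  rw [← finPolylog_inv d hx, eq_div_of_mul_eq hx (by rw [mul_comm]; exact h : y * x = 1)]

theorem neg_one_pow_prime {R : Type*} [Ring R] : (-1 : R) ^ p = -1 :=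
  (hp.out.odd_of_ne_two (by omega)).neg_one_pow

theorem finPolylog_two_neg_one : finPolylog p 2 (-1 : k) = 0 := by
  have h := finPolylog_inv_of_mul_eq_one hp3 2 (show (-1 : k) * -1 = 1 by ring)
  rw [neg_one_pow_prime hp3] at h
  have h2 : (2 : k) ≠ 0 := two_ne_zero_of_three_lt (p := p) hp3
  refine (mul_eq_zero.mp (?_ : 2 * finPolylog p 2 (-1 : k) = 0)).resolve_left h2
  linear_combination -h

/-- The relation for £_1² at x = -1, where £_2(-1) vanishes by inversion. -/
theorem finPolylog_two_two : finPolylog p 2 (2 : k) = -(finPolylog p 1 (-1 : k)) ^ 2 / 4 := by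
  have h := sq_finPolylog_one hp3 (-1 : k)
  have h2 : (2 : k) ≠ 0 := two_ne_zero_of_three_lt (p := p) hp3
  have h4 : (4 : k) ≠ 0 := by rw [show (4 : k) = 2 * 2 by norm_num]; exact mul_ne_zero h2 h2
  rw [finPolylog_two_neg_one hp3, neg_one_pow_prime hp3, show (1 : k) - -1 = 2 by norm_num] at h
  rw [eq_div_iff h4]
  linear_combination h

variable {f : k[X]} {b : k}

theorem finPolylog_three_neg_one (hf : IsFaulhaber p f b) : finPolylog p 3 (-1 : k) = -b / 2 := by
  have h2 : (2 : k) ≠ 0 := two_ne_zero_of_three_lt (p := p) hp3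
  obtain ⟨n, hn⟩ : ∃ n, p = 2 * n + 1 := hp.out.odd_of_ne_two (by omega)
  have h3 := IsFaulhaber.harmonicSum_three_half hp3 hf hn
  have h4 := harmonicSum_prime_sub_one (k := k) (d := 3) hp3 (by norm_num)
    (by have : p ≠ 4 := by rintro rfl; exact absurd hp.out (by norm_num)
        omega)
  have h5 := finPolylog_neg_one_eq h2 3 n
  rw [← hn, h3, show 2 * n = p - 1 by omega, h4, show (2 : k) ^ 3 = 2 * 2 * 2 by norm_num] at h5
  rw [h5]
  field_simp
  ring

/-- Duplication at i expresses £_3(-1) through £_3(i) and £_3(-i), and inversion removes the factors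
i^p. -/
theorem finPolylog_three_add_inv_of_sq_eq_neg_one (hf : IsFaulhaber p f b) {i : k}
    (hi : i ^ 2 = -1) : finPolylog p 3 i + finPolylog p 3 i⁻¹ = -b / 16 := by
  have h2 : (2 : k) ≠ 0 := two_ne_zero_of_three_lt (p := p) hp3
  have hinv : i⁻¹ = -i := inv_eq_of_mul_eq_one_right (by linear_combination -hi)
  have h1 := finPolylog_sq (k := k) (p := p) (by omega) 3 i
  have h3 := finPolylog_inv_of_mul_eq_one hp3 3 (show i * -i = 1 by linear_combination -hi)
  have h4 := finPolylog_inv_of_mul_eq_one hp3 3 (show -i * i = 1 by linear_combination -hi)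
  rw [neg_pow, neg_one_pow_prime hp3] at h4
  rw [hi, finPolylog_three_neg_one hp3 hf] at h1
  rw [hinv]
  have h16 : (16 : k) = 2 * 2 * 2 * 2 := by norm_num
  have h8 : (2 : k) ^ 3 = 2 * 2 * 2 := by norm_num
  rw [h8] at h1
  rw [h16]
  field_simp at h1 ⊢
  linear_combination -h1 + 8 * h3 + 8 * h4

/-! ### Special values at the golden ratio -/

section Golden

variable {φ : k} (hφ : φ ^ 2 = φ + 1) (h5 : (5 : k) ≠ 0)
include hφ

theorem golden_pow_prime : (φ ^ p) ^ 2 = φ ^ p + 1 := by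
  rw [← pow_mul, mul_comm, pow_mul, hφ, add_pow_char, one_pow]

include h5

/-- Because 1 - 1/φ = φ⁻² and -φ(1-φ) = 1, the reflection, inversion, duplication and square
relations close up into a linear system. Solving it divides by 2φ^p - 1, a square root of 5. -/
theorem finPolylog_two_golden :
    finPolylog p 2 (φ ^ 2) = -(φ ^ p + 2) * finPolylog p 1 φ ^ 2 / 5 ∧
    finPolylog p 2 (-φ) = -(φ ^ p + 2) * finPolylog p 1 φ ^ 2 / 10 := by
  have h2 : (2 : k) ≠ 0 := two_ne_zero_of_three_lt (p := p) hp3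
  have hφ0 : φ ≠ 0 := by rintro rfl; simp at hφ
  have hu := golden_pow_prime hp3 hφ
  have e1 := finPolylog_two_one_sub hp3 hφ0
  have e2 := finPolylog_sq (k := k) (p := p) (by omega) 2 φ
  have e3 := sq_finPolylog_one hp3 φ
  have i1 := finPolylog_inv_of_mul_eq_one hp3 2
    (show φ ^ 2 * (1 - 1 / φ) = 1 by field_simp; linear_combination hφ)
  have i2 := finPolylog_inv_of_mul_eq_one hp3 2 (show -φ * (1 - φ) = 1 by linear_combination hφ)
  rw [← pow_mul, mul_comm 2 p, pow_mul] at i1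
  rw [neg_pow, neg_one_pow_prime hp3] at i2
  generalize φ ^ p = u at *
  generalize finPolylog p 2 (φ ^ 2) = H at *
  generalize finPolylog p 2 (-φ) = G at *
  generalize finPolylog p 2 φ = R at *
  generalize finPolylog p 1 φ = q at *
  generalize finPolylog p 2 (1 - φ) = S at *
  generalize finPolylog p 2 (1 - 1 / φ) = T at *
  have hu0 : u ≠ 0 := by rintro rfl; simp at hu
  have hu1 : (2 * u - 1) * (2 * u - 1) = 5 := by linear_combination 4 * hu
  have hu2 : 2 * u - 1 ≠ 0 := by intro h; rw [h, zero_mul] at hu1; exact h5 hu1.symm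
  have a1 : H = G + u * R := by
    refine mul_left_cancel₀ hu0 ?_
    linear_combination (-u) * i1 + u * i2 + u ^ 2 * e1
  have a2 : H = 2 * G := by
    refine mul_left_cancel₀ h2 (mul_left_cancel₀ hu2 ?_)
    linear_combination -e2 + 4 * u * a1 + 4 * R * hu
  have a3 : q ^ 2 * u = -2 * G * (2 * u - 1) := by
    linear_combination u * e3 + (2 - 2 * u) * i2 + 2 * u * a1 - 2 * u * a2
  have h10 : (10 : k) = 5 * 2 := by norm_num
  constructor
  · rw [eq_div_iff h5]
    linear_combination 5 * a2 + (2 * u - 1) * a3 - (2 * q ^ 2 + 8 * G) * hu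
  · rw [h10, eq_div_iff (mul_ne_zero h5 h2)]
    linear_combination (2 * u - 1) * a3 - (2 * q ^ 2 + 8 * G) * hu

/-- At x = φ² the weight three relation involves 1 - x = -φ and 1 - 1/x = φ⁻¹ only; duplication and
inversion eliminate £_3(φ) and £_3(-φ). The conjugate φ^p satisfies the same quadratic equation. -/
theorem finPolylog_three_golden (hf : IsFaulhaber p f b) :
    -(finPolylog p 3 (φ ^ 2) + finPolylog p 3 (φ ^ 2)⁻¹) =
      4 / 15 * (-finPolylog p 1 φ ^ 3 / 2 + b) := by
  have h2 : (2 : k) ≠ 0 := two_ne_zero_of_three_lt (p := p) hp3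
  have h3 : (3 : k) ≠ 0 := three_ne_zero_of_three_lt (p := p) hp3
  have hφ0 : φ ≠ 0 := by rintro rfl; simp at hφ
  have hu := golden_pow_prime hp3 hφ
  have hq : finPolylog p 1 (φ ^ 2) = finPolylog p 1 φ * φ ^ p := by
    have e1 := finPolylog_sq (k := k) (p := p) (by omega) 1 φ
    have i1 := finPolylog_inv_of_mul_eq_one hp3 1 (show -φ * (1 - φ) = 1 by linear_combination hφ)
    rw [finPolylog_one_one_sub hp3, neg_pow, neg_one_pow_prime hp3] at i1
    refine mul_left_cancel₀ h2 ?_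
    linear_combination e1 + (2 - 2 * φ ^ p) * i1 - 2 * finPolylog p 1 φ * hu
  have e1 := finPolylog_three_relation hp3 hf (pow_ne_zero 2 hφ0)
  have e2 := finPolylog_sq (k := k) (p := p) (by omega) 3 φ
  have i1 := finPolylog_inv_of_mul_eq_one hp3 3
    (show φ ^ 2 * (φ ^ 2)⁻¹ = 1 from mul_inv_cancel₀ (pow_ne_zero 2 hφ0))
  have i2 := finPolylog_inv_of_mul_eq_one hp3 3
    (show φ * (1 - 1 / φ ^ 2) = 1 by field_simp; linear_combination hφ)
  rw [show (φ ^ 2) ^ p = (φ ^ p) ^ 2 by rw [← pow_mul, ← pow_mul, mul_comm], hq,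
    show 1 - φ ^ 2 = -φ by linear_combination -hφ] at e1
  rw [show (φ ^ 2) ^ p = (φ ^ p) ^ 2 by rw [← pow_mul, ← pow_mul, mul_comm]] at i1
  generalize φ ^ p = u at *
  generalize finPolylog p 3 (φ ^ 2) = H at *
  generalize finPolylog p 3 (φ ^ 2)⁻¹ = H' at *
  generalize finPolylog p 3 (-φ) = G at *
  generalize finPolylog p 3 φ = R at *
  generalize finPolylog p 1 φ = q at *
  generalize finPolylog p 3 (1 - 1 / φ ^ 2) = T at *
  have hu0 : u ≠ 0 := by rintro rfl; simp at hu
  have e2' : H = 4 * (u ^ 2 * R + (1 - u) * G) := by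
    refine mul_left_cancel₀ h2 ?_
    linear_combination e2 - 8 * R * hu
  have h6 : (6 : k) ≠ 0 := by rw [show (6 : k) = 2 * 3 by norm_num]; exact mul_ne_zero h2 h3
  have e3 : 5 * H * 6 = -4 * u * (-q ^ 3 + 2 * b) := by
    have e1' : 6 * (u ^ 2 * H + (1 - u ^ 2) * G + u ^ 2 * (1 - u ^ 2) * (u ^ 2 * T)) =
        (q * u) ^ 3 + 2 * b * (u ^ 2 * (1 - u ^ 2)) := by
      rw [e1, show (6 : k) = 2 * 3 by norm_num]
      field_simp
    refine mul_left_cancel₀ (pow_ne_zero 2 hu0) ?_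
    linear_combination 4 * e1' + (-8 * b * u ^ 2 + 24 * G + 24 * u ^ 4 * T - 24 * u * G) * hu
      + 24 * u ^ 4 * i2 + 6 * u ^ 2 * e2'
  have h15 : (15 : k) ≠ 0 := by rw [show (15 : k) = 5 * 3 by norm_num]; exact mul_ne_zero h5 h3
  have e4 : u * (H + H') = H := by
    refine mul_left_cancel₀ hu0 ?_
    linear_combination i1 + H * hu
  rw [div_mul_eq_mul_div, eq_div_iff h15]
  refine mul_left_cancel₀ hu0 (mul_left_cancel₀ h2 ?_)
  have e5 : 2 * (4 * (-q ^ 3 / 2 + b)) = -4 * q ^ 3 + 8 * b := by field_simp; ring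
  linear_combination -e3 - 30 * e4 - u * e5

/-- The factor ε records how Frobenius acts on √5 = 2φ - 1. The denominator simplifies through 1 +
φ² = φ(2φ - 1). -/
theorem golden_ratio_two {ε : k} (hε : 2 * φ ^ p - 1 = ε * (2 * φ - 1)) :
    (1 - φ ^ 2) / (1 + φ ^ 2) * (finPolylog p 2 (φ ^ 2) - finPolylog p 2 (φ ^ 2)⁻¹) =
      1 / 5 * ε * finPolylog p 1 φ ^ 2 := by
  have hφ0 : φ ≠ 0 := by rintro rfl; simp at hφ
  have hu := golden_pow_prime hp3 hφ
  have hu0 : φ ^ p ≠ 0 := pow_ne_zero _ hφ0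
  have h1 := (finPolylog_two_golden hp3 hφ h5).1
  have i1 := finPolylog_inv_of_mul_eq_one hp3 2
    (show φ ^ 2 * (φ ^ 2)⁻¹ = 1 from mul_inv_cancel₀ (pow_ne_zero 2 hφ0))
  rw [show (φ ^ 2) ^ p = (φ ^ p) ^ 2 by rw [← pow_mul, ← pow_mul, mul_comm]] at i1
  have hs : (2 * φ - 1) ^ 2 = 5 := by linear_combination 4 * hφ
  have h12 : 1 + φ ^ 2 = φ * (2 * φ - 1) := by linear_combination -hφ
  have hs0 : 2 * φ - 1 ≠ 0 := by intro h; rw [h] at hs; apply h5; rw [← hs]; ring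
  have h12' : 1 + φ ^ 2 ≠ 0 := by rw [h12]; exact mul_ne_zero hφ0 hs0
  rw [eq_div_iff h5] at h1
  generalize φ ^ p = u at *
  generalize finPolylog p 2 (φ ^ 2) = H at *
  generalize finPolylog p 2 (φ ^ 2)⁻¹ = H' at *
  generalize finPolylog p 1 φ = q at *
  rw [div_mul_eq_mul_div, div_eq_iff h12', h12]
  refine mul_left_cancel₀ (pow_ne_zero 2 hu0) (mul_left_cancel₀ h5 ?_)
  have e : u ^ 2 * (H - H') = u * H := by linear_combination -i1 + H * hu
  have hφ2 : 1 - φ ^ 2 = -φ := by linear_combination -hφ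
  have e5 : (5 : k) * (1 / 5) = 1 := by field_simp
  rw [hφ2]
  linear_combination -5 * φ * e - φ * u * h1 - 2 * φ * u * q ^ 2 * hu + u ^ 2 * q ^ 2 * φ * hε
    - u ^ 2 * ε * q ^ 2 * φ * (2 * φ - 1) * e5

end Golden

/-! ### Special values at sixth roots of unity -/

section Eisenstein

theorem pow_prime_of_sq_eq_sub_one {R : Type*} [CommRing R] {ζ : R} (hζ : ζ ^ 2 = ζ - 1) :
    (p % 3 = 1 → ζ ^ p = ζ) ∧ (p % 3 = 2 → ζ ^ p = 1 - ζ) := by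
  have h3 : ζ ^ 3 = -1 := by linear_combination (ζ + 1) * hζ
  have hodd : p % 2 = 1 := Nat.odd_iff.mp (hp.out.odd_of_ne_two (by omega))
  have h6 : ∀ n, ζ ^ (6 * n) = 1 := fun n => by
    rw [pow_mul, show ζ ^ 6 = 1 by rw [show 6 = 3 * 2 by norm_num, pow_mul, h3]; ring, one_pow]
  constructor
  · intro h
    rw [show p = 6 * (p / 6) + 1 by omega, pow_succ, h6, one_mul]
  · intro h
    rw [show p = 6 * (p / 6) + 5 by omega, pow_add, h6, one_mul]
    linear_combination (ζ ^ 3 + ζ ^ 2 - 1) * hζ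

variable {ζ : k} (hζ : ζ ^ 2 = ζ - 1) (hf : IsFaulhaber p f b)
include hζ hf

/-- ζ² and -ζ are the primitive cube roots of unity, so adding £_2(1) = 0 selects the multiples of 3
and leaves H_m(2)/3 with m = ⌊p/3⌋. This is ∓f(1/3)/3 by interpolation, directly or after
reflection, according to p modulo 3. -/
theorem finPolylog_two_omega {ε : k}
    (hε : (p % 3 = 1 ∧ ε = 1) ∨ (p % 3 = 2 ∧ ε = -1)) :
    3 * (finPolylog p 2 (ζ ^ 2) + finPolylog p 2 (-ζ)) = -ε * f.eval (1 / 3) := by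
  have h3 : (3 : k) ≠ 0 := three_ne_zero_of_three_lt (p := p) hp3
  have h33 : ζ ^ 3 = -1 := by linear_combination (ζ + 1) * hζ
  have hw : ∀ m : ℕ, (ζ ^ 2) ^ (3 * m) = 1 := fun m => by
    rw [← pow_mul, show 2 * (3 * m) = 3 * (2 * m) by ring, pow_mul, h33]
    exact (even_two_mul m).neg_one_pow
  have hw' : ∀ m : ℕ, (-ζ) ^ (3 * m) = 1 := fun m => by
    rw [pow_mul, show (-ζ) ^ 3 = 1 by linear_combination -h33, one_pow]
  have key : ∀ m : ℕ, ∑ i ∈ Ico 1 (3 * m + 1), ((ζ ^ 2) ^ i + (-ζ) ^ i + 1) / (i : k) ^ 2 =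
      harmonicSum k 2 m / 3 := by
    intro m
    induction m with
    | zero => simp [harmonicSum_zero]
    | succ m ih =>
      rw [show 3 * (m + 1) + 1 = 3 * m + 1 + 1 + 1 + 1 by ring, sum_Ico_succ_top (by omega),
        sum_Ico_succ_top (by omega), sum_Ico_succ_top (by omega), ih, harmonicSum_succ,
        show 3 * m + 1 + 1 + 1 = 3 * (m + 1) by ring, hw, hw', pow_add (ζ ^ 2) (3 * m) 2, pow_add (-ζ) (3 * m) 2,
        pow_succ (ζ ^ 2) (3 * m), pow_succ (-ζ) (3 * m), hw, hw']
      have e1 : 1 * ζ ^ 2 + 1 * -ζ + 1 = 0 := by linear_combination hζ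
      have e2 : 1 * (ζ ^ 2) ^ 2 + 1 * (-ζ) ^ 2 + 1 = 0 := by
        linear_combination (ζ ^ 2 + ζ + 1) * hζ
      rw [e1, e2]
      push_cast
      rw [mul_pow, mul_comm ((3 : k) ^ 2), ← div_div]
      field_simp
      ring
  have h1 := finPolylog_one_right (k := k) (p := p) (d := 2) (by norm_num) (by omega)
  have hs : finPolylog p 2 (ζ ^ 2) + finPolylog p 2 (-ζ) =
      ∑ i ∈ Ico 1 p, ((ζ ^ 2) ^ i + (-ζ) ^ i + 1) / (i : k) ^ 2 := by
    simp only [add_div, sum_add_distrib]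
    simp only [finPolylog, one_pow] at h1 ⊢
    rw [h1, add_zero]
  rcases hε with ⟨h, rfl⟩ | ⟨h, rfl⟩
  · obtain ⟨m, hm⟩ : ∃ m, p = 3 * m + 1 := ⟨p / 3, by omega⟩
    have hm0 : (3 * (m : k) + 1) = 0 := by
      have := CharP.cast_eq_zero k p
      rw [hm] at this
      exact_mod_cast this
    have e1 := harmonicSum_reflect (k := k) (m := m) hp3 two_pos (by omega) (by omega)
    have e2 := hf.eval_succ hp3 (m := 2 * m) (by omega)
    rw [show p - 1 - m = 2 * m by omega] at e1
    rw [show ((2 * m : ℕ) : k) + 1 = 1 / 3 by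
      rw [eq_div_iff h3]; push_cast; linear_combination 2 * hm0, e1] at e2
    rw [hs, hm, key, e2]
    field_simp
  · obtain ⟨m, hm⟩ : ∃ m, p = 3 * m + 2 := ⟨p / 3, by omega⟩
    have hm0 : (3 * (m : k) + 2) = 0 := by
      have := CharP.cast_eq_zero k p
      rw [hm] at this
      exact_mod_cast this
    have e2 := hf.eval_succ hp3 (m := m) (by omega)
    rw [show (m : k) + 1 = 1 / 3 by
      rw [eq_div_iff h3]; linear_combination hm0] at e2
    rw [hs, hm, sum_Ico_succ_top (by omega), key, e2, pow_succ (ζ ^ 2), hw, pow_succ (-ζ), hw',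
      show 1 * ζ ^ 2 + 1 * -ζ + 1 = 0 by linear_combination hζ]
    field_simp
    ring

/-- Inversion pairs ζ with 1 - ζ and -ζ with ζ²; together with duplication at ζ and the sum over
cube roots this determines all four values. -/
theorem finPolylog_two_eisenstein {ε : k}
    (hε : (p % 3 = 1 ∧ ε = 1) ∨ (p % 3 = 2 ∧ ε = -1)) :
    6 * (1 - ζ ^ p) * finPolylog p 2 (1 - ζ) = -(1 - 2 * ζ) * f.eval (1 / 3) ∧
    2 * (finPolylog p 2 ζ + finPolylog p 2 (1 - ζ)) = -ε * f.eval (1 / 3) ∧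
    3 * (1 + ζ ^ p) * finPolylog p 2 (ζ ^ 2) = (1 - 2 * ζ) * f.eval (1 / 3) := by
  have h2 : (2 : k) ≠ 0 := two_ne_zero_of_three_lt (p := p) hp3
  have h3 : (3 : k) ≠ 0 := three_ne_zero_of_three_lt (p := p) hp3
  have h1 := finPolylog_two_omega hp3 hζ hf hε
  have e2 := finPolylog_sq (k := k) (p := p) (by omega) 2 ζ
  have i1 := finPolylog_inv_of_mul_eq_one hp3 2 (show ζ * (1 - ζ) = 1 by linear_combination -hζ)
  have i2 := finPolylog_inv_of_mul_eq_one hp3 2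
    (show -ζ * ζ ^ 2 = 1 by linear_combination (-ζ - 1) * hζ)
  rw [neg_pow, neg_one_pow_prime hp3] at i2
  have hX := pow_prime_of_sq_eq_sub_one hp3 hζ
  generalize ζ ^ p = X at *
  generalize finPolylog p 2 (ζ ^ 2) = W at *
  generalize finPolylog p 2 (-ζ) = Y at *
  generalize finPolylog p 2 ζ = Z at *
  generalize finPolylog p 2 (1 - ζ) = Z' at *
  generalize f.eval (1 / 3) = g at *
  have e2' : W = 2 * ((1 + X) * Z + (1 - X) * Y) := by
    refine mul_left_cancel₀ h2 ?_
    linear_combination e2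
  rcases hε with ⟨h, rfl⟩ | ⟨h, rfl⟩
  · obtain rfl := (hX.1 h).symm
    have w1 : 3 * W = -g * ζ := by
      linear_combination ζ * h1 + 3 * ζ * i2 + 3 * W * hζ
    have y1 : 3 * Y = g * (ζ - 1) := by
      linear_combination -3 * i2 - ζ * w1 + g * hζ
    have z1 : 6 * Z = -g * (1 + ζ) := by
      refine mul_left_cancel₀ h3 ?_
      linear_combination -3 * (2 - ζ) * e2' + 6 * Z * hζ + (2 - ζ) * w1
        - 2 * (2 - ζ) * (1 - ζ) * y1 + g * (7 - 2 * ζ) * hζ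
    have z2 : 6 * Z' = -g * (2 - ζ) := by
      linear_combination 6 * (1 - ζ) * i1 + 6 * Z' * hζ + (1 - ζ) * z1 + g * hζ
    refine ⟨?_, ?_, ?_⟩
    · linear_combination (1 - ζ) * z2 - g * hζ
    · refine mul_left_cancel₀ h3 ?_
      linear_combination z1 + z2
    · linear_combination (1 + ζ) * w1 - g * hζ
  · obtain rfl := (hX.2 h).symm
    have w1 : 3 * W = g * (1 - ζ) := by
      linear_combination (1 - ζ) * h1 + 3 * (1 - ζ) * i2 + 3 * W * hζ
    have y1 : 3 * Y = g * ζ := by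
      linear_combination -3 * i2 - (1 - ζ) * w1 - g * hζ
    have z1 : 6 * Z = g * (2 - ζ) := by
      refine mul_left_cancel₀ h3 ?_
      linear_combination -3 * (1 + ζ) * e2' + 6 * Z * hζ + (1 + ζ) * w1
        - 2 * ζ * (1 + ζ) * y1 + g * (-2 * ζ - 5) * hζ
    have z2 : 6 * Z' = g * (1 + ζ) := by
      linear_combination 6 * ζ * i1 + 6 * Z' * hζ + ζ * z1 - g * hζ
    refine ⟨?_, ?_, ?_⟩
    · linear_combination ζ * z2 + g * hζ
    · refine mul_left_cancel₀ h3 ?_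
      linear_combination z1 + z2
    · linear_combination (2 - ζ) * w1 + g * hζ

end Eisenstein

end

/-! ### Euler numbers modulo p -/

section

theorem sum_choose_mul_eulerNumber (n : ℕ) :
    ∑ j ∈ range (n + 1), (n.choose j : ℚ) * eulerNumber j * (if Even (n - j) then 1 else 0) =
      if n = 0 then 1 else 0 := by
  set D : PowerSeries ℚ := PowerSeries.exp ℚ + PowerSeries.evalNegHom (PowerSeries.exp ℚ) with hD
  have hcoeff : ∀ l, PowerSeries.coeff l D = (1 + (-1) ^ l) / (l.factorial : ℚ) := by
    intro l
    rw [hD, map_add, PowerSeries.evalNegHom, PowerSeries.coeff_rescale, PowerSeries.coeff_exp]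
    simp
    ring
  have hD0 : PowerSeries.constantCoeff D ≠ 0 := by
    rw [← PowerSeries.coeff_zero_eq_constantCoeff_apply, hcoeff]; norm_num
  have h1 : (2 * D⁻¹) * D = 2 := by rw [mul_assoc, PowerSeries.inv_mul_cancel _ hD0, mul_one]
  have h2 := congrArg (PowerSeries.coeff n) h1
  rw [PowerSeries.coeff_mul, Finset.Nat.sum_antidiagonal_eq_sum_range_succ_mk] at h2
  have h3 : PowerSeries.coeff n (2 : PowerSeries ℚ) = 2 * if n = 0 then 1 else 0 := by
    rw [show (2 : PowerSeries ℚ) = PowerSeries.C 2 from (map_ofNat _ 2).symm, PowerSeries.coeff_C]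
    simp
  rw [h3] at h2
  have h4 : ∀ j ∈ range (n + 1), (n.choose j : ℚ) * eulerNumber j * (if Even (n - j) then 1 else 0) =
      n.factorial / 2 * (PowerSeries.coeff j (2 * D⁻¹) * PowerSeries.coeff (n - j) D) := by
    intro j hj
    have hjn : j ≤ n := by have := mem_range.mp hj; omega
    rw [hcoeff, eulerNumber, Nat.cast_choose ℚ hjn]
    have f1 : (j.factorial : ℚ) ≠ 0 := by exact_mod_cast j.factorial_ne_zero
    have f2 : ((n - j).factorial : ℚ) ≠ 0 := by exact_mod_cast (n - j).factorial_ne_zero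
    rcases Nat.even_or_odd (n - j) with h | h
    · rw [if_pos h, h.neg_one_pow]; field_simp; ring
    · rw [if_neg (Nat.not_even_iff_odd.mpr h), h.neg_one_pow]; simp
  rw [sum_congr rfl h4, ← mul_sum, h2]
  split_ifs with h
  · subst h; norm_num
  · simp

/-- The coefficient of E_n in its recursion is 1, so integrality propagates; in odd index the
recursion only involves odd indices, so these numbers vanish. -/
theorem exists_int_eulerNumber : ∃ e : ℕ → ℤ, (∀ n, eulerNumber n = e n) ∧ (∀ n, Odd n → e n = 0) ∧
    ∀ n, ∑ j ∈ range (n + 1), (n.choose j : ℤ) * e j * (if Even (n - j) then 1 else 0) =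
      if n = 0 then 1 else 0 := by
  have h0 : ∀ n, ∃ e : ℤ, eulerNumber n = e := by
    intro n
    induction n using Nat.strong_induction_on with
    | _ n ih =>
      choose! e he using ih
      have h := sum_choose_mul_eulerNumber n
      rw [sum_range_succ, Nat.sub_self, if_pos (by simp), Nat.choose_self] at h
      refine ⟨(if n = 0 then 1 else 0) -
        ∑ j ∈ range n, (n.choose j : ℤ) * e j * (if Even (n - j) then 1 else 0), ?_⟩
      push_cast
      rw [← h, sum_congr rfl fun j hj => by rw [he j (mem_range.mp hj)]]
      simp
  choose e he using h0
  have hrec : ∀ n, ∑ j ∈ range (n + 1), (n.choose j : ℤ) * e j * (if Even (n - j) then 1 else 0) =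
      if n = 0 then 1 else 0 := by
    intro n
    have := sum_choose_mul_eulerNumber n
    simp only [he] at this
    exact_mod_cast this
  refine ⟨e, he, fun n => ?_, hrec⟩
  induction n using Nat.strong_induction_on with
  | _ n ih =>
    intro hn
    have h := hrec n
    rw [sum_range_succ, Nat.sub_self, if_pos (by simp), Nat.choose_self,
      if_neg (by rintro rfl; simp at hn), sum_eq_zero] at h
    · simpa using h
    · intro j hj
      have hj' := mem_range.mp hj
      split_ifs with hev
      · have : Odd j := by
          by_contra hc
          rw [Nat.not_odd_iff_even] at hc
          have h2 := hev.add hc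
          rw [Nat.sub_add_cancel hj'.le] at h2
          exact (Nat.not_even_iff_odd.mpr hn) h2
        rw [ih j hj' this]; simp
      · simp

variable {R : Type*} [CommRing R]

/-- The function `∑_j binom(n, j) e_j x ^ (n - j)`. -/
def appellSum (e : ℕ → ℤ) (n : ℕ) (x : R) : R :=
  ∑ j ∈ range (n + 1), (n.choose j : R) * (e j : R) * x ^ (n - j)

theorem appellSum_add (e : ℕ → ℤ) (n : ℕ) (x y : R) :
    appellSum e n (x + y) = ∑ i ∈ range (n + 1), (n.choose i : R) * x ^ i * appellSum e (n - i) y := by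
  have h1 : ∀ j ∈ range (n + 1), (n.choose j : R) * (e j : R) * (x + y) ^ (n - j) =
      ∑ i ∈ range (n - j + 1), (n.choose i : R) * x ^ i *
        (((n - i).choose j : R) * (e j : R) * y ^ (n - i - j)) := by
    intro j hj
    rw [add_pow, mul_sum]
    refine sum_congr rfl fun i hi => ?_
    have hj' := mem_range.mp hj
    have hi' := mem_range.mp hi
    have e1 := Nat.choose_mul (n := n) (k := i + j) (s := j) (by omega)
    have e2 := Nat.choose_mul (n := n) (k := i + j) (s := i) (by omega)
    rw [Nat.add_sub_cancel] at e1
    rw [Nat.add_sub_cancel_left, Nat.choose_symm_add, e1] at e2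
    have e3 := congrArg (fun n : ℕ => (n : R)) e2
    push_cast at e3
    rw [show n - i - j = n - j - i by omega]
    linear_combination x ^ i * y ^ (n - j - i) * (e j : R) * e3
  rw [appellSum, sum_congr rfl h1]
  simp only [appellSum, mul_sum]
  refine sum_comm' fun j i => ?_
  simp only [mem_range]
  omega

/-- By the translation formula it suffices to know the values at 1 and -1. Their sum is twice the
defining recursion, which is nonzero in degree 0 only. -/
theorem appellSum_add_one_add_appellSum_sub_one {e : ℕ → ℤ} (he : ∀ n,
    ∑ j ∈ range (n + 1), (n.choose j : ℤ) * e j * (if Even (n - j) then 1 else 0) =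
      if n = 0 then 1 else 0) (n : ℕ) (x : R) :
    appellSum e n (x + 1) + appellSum e n (x - 1) = 2 * x ^ n := by
  have h : ∀ m, appellSum e m (1 : R) + appellSum e m (-1 : R) = if m = 0 then 2 else 0 := by
    intro m
    have h1 := congrArg (fun n : ℤ => (n : R)) (he m)
    push_cast at h1
    rw [appellSum, appellSum, ← sum_add_distrib]
    have h2 : ∀ j ∈ range (m + 1), (m.choose j : R) * (e j : R) * 1 ^ (m - j) +
        (m.choose j : R) * (e j : R) * (-1) ^ (m - j) =
        2 * ((m.choose j : R) * e j * (if Even (m - j) then 1 else 0)) := by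
      intro j _
      rcases Nat.even_or_odd (m - j) with h | h
      · rw [if_pos h, h.neg_one_pow]; ring
      · rw [if_neg (Nat.not_even_iff_odd.mpr h), h.neg_one_pow]; ring
    rw [sum_congr rfl h2, ← mul_sum, h1]
    split_ifs <;> simp
  rw [sub_eq_add_neg, appellSum_add, appellSum_add, ← sum_add_distrib, sum_range_succ, sum_eq_zero]
  · rw [← mul_add, Nat.sub_self, h]; simp; ring
  · intro i hi
    have := mem_range.mp hi
    rw [← mul_add, h, if_neg (by omega), mul_zero]

theorem appellSum_zero_right (e : ℕ → ℤ) (n : ℕ) : appellSum e n (0 : R) = e n := by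
  rw [appellSum, sum_range_succ, sum_eq_zero]
  · simp
  · intro j hj
    have := mem_range.mp hj
    rw [zero_pow (by omega), mul_zero]

theorem appellSum_neg {e : ℕ → ℤ} (he : ∀ n, Odd n → e n = 0) {n : ℕ} (hn : Even n) (x : R) :
    appellSum e n (-x) = appellSum e n x := by
  refine sum_congr rfl fun j hj => ?_
  have hj' := mem_range.mp hj
  rcases Nat.even_or_odd j with h | h
  · rw [Even.neg_pow (Nat.even_sub (by omega) |>.mpr (iff_of_true hn h))]
  · rw [he j h]; simp

/-- The relation between x + 1 and x - 1 at x = 2N + 1 makes the alternating sum telescope. -/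
theorem sum_neg_one_pow_mul_odd_pow {e : ℕ → ℤ} (he : ∀ n,
    ∑ j ∈ range (n + 1), (n.choose j : ℤ) * e j * (if Even (n - j) then 1 else 0) =
      if n = 0 then 1 else 0) (n N : ℕ) :
    2 * ∑ j ∈ range N, (-1) ^ j * (2 * (j : R) + 1) ^ n =
      (e n : R) - (-1) ^ N * appellSum e n (2 * (N : R)) := by
  induction N with
  | zero => simp [appellSum_zero_right]
  | succ N ih =>
    rw [sum_range_succ, mul_add, ih]
    have h := appellSum_add_one_add_appellSum_sub_one (R := R) he n (2 * (N : R) + 1)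
    rw [add_sub_cancel_right, show (2 * (N : R) + 1 + 1) = 2 * ((N + 1 : ℕ) : R) by push_cast; ring]
      at h
    linear_combination (-(-1) ^ N) * h

variable {k : Type*} [Field k] {p : ℕ} [hp : Fact p.Prime] [CharP k p]
  {K : Type*} [Field K] [CharZero K] {V : ValuationSubring K} {ρ : V →+* k} [IsLocalHom ρ]

/-- In £_2(i) - £_2(-i) only odd exponents survive, giving 2i ∑ (-1)^j/(2j+1)². By Fermat these are
(p-3)-th powers of odd numbers, and the upper boundary 2N = p - 1 is -1 in `k`, where the Appell sum
vanishes. -/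
theorem red_eulerNumber (hp3 : 3 < p) {i : k} (hi : i ^ 2 = -1) :
    Red ρ ((eulerNumber (p - 3) : ℚ) : K)
      ((1 - i) / (1 + i) * (finPolylog p 2 i - finPolylog p 2 i⁻¹)) := by
  obtain ⟨e, he, hodd, hrec⟩ := exists_int_eulerNumber
  obtain ⟨N, hN⟩ : ∃ N, p = 2 * N + 1 := hp.out.odd_of_ne_two (by omega)
  have h2 : (2 : k) ≠ 0 := two_ne_zero_of_three_lt (p := p) hp3
  have hinv : i⁻¹ = -i := inv_eq_of_mul_eq_one_right (by linear_combination -hi)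
  have hi1 : 1 + i ≠ 0 := by
    intro h
    apply h2
    linear_combination (1 - i) * h + hi
  have hq : (1 - i) / (1 + i) = -i := by rw [div_eq_iff hi1]; linear_combination hi
  have key : ∀ N : ℕ, ∑ m ∈ Ico 1 (2 * N + 1), (i ^ m - (-i) ^ m) / (m : k) ^ 2 =
      2 * i * ∑ j ∈ range N, (-1) ^ j * (1 / ((2 * j + 1 : ℕ) : k) ^ 2) := by
    intro N
    induction N with
    | zero => simp
    | succ N ih =>
      have e1 : i ^ (2 * N + 1) = (-1) ^ N * i := by rw [pow_succ, pow_mul, hi]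
      have e2 : (-i) ^ (2 * N + 1) = -((-1) ^ N * i) := by
        rw [Odd.neg_pow ⟨N, rfl⟩, e1]
      have e3 : (-i) ^ (2 * N + 1 + 1) = i ^ (2 * N + 1 + 1) := Even.neg_pow ⟨N + 1, by ring⟩ _
      rw [show 2 * (N + 1) + 1 = 2 * N + 1 + 1 + 1 by ring, sum_Ico_succ_top (by omega),
        sum_Ico_succ_top (by omega), ih, sum_range_succ, e1, e2, e3]
      ring
  have hs := sum_neg_one_pow_mul_odd_pow (R := k) hrec (p - 3) N
  have hN0 : (2 * (N : k)) = -1 := by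
    have := CharP.cast_eq_zero k p
    rw [hN] at this
    push_cast at this
    linear_combination this
  have hev : Even (p - 3) := ⟨N - 1, by omega⟩
  -- The values at 1 and -1 add up to 2 · 0^(p-3) = 0 and are equal by parity.
  have hz : appellSum e (p - 3) (1 : k) = 0 := by
    have h := appellSum_add_one_add_appellSum_sub_one (R := k) hrec (p - 3) 0
    rw [zero_add, zero_sub, appellSum_neg hodd hev, zero_pow (by omega)] at h
    refine (mul_eq_zero.mp (?_ : 2 * appellSum e (p - 3) (1 : k) = 0)).resolve_left h2
    linear_combination h
  rw [hN0, appellSum_neg hodd hev, hz, mul_zero, sub_zero] at hs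
  rw [he, Rat.cast_intCast]
  refine (Red.intCast (e (p - 3))).congr rfl ?_
  rw [← hs, hinv, hq, finPolylog, finPolylog, ← sum_sub_distrib]
  simp only [← sub_div]
  have h3 := key N
  rw [← hN] at h3
  rw [h3]
  have h4 : ∀ j ∈ range N, (-1) ^ j * (1 / ((2 * j + 1 : ℕ) : k) ^ 2) =
      (-1) ^ j * (2 * (j : k) + 1) ^ (p - 3) := by
    intro j hj
    have := mem_range.mp hj
    rw [one_div_pow_eq_pow (p := p) (mem_Ico.mpr (by omega)) (by omega),
      show p - 1 - 2 = p - 3 by omega]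
    push_cast
    ring
  rw [sum_congr rfl h4]
  linear_combination (-2 * ∑ j ∈ range N, (-1) ^ j * (2 * (j : k) + 1) ^ (p - 3)) * hi

end

/-! ### Alternating binomial sums for t = 4 -/

section

open Polynomial

variable {F : Type*} [Field F]

theorem sum_range_harmonicSum_one_div (h2 : (2 : F) ≠ 0) (m : ℕ) :
    ∑ l ∈ range m, harmonicSum F 1 l / ((l : F) + 1) =
      (harmonicSum F 1 m ^ 2 - harmonicSum F 2 m) / 2 := by
  induction m with
  | zero => simp [harmonicSum_zero]
  | succ m ih =>
    rw [sum_range_succ, ih, harmonicSum_succ, harmonicSum_succ, pow_one]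
    generalize (m : F) + 1 = c
    rw [← sub_eq_zero]
    field_simp
    ring

theorem sum_range_harmonicSum_succ_div (h2 : (2 : F) ≠ 0) (m : ℕ) :
    ∑ l ∈ range m, harmonicSum F 1 (l + 1) / ((l : F) + 1) =
      (harmonicSum F 1 m ^ 2 + harmonicSum F 2 m) / 2 := by
  induction m with
  | zero => simp [harmonicSum_zero]
  | succ m ih =>
    rw [sum_range_succ, ih, harmonicSum_succ, harmonicSum_succ, pow_one]
    generalize (m : F) + 1 = c
    field_simp
    ring

/-- The third elementary symmetric function of the numbers `1 / j` for `0 < j ≤ m`. -/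
def harmonicEsymmThree (F : Type*) [Field F] (m : ℕ) : F :=
  (harmonicSum F 1 m ^ 3 - 3 * harmonicSum F 1 m * harmonicSum F 2 m + 2 * harmonicSum F 3 m) / 6

theorem sum_range_esymm_two_div (h2 : (2 : F) ≠ 0) (h3 : (3 : F) ≠ 0) (m : ℕ) :
    ∑ l ∈ range m, (harmonicSum F 1 l ^ 2 - harmonicSum F 2 l) / 2 / ((l : F) + 1) =
      harmonicEsymmThree F m := by
  have h6 : (6 : F) = 2 * 3 := by norm_num
  induction m with
  | zero => simp [harmonicSum_zero, harmonicEsymmThree]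
  | succ m ih =>
    rw [sum_range_succ, ih, harmonicEsymmThree, harmonicEsymmThree, harmonicSum_succ, harmonicSum_succ,
      harmonicSum_succ, pow_one, h6]
    generalize (m : F) + 1 = c
    by_cases hc : c = 0
    · subst hc; simp
    field_simp
    ring

theorem sum_range_sum_range_harmonicSum (h2 : (2 : F) ≠ 0) (h3 : (3 : F) ≠ 0) (m : ℕ) :
    ∑ l ∈ range m, (∑ i ∈ range l, harmonicSum F 1 (i + 1) / ((i : F) + 1)) / ((l : F) + 1) =
      harmonicEsymmThree F m + ∑ l ∈ range m, harmonicSum F 2 l / ((l : F) + 1) := by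
  rw [← sum_range_esymm_two_div h2 h3, ← sum_add_distrib]
  refine sum_congr rfl fun l _ => ?_
  rw [sum_range_harmonicSum_succ_div h2]
  field_simp
  ring

/-- Both sides are the integral of (1 - x²)^m over [0, 1]; the induction uses its reduction formula
(2m+3) I_{m+1} = (2m+2) I_m. -/
theorem sum_choose_div_odd [CharZero F] (m : ℕ) :
    ∑ j ∈ range (m + 1), (-1) ^ j * (m.choose j : F) / (2 * j + 1) =
      4 ^ (m + 1) / (2 * ((m : F) + 1) * (m + 1).centralBinom) := by
  have hodd : ∀ j : ℕ, (2 * (j : F) + 1) ≠ 0 := fun j => by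
    exact_mod_cast (Nat.cast_ne_zero (R := F)).mpr (show 2 * j + 1 ≠ 0 by omega)
  induction m with
  | zero => simp [Nat.centralBinom, Nat.choose]; norm_num
  | succ m ih =>
    have h1 : (2 * ((m : F) + 1) + 1) * ∑ j ∈ range (m + 1 + 1), (-1) ^ j * ((m + 1).choose j : F) / (2 * j + 1)
        = 2 * ((m : F) + 1) * ∑ j ∈ range (m + 1), (-1) ^ j * (m.choose j : F) / (2 * j + 1) := by
      have h2 : ∑ j ∈ range (m + 1), (-1) ^ j * (m.choose j : F) / (2 * j + 1) =
          ∑ j ∈ range (m + 1 + 1), (-1) ^ j * (m.choose j : F) / (2 * j + 1) := by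
        rw [sum_range_succ _ (m + 1), Nat.choose_succ_self]; simp
      rw [h2, mul_sum, mul_sum, ← sub_eq_zero, ← sum_sub_distrib]
      have h3 : ∑ j ∈ range (m + 1 + 1), (-1) ^ j * ((m + 1).choose j : F) = 0 := by
        have := add_pow (-1 : F) 1 (m + 1)
        simp only [one_pow, mul_one] at this
        rw [← this]; simp
      rw [← h3]
      refine sum_congr rfl fun j hj => ?_
      have hj' := mem_range.mp hj
      have h4 := congrArg (fun n : ℕ => (n : F)) (Nat.choose_mul_succ_eq m j)
      simp only [Nat.cast_mul] at h4
      rw [Nat.cast_sub (by omega)] at h4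
      push_cast at h4
      have := hodd j
      field_simp
      linear_combination (-2) * h4
    have h5 := centralBinom_succ_cast (K := F) (m + 1)
    have h0 := centralBinom_cast_ne_zero (K := F) (m + 1)
    have h0' := centralBinom_cast_ne_zero (K := F) (m + 1 + 1)
    have hm := hodd (m + 1)
    have hm1 : ((m : F) + 1) ≠ 0 := Nat.cast_add_one_ne_zero m
    have hm2 : ((m : F) + 1 + 1) ≠ 0 := by exact_mod_cast Nat.cast_add_one_ne_zero (R := F) (m + 1)
    push_cast at hm h5 ⊢
    refine mul_left_cancel₀ hm ?_
    rw [h1, ih]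
    field_simp
    linear_combination 2 * 4 ^ (m + 1) * h5

/-- The alternating binomial sums `(-1) ^ m ∑_{j < N} binom(j, m) / (j + 1) ^ r`. -/
def binomSum (F : Type*) [Field F] (N r m : ℕ) : F :=
  (-1) ^ m * ∑ j ∈ range N, (j.choose m : F) / ((j : F) + 1) ^ r

theorem binomSum_zero_right (N r : ℕ) : binomSum F N r 0 = harmonicSum F r N := by
  simp [binomSum, harmonicSum]

theorem binomSum_zero (N m : ℕ) : binomSum F N 0 m = (-1) ^ m * (N.choose (m + 1) : F) := by
  rw [binomSum]
  congr 1
  simp only [pow_zero, div_one]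
  induction N with
  | zero => simp
  | succ N ih => rw [sum_range_succ, ih, Nat.choose_succ_succ']; push_cast; ring

theorem binomSum_self (N r : ℕ) : binomSum F N r N = 0 := by
  rw [binomSum, sum_eq_zero, mul_zero]
  intro j hj
  rw [Nat.choose_eq_zero_of_lt (mem_range.mp hj)]; simp

variable [CharZero F]

theorem binomSum_succ (N r m : ℕ) :
    binomSum F N (r + 1) (m + 1) =
      binomSum F N (r + 1) m - binomSum F N r m / ((m : F) + 1) := by
  have hm : ((m : F) + 1) ≠ 0 := Nat.cast_add_one_ne_zero m
  simp only [binomSum, mul_sum, sum_div]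
  rw [← sum_sub_distrib]
  refine sum_congr rfl fun j _ => ?_
  have hj : ((j : F) + 1) ≠ 0 := Nat.cast_add_one_ne_zero j
  have h1 := congrArg (fun n : ℕ => (n : F)) (Nat.add_one_mul_choose_eq j m)
  have h2 := congrArg (fun n : ℕ => (n : F)) (Nat.choose_succ_succ' j m)
  push_cast at h1 h2
  field_simp
  rw [pow_succ]
  linear_combination (-1) ^ m * ((j : F) + 1) ^ r * (h1 + ((m : F) + 1) * h2)

theorem binomSum_eq (N r m : ℕ) :
    binomSum F N (r + 1) m =
      harmonicSum F (r + 1) N - ∑ l ∈ range m, binomSum F N r l / ((l : F) + 1) := by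
  induction m with
  | zero => simp [binomSum_zero_right]
  | succ m ih => rw [binomSum_succ, ih, sum_range_succ]; ring

/-- Insert the expansion over odd denominators for each 4^i / (i binom(2i, i)) and exchange the
sums. All powers of p in denominators then sit in the single factor 1/(2m+1). -/
theorem sum_four_pow_div (N r : ℕ) :
    ∑ i ∈ Ico 1 (N + 1), (4 : F) ^ i / ((i : F) ^ (r + 1) * i.centralBinom) =
      2 * ∑ m ∈ range N, binomSum F N r m / (2 * m + 1) := by
  have h1 : ∀ i ∈ range N, (4 : F) ^ (1 + i) / (((1 + i : ℕ) : F) ^ (r + 1) * (1 + i).centralBinom) =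
      2 * ∑ m ∈ range N, (-1) ^ m * ((i.choose m : F) / ((i : F) + 1) ^ r) / (2 * m + 1) := by
    intro i hi
    have h2 := sum_choose_div_odd (F := F) i
    have h3 : ∑ j ∈ range (i + 1), (-1) ^ j * (i.choose j : F) / (2 * j + 1) =
        ∑ j ∈ range N, (-1) ^ j * (i.choose j : F) / (2 * j + 1) := by
      refine sum_subset (range_subset_range.mpr (mem_range.mp hi)) fun j _ hj => ?_
      rw [Nat.choose_eq_zero_of_lt (by simpa using hj)]; simp
    have hi1 : ((i : F) + 1) ≠ 0 := Nat.cast_add_one_ne_zero i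
    have h0 := centralBinom_cast_ne_zero (K := F) (i + 1)
    have h4 : ∑ m ∈ range N, (-1) ^ m * ((i.choose m : F) / ((i : F) + 1) ^ r) / (2 * m + 1) =
        (∑ j ∈ range N, (-1) ^ j * (i.choose j : F) / (2 * j + 1)) / ((i : F) + 1) ^ r := by
      rw [sum_div]
      exact sum_congr rfl fun j _ => by ring
    rw [h4, ← h3, h2, add_comm 1 i, pow_succ ((i + 1 : ℕ) : F)]
    push_cast
    field_simp
  rw [sum_Ico_eq_sum_range, Nat.add_sub_cancel, sum_congr rfl h1, ← mul_sum, sum_comm]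
  congr 1
  refine sum_congr rfl fun m _ => ?_
  rw [binomSum, mul_sum, sum_div]

end

/-! ### First-order expansions: binomials, Wolstenholme, H_{p-1}(2) -/

section

open Polynomial

variable {k : Type*} [Field k] {p : ℕ} [hp : Fact p.Prime] [CharP k p]
  {K : Type*} [Field K] [CharZero K] {V : ValuationSubring K} {ρ : V →+* k} [IsLocalHom ρ]

theorem Red.one_div_succ {l : ℕ} (h : l + 1 < p) :
    Red ρ (1 / ((l : K) + 1)) (1 / ((l : k) + 1)) := by
  have := Red.one_div_pow (K := K) (ρ := ρ) (Nat.succ_pos l) h 1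
  simpa using this

theorem exists_choose_prime_sub_one {m : ℕ} (hm : m < p) :
    ∃ z, Red ρ z (harmonicSum k 1 m) ∧ (-1) ^ m * ((p - 1).choose m : K) = 1 - p * z := by
  obtain ⟨z, hz, he⟩ := exists_prod_one_add (K := K) (ρ := ρ) (k := k) Red.one.neg hm
  refine ⟨-z, hz.neg.congr rfl (by ring), ?_⟩
  have h : ∀ m < p, (-1) ^ m * ((p - 1).choose m : K) =
      ∏ j ∈ range m, (1 + (p : K) * -1 / ((j + 1 : ℕ) : K)) := by
    intro m
    induction m with
    | zero => simp
    | succ m ih =>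
      intro hm
      rw [prod_range_succ, ← ih (by omega)]
      have h1 := congrArg (fun n : ℕ => (n : K)) (Nat.choose_succ_right_eq (p - 1) m)
      simp only [Nat.cast_mul] at h1
      rw [Nat.cast_sub (by omega), Nat.cast_sub (by omega)] at h1
      have hm0 : ((m : K) + 1) ≠ 0 := Nat.cast_add_one_ne_zero m
      push_cast at h1 ⊢
      field_simp
      rw [pow_succ]
      linear_combination (-(-1) ^ m) * h1
  rw [h m hm, he]
  ring

/-- Write binom(p, i) = (p/i) binom(p-1, i-1) and expand the second factor as ±(1 - p H_{i-1} +
...). The second-order term is ∑ H_{i-1} x^i / i, whose residue is -£_2(1-a). -/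
theorem exists_one_sub_pow_sub_pow (hp3 : 3 < p) {x : K} {a : k} (hx : Red ρ x a) :
    ∃ z, Red ρ z (-finPolylog p 2 (1 - a)) ∧
      1 - x ^ p - (1 - x) ^ p = p * (finPolylog p 1 x - p * z) := by
  have h1 : ∀ i, ∃ z, i < p → Red ρ z (harmonicSum k 1 i) ∧
      (-1) ^ i * ((p - 1).choose i : K) = 1 - p * z := by
    intro i
    by_cases hi : i < p
    · obtain ⟨z, hz⟩ := exists_choose_prime_sub_one (K := K) (ρ := ρ) hi
      exact ⟨z, fun _ => hz⟩
    · exact ⟨0, fun h => absurd h hi⟩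
  choose z hz using h1
  refine ⟨∑ i ∈ Ico 1 p, z (i - 1) * (1 / (i : K) ^ 1) * x ^ i, ?_, ?_⟩
  · rw [← sum_harmonicSum_one_mul_pow hp3]
    refine Red.sum fun i hi => ?_
    have hi' := mem_Ico.mp hi
    exact (((hz (i - 1) (by omega)).1.mul (Red.one_div_pow hi'.1 hi'.2 1)).mul (hx.pow i)).congr rfl
      (by ring)
  · have h2 := add_pow (-x) 1 p
    rw [sum_range_succ, range_eq_Ico, sum_eq_sum_Ico_succ_bot hp.out.pos] at h2
    have h3 : ∀ i ∈ Ico (0 + 1) p, (-x) ^ i * 1 ^ (p - i) * (p.choose i : K) =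
        -(p * (x ^ i / (i : K) ^ 1 - p * (z (i - 1) * (1 / (i : K) ^ 1) * x ^ i))) := by
      intro i hi
      have hi' := mem_Ico.mp hi
      obtain ⟨j, rfl⟩ : ∃ j, i = j + 1 := ⟨i - 1, by omega⟩
      have h4 := congrArg (fun n : ℕ => (n : K)) (Nat.add_one_mul_choose_eq (p - 1) j)
      rw [Nat.sub_add_cancel hp.out.one_le] at h4
      have hj0 : ((j : K) + 1) ≠ 0 := Nat.cast_add_one_ne_zero j
      have h5 := (hz j (by omega)).2
      push_cast at h4 ⊢
      rw [neg_pow, pow_succ (-1 : K), one_pow, pow_one]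
      field_simp
      linear_combination x ^ (j + 1) * ((-1) ^ j * h4 - p * h5)
    rw [sum_congr rfl h3, sum_neg_distrib, ← mul_sum, sum_sub_distrib, ← mul_sum] at h2
    rw [show 1 - x = -x + 1 by ring, h2, finPolylog, neg_pow x p, neg_one_pow_prime hp3]
    simp
    ring

theorem Red.one_sub_pow_sub_pow_div (hp3 : 3 < p) {x σ : K} {a : k} (hx : Red ρ x a)
    (hσ : p * σ = 1 - x ^ p - (1 - x) ^ p) : Red ρ σ (_root_.finPolylog p 1 a) := by
  have hpK : (p : K) ≠ 0 := Nat.cast_ne_zero.mpr hp.out.ne_zero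
  obtain ⟨z, hz, he⟩ := exists_one_sub_pow_sub_pow hp3 hx
  rw [he] at hσ
  exact ((Red.finPolylog hx 1).sub ((Red.prime p).mul hz)).congr (mul_left_cancel₀ hpK hσ) (by ring)

/-- Wolstenholme: pairing i with p - i gives p/2 times ∑ 1/(i(p-i)), which is -∑ 1/i² = 0 modulo p.
-/
theorem exists_harmonicSum_one_prime (hp3 : 3 < p) :
    ∃ z, Red ρ z (0 : k) ∧ harmonicSum K 1 (p - 1) = p * z := by
  have h2 : (2 : k) ≠ 0 := two_ne_zero_of_three_lt (p := p) hp3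
  refine ⟨1 / 2 * ∑ i ∈ Ico 1 p, 1 / (i : K) ^ 1 * (1 / ((p - i : ℕ) : K) ^ 1), ?_, ?_⟩
  · have h : Red ρ (∑ i ∈ Ico 1 p, 1 / (i : K) ^ 1 * (1 / ((p - i : ℕ) : K) ^ 1))
        (∑ i ∈ Ico 1 p, 1 / (i : k) ^ 1 * (1 / ((p - i : ℕ) : k) ^ 1)) :=
      Red.sum fun i hi => by
        have hi' := mem_Ico.mp hi
        exact (Red.one_div_pow hi'.1 hi'.2 1).mul (Red.one_div_pow (by omega) (by omega) 1)
    refine ((Red.one.div (Red.ofNat 2) h2).mul h).congr rfl ?_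
    have h3 : ∑ i ∈ Ico 1 p, 1 / (i : k) ^ 1 * (1 / ((p - i : ℕ) : k) ^ 1) =
        -∑ i ∈ Ico 1 p, 1 / (i : k) ^ 2 := by
      rw [← sum_neg_distrib]
      refine sum_congr rfl fun i hi => ?_
      have h0 := cast_ne_zero_of_mem_Ico (k := k) hi
      rw [natCast_prime_sub (mem_Ico.mp hi).2.le]
      field_simp
    rw [h3, sum_Ico_one_div_pow_eq_zero (p := p) two_pos (by omega)]
    simp
  · have h3 := sum_Ico_reflect_prime (p := p) (fun i => 1 / (i : K) ^ 1)
    rw [harmonicSum_eq_sum_Ico, Nat.sub_add_cancel hp.out.one_le]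
    have h4 : ∀ i ∈ Ico 1 p, (p : K) * (1 / (i : K) ^ 1 * (1 / ((p - i : ℕ) : K) ^ 1)) =
        1 / (i : K) ^ 1 + 1 / ((p - i : ℕ) : K) ^ 1 := by
      intro i hi
      have hi' := mem_Ico.mp hi
      have h0 : (i : K) ≠ 0 := Nat.cast_ne_zero.mpr (by omega)
      have h1 : ((p - i : ℕ) : K) ≠ 0 := Nat.cast_ne_zero.mpr (by omega)
      have h5 : ((p - i : ℕ) : K) = p - i := Nat.cast_sub hi'.2.le
      field_simp
      rw [h5]
      ring
    have h6 : (p : K) * ∑ i ∈ Ico 1 p, 1 / (i : K) ^ 1 * (1 / ((p - i : ℕ) : K) ^ 1) =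
        2 * ∑ i ∈ Ico 1 p, 1 / (i : K) ^ 1 := by
      rw [mul_sum, sum_congr rfl h4, sum_add_distrib, h3]; ring
    linear_combination (-1 / 2 : K) * h6

variable {f : k[X]} {b : k} (hp3 : 3 < p) (hf : IsFaulhaber p f b)
include hp3

/-- The same pairing, now with opposite signs since p is odd; the difference 1/i² - 1/(p-i)²
supplies the factor p and leaves -£_3(-1). -/
theorem exists_finPolylog_two_neg_one (hf : IsFaulhaber p f b) :
    ∃ z, Red ρ z (b / 2) ∧ finPolylog p 2 (-1 : K) = p * z := by
  have h2 : (2 : k) ≠ 0 := two_ne_zero_of_three_lt (p := p) hp3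
  refine ⟨1 / 2 * ∑ i ∈ Ico 1 p, (-1) ^ i * (1 / (i : K) ^ 2 * (1 / ((p - i : ℕ) : K) ^ 2))
    * (p - 2 * i), ?_, ?_⟩
  · have h : Red ρ (∑ i ∈ Ico 1 p, (-1) ^ i * (1 / (i : K) ^ 2 * (1 / ((p - i : ℕ) : K) ^ 2))
          * (p - 2 * i))
        (∑ i ∈ Ico 1 p, (-1) ^ i * (1 / (i : k) ^ 2 * (1 / ((p - i : ℕ) : k) ^ 2))
          * (0 - 2 * i)) :=
      Red.sum fun i hi => by
        have hi' := mem_Ico.mp hi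
        exact ((Red.one.neg.pow i).mul ((Red.one_div_pow hi'.1 hi'.2 2).mul
          (Red.one_div_pow (by omega) (by omega) 2))).mul
          ((Red.prime p).sub ((Red.ofNat 2).mul (Red.natCast i)))
    refine ((Red.one.div (Red.ofNat 2) h2).mul h).congr rfl ?_
    have h3 : ∑ i ∈ Ico 1 p, (-1) ^ i * (1 / (i : k) ^ 2 * (1 / ((p - i : ℕ) : k) ^ 2))
        * (0 - 2 * i) = -2 * finPolylog p 3 (-1) := by
      rw [finPolylog, mul_sum]
      refine sum_congr rfl fun i hi => ?_
      have h0 := cast_ne_zero_of_mem_Ico (k := k) hi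
      rw [natCast_prime_sub (mem_Ico.mp hi).2.le]
      field_simp
      ring
    rw [h3, finPolylog_three_neg_one hp3 hf]
    field_simp
  · have h3 := sum_Ico_reflect_prime (p := p) (fun i => (-1) ^ i / (i : K) ^ 2)
    rw [finPolylog]
    have h4 : ∀ i ∈ Ico 1 p, (p : K) * ((-1) ^ i * (1 / (i : K) ^ 2 * (1 / ((p - i : ℕ) : K) ^ 2))
        * (p - 2 * i)) = (-1) ^ i / (i : K) ^ 2 + (-1) ^ (p - i) / ((p - i : ℕ) : K) ^ 2 := by
      intro i hi
      have hi' := mem_Ico.mp hi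
      have h0 : (i : K) ≠ 0 := Nat.cast_ne_zero.mpr (by omega)
      have h1 : ((p - i : ℕ) : K) ≠ 0 := Nat.cast_ne_zero.mpr (by omega)
      have h5 : ((p - i : ℕ) : K) = p - i := Nat.cast_sub hi'.2.le
      have h6 : (-1 : K) ^ (p - i) = -(-1) ^ i := by
        have h7 : (-1 : K) ^ (p - i) * (-1) ^ i = -1 := by
          rw [← pow_add, Nat.sub_add_cancel hi'.2.le, neg_one_pow_prime hp3]
        have h8 : (-1 : K) ^ i * (-1) ^ i = 1 := by rw [← mul_pow]; simp
        linear_combination (-1) ^ i * h7 - (-1) ^ (p - i) * h8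
      rw [h6]
      field_simp
      rw [h5]
      ring
    have h6 : (p : K) * ∑ i ∈ Ico 1 p, (-1) ^ i * (1 / (i : K) ^ 2 * (1 / ((p - i : ℕ) : K) ^ 2))
        * (p - 2 * i) = 2 * ∑ i ∈ Ico 1 p, (-1) ^ i / (i : K) ^ 2 := by
      rw [mul_sum, sum_congr rfl h4, sum_add_distrib, h3]; ring
    linear_combination (-1 / 2 : K) * h6

/-- Apply the recursion in r twice, starting from r = 0, where the value is -(1 - p z) with z
congruent to H_{m+1}(1). The accumulated first-order terms form the nested harmonic sum in `R`. -/
theorem exists_binomSum_two {m : ℕ} (hm : m < p) :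
    ∃ R, Red ρ R (harmonicEsymmThree k m + ∑ l ∈ range m, harmonicSum k 2 l / ((l : k) + 1)) ∧
      binomSum K (p - 1) 2 m = harmonicSum K 2 (p - 1) - harmonicSum K 1 (p - 1) * harmonicSum K 1 m
        - (harmonicSum K 1 m ^ 2 - harmonicSum K 2 m) / 2 + p * R := by
  have h2 : (2 : k) ≠ 0 := two_ne_zero_of_three_lt (p := p) hp3
  have h3 : (3 : k) ≠ 0 := three_ne_zero_of_three_lt (p := p) hp3
  have h1 : ∀ i, ∃ z, i < p → Red ρ z (harmonicSum k 1 i) ∧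
      (-1) ^ i * ((p - 1).choose i : K) = 1 - p * z := by
    intro i
    by_cases hi : i < p
    · obtain ⟨z, hz⟩ := exists_choose_prime_sub_one (K := K) (ρ := ρ) hi
      exact ⟨z, fun _ => hz⟩
    · exact ⟨0, fun h => absurd h hi⟩
  choose z hz using h1
  refine ⟨∑ l ∈ range m, (∑ i ∈ range l, z (i + 1) * (1 / ((i : K) + 1))) * (1 / ((l : K) + 1)),
    ?_, ?_⟩
  · rw [← sum_range_sum_range_harmonicSum h2 h3]
    refine Red.congr (Red.sum (g := fun l => (∑ i ∈ range l, harmonicSum k 1 (i + 1) *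
      (1 / ((i : k) + 1))) * (1 / ((l : k) + 1))) fun l hl => ?_) rfl ?_
    · have hl' := mem_range.mp hl
      refine Red.mul (Red.sum fun i hi => ?_) (Red.one_div_succ (by omega))
      have hi' := mem_range.mp hi
      exact (hz (i + 1) (by omega)).1.mul (Red.one_div_succ (by omega))
    · refine sum_congr rfl fun l _ => ?_
      rw [mul_one_div]
      congr 1
      exact sum_congr rfl fun i _ => by rw [mul_one_div]
  · have h4 : ∀ l ∈ range m, binomSum K (p - 1) 1 l / ((l : K) + 1) =
        harmonicSum K 1 (p - 1) * (1 / ((l : K) + 1) ^ 1) + harmonicSum K 1 l / ((l : K) + 1)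
        - p * ((∑ i ∈ range l, z (i + 1) * (1 / ((i : K) + 1))) * (1 / ((l : K) + 1))) := by
      intro l hl
      have hl' := mem_range.mp hl
      have h5 : ∑ i ∈ range l, binomSum K (p - 1) 0 i / ((i : K) + 1) =
          -harmonicSum K 1 l + p * ∑ i ∈ range l, z (i + 1) * (1 / ((i : K) + 1)) := by
        rw [harmonicSum, ← sum_neg_distrib, mul_sum, ← sum_add_distrib]
        refine sum_congr rfl fun i hi => ?_
        have hi' := mem_range.mp hi
        have h6 := (hz (i + 1) (by omega)).2
        rw [pow_succ] at h6
        have h7 : (-1) ^ i * ((p - 1).choose (i + 1) : K) = -(1 - p * z (i + 1)) := by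
          linear_combination -h6
        rw [binomSum_zero, h7]
        push_cast
        ring
      rw [binomSum_eq, h5]
      ring
    rw [binomSum_eq, sum_congr rfl h4, sum_sub_distrib, sum_add_distrib, ← mul_sum, ← mul_sum,
      sum_range_harmonicSum_one_div two_ne_zero]
    have h8 : ∑ l ∈ range m, 1 / ((l : K) + 1) ^ 1 = harmonicSum K 1 m := by
      simp [harmonicSum]
    rw [h8]
    ring

omit hp3 in
theorem sum_range_harmonicSum_two_div_eq (m : ℕ) :
    ∑ l ∈ range m, harmonicSum k 2 l / ((l : k) + 1) =
      ∑ i ∈ Ico 1 (m + 1), harmonicSum k 2 (i - 1) / (i : k) := by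
  rw [sum_Ico_eq_sum_range, Nat.add_sub_cancel]
  refine sum_congr rfl fun l _ => ?_
  rw [Nat.add_sub_cancel_left]
  push_cast
  rw [add_comm]

theorem three_lt_prime_sub_one_of_three_lt : 3 < p - 1 := by
  have : p ≠ 4 := by rintro rfl; exact absurd hp.out (by norm_num)
  omega

theorem harmonicEsymmThree_prime_sub_one : harmonicEsymmThree k (p - 1) = 0 := by
  rw [harmonicEsymmThree, harmonicSum_prime_sub_one hp3 one_pos (by omega),
    harmonicSum_prime_sub_one hp3 two_pos (by omega),
    harmonicSum_prime_sub_one hp3 three_pos (three_lt_prime_sub_one_of_three_lt hp3)]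
  simp

/-- At m = p - 1 the binomial sum is empty of nonzero terms, so the expansion becomes a linear
equation for H_{p-1}(2), in which H_{p-1}(1)² is negligible by Wolstenholme. -/
theorem exists_harmonicSum_two_prime (hf : IsFaulhaber p f b) :
    ∃ z, Red ρ z (2 / 3 * b) ∧ harmonicSum K 2 (p - 1) = p * z := by
  have h3 : (3 : k) ≠ 0 := three_ne_zero_of_three_lt (p := p) hp3
  obtain ⟨h, hh, e1⟩ := exists_harmonicSum_one_prime (K := K) (ρ := ρ) (k := k) hp3
  obtain ⟨R, hR, e2⟩ := exists_binomSum_two (K := K) (ρ := ρ) (k := k) (m := p - 1) hp3 (by omega)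
  rw [harmonicEsymmThree_prime_sub_one hp3, sum_range_harmonicSum_two_div_eq,
    Nat.sub_add_cancel hp.out.one_le, hf.sum_harmonicSum_two_div hp3, zero_add] at hR
  rw [binomSum_self, e1] at e2
  refine ⟨p * h ^ 2 - 2 / 3 * R, (((Red.prime p).mul (hh.pow 2)).sub
    (((Red.ofNat 2).div (Red.ofNat 3) h3).mul hR)).congr rfl (by ring), ?_⟩
  linear_combination (-2 / 3 : K) * e2

end

/-! ### Half-range harmonic sums; t = 4 with cubes and fourth powers -/

section

open Polynomial

variable {k : Type*} [Field k] {p : ℕ} [hp : Fact p.Prime] [CharP k p]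
  {K : Type*} [Field K] [CharZero K] {V : ValuationSubring K} {ρ : V →+* k} [IsLocalHom ρ]
  {f : k[X]} {b : k} (hp3 : 3 < p) {n : ℕ} (hn : p = 2 * n + 1)
include hp3 hn

theorem harmonicSum_two_half : harmonicSum k 2 n = 0 := by
  have h2 : (2 : k) ≠ 0 := two_ne_zero_of_three_lt (p := p) hp3
  have h := harmonicSum_reflect (k := k) (m := n) hp3 two_pos (by omega) (by omega)
  rw [show p - 1 - n = n by omega] at h
  refine (mul_eq_zero.mp (?_ : 2 * harmonicSum k 2 n = 0)).resolve_left h2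
  linear_combination h

theorem harmonicSum_one_half : harmonicSum k 1 n = finPolylog p 1 (-1) := by
  have h2 : (2 : k) ≠ 0 := two_ne_zero_of_three_lt (p := p) hp3
  have h := finPolylog_neg_one_eq h2 1 n
  rw [← hn, show 2 * n = p - 1 by omega, harmonicSum_prime_sub_one hp3 one_pos (by omega)] at h
  rw [h]
  field_simp
  ring

theorem harmonicEsymmThree_half (hf : IsFaulhaber p f b) :
    harmonicEsymmThree k n = (finPolylog p 1 (-1) ^ 3 - 4 * b) / 6 := by
  rw [harmonicEsymmThree, harmonicSum_two_half hp3 hn, harmonicSum_one_half hp3 hn,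
    hf.harmonicSum_three_half hp3 hn]
  ring

/-- Split the full sum, which is -b, in the middle. Reflection makes the upper half equal to the
lower one plus H_n(3) = -2b. -/
theorem sum_harmonicSum_two_div_half (hf : IsFaulhaber p f b) :
    ∑ l ∈ range n, harmonicSum k 2 l / ((l : k) + 1) = b / 2 := by
  have h2 : (2 : k) ≠ 0 := two_ne_zero_of_three_lt (p := p) hp3
  have h := hf.sum_harmonicSum_two_div hp3
  rw [← sum_Ico_consecutive _ (show 1 ≤ n + 1 by omega) (show n + 1 ≤ p by omega),
    ← sum_range_harmonicSum_two_div_eq] at h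
  have h1 : ∑ i ∈ Ico (n + 1) p, harmonicSum k 2 (i - 1) / (i : k) =
      ∑ l ∈ range n, (harmonicSum k 2 l / ((l : k) + 1) + 1 / ((l : k) + 1) ^ 3) := by
    rw [sum_Ico_eq_sum_range, show p - (n + 1) = n by omega, ← sum_range_reflect]
    refine sum_congr rfl fun l hl => ?_
    have hl' := mem_range.mp hl
    have e1 : ((n + 1 + (n - 1 - l) : ℕ) : k) = -((l : k) + 1) := by
      rw [show n + 1 + (n - 1 - l) = p - (l + 1) by omega, natCast_prime_sub (by omega)]
      push_cast; ring
    have e2 : n + 1 + (n - 1 - l) - 1 = p - 1 - (l + 1) := by omega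
    have h0 : ((l : k) + 1) ≠ 0 := by
      have := natCast_ne_zero_of_lt (k := k) (p := p) (i := l + 1) (by omega) (by omega)
      exact_mod_cast this
    rw [e1, e2, harmonicSum_reflect hp3 two_pos (by omega) (by omega), harmonicSum_succ]
    field_simp
  have h3 : ∑ l ∈ range n, 1 / ((l : k) + 1) ^ 3 = -2 * b := by
    rw [← hf.harmonicSum_three_half hp3 hn]
    simp [harmonicSum]
  rw [h1, sum_add_distrib, h3] at h
  rw [eq_div_iff h2]
  linear_combination h

theorem exists_harmonicSum_two_half (hf : IsFaulhaber p f b) :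
    ∃ z, Red ρ z (7 / 3 * b) ∧ harmonicSum K 2 n = p * z := by
  have h2 : (2 : k) ≠ 0 := two_ne_zero_of_three_lt (p := p) hp3
  have h3 : (3 : k) ≠ 0 := three_ne_zero_of_three_lt (p := p) hp3
  obtain ⟨z, hz, e1⟩ := exists_finPolylog_two_neg_one (K := K) (ρ := ρ) hp3 hf
  obtain ⟨w, hw, e2⟩ := exists_harmonicSum_two_prime (K := K) (ρ := ρ) hp3 hf
  have h := finPolylog_neg_one_eq (F := K) two_ne_zero 2 n
  rw [← hn, show 2 * n = p - 1 by omega, e1, e2] at h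
  refine ⟨2 * (z + w), ((Red.ofNat 2).mul (hz.add hw)).congr rfl (by field_simp; ring), ?_⟩
  linear_combination (-2 : K) * h

theorem exists_harmonicSum_one_half {σ : K} (hσ : p * σ = 2 - 2 ^ p) :
    ∃ z, Red ρ z (finPolylog p 1 (-1 : k) ^ 2 / 4) ∧ harmonicSum K 1 n = σ + p * z := by
  have hpK : (p : K) ≠ 0 := Nat.cast_ne_zero.mpr hp.out.ne_zero
  obtain ⟨z, hz, e1⟩ := exists_one_sub_pow_sub_pow (K := K) (ρ := ρ) (k := k) hp3 Red.one.neg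
  obtain ⟨w, hw, e2⟩ := exists_harmonicSum_one_prime (K := K) (ρ := ρ) (k := k) hp3
  have h := finPolylog_neg_one_eq (F := K) two_ne_zero 1 n
  rw [← hn, show 2 * n = p - 1 by omega, e2] at h
  rw [show (1 : k) - -1 = 2 by norm_num, finPolylog_two_two hp3] at hz
  rw [neg_one_pow_prime hp3, show (1 : K) - -1 = 2 by norm_num, ← hσ, h] at e1
  have e3 := mul_left_cancel₀ hpK e1
  refine ⟨z + w, (hz.add hw).congr rfl (by ring), ?_⟩
  linear_combination -e3

theorem odd_cast_ne_zero {m : ℕ} (hm : m < p) (hne : m ≠ n) : (2 * (m : k) + 1) ≠ 0 := by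
  intro h
  have h1 : ((2 * m + 1 : ℕ) : k) = 0 := by exact_mod_cast h
  rw [CharP.cast_eq_zero_iff k p] at h1
  obtain ⟨c, hc⟩ := h1
  have : c = 1 := by
    have h3 : c < 2 := by
      by_contra h4
      have : p * 2 ≤ p * c := Nat.mul_le_mul_left p (by omega)
      omega
    interval_cases c <;> omega
  subst this
  omega

omit hp3 in
-- Only m = n = (p-1)/2 has 2m + 1 divisible by p; that term is isolated, and the remaining ones
-- enter with a factor p.
theorem prime_mul_sum_four_pow_div (r : ℕ) :
    ∑ i ∈ Ico 1 p, p * (4 : K) ^ i / (i.centralBinom : K) * (1 / (i : K) ^ (r + 1)) =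
      2 * binomSum K (p - 1) r n +
        p * (2 * ∑ m ∈ (range p).erase n, binomSum K (p - 1) r m / (2 * m + 1)) := by
  have h := sum_four_pow_div (F := K) (p - 1) r
  have hpK : (p : K) ≠ 0 := Nat.cast_ne_zero.mpr hp.out.ne_zero
  rw [Nat.sub_add_cancel hp.out.one_le] at h
  have h1 : ∑ m ∈ range (p - 1), binomSum K (p - 1) r m / (2 * (m : K) + 1) =
      ∑ m ∈ range p, binomSum K (p - 1) r m / (2 * (m : K) + 1) := by
    conv_rhs => rw [← Nat.sub_add_cancel hp.out.one_le, sum_range_succ]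
    rw [Nat.sub_add_cancel hp.out.one_le, binomSum_self, zero_div, add_zero]
  rw [h1, ← add_sum_erase _ _ (mem_range.mpr (show n < p by omega))] at h
  have h2 : (2 * (n : K) + 1) = p := by rw [hn]; push_cast; ring
  have h3 : ∑ i ∈ Ico 1 p, p * (4 : K) ^ i / (i.centralBinom : K) * (1 / (i : K) ^ (r + 1)) =
      p * ∑ i ∈ Ico 1 p, (4 : K) ^ i / ((i : K) ^ (r + 1) * i.centralBinom) := by
    rw [mul_sum]
    exact sum_congr rfl fun i _ => by ring
  rw [h3, h, h2]
  field_simp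

/-- Modulo p only the isolated term counts. One more step of the recursion in r turns second
elementary symmetric functions of the 1/j into the third one. -/
theorem red_sum_four_pow_div_pow_four (hf : IsFaulhaber p f b) :
    Red ρ (∑ i ∈ Ico 1 p, p * (4 : K) ^ i / (i.centralBinom : K) * (1 / (i : K) ^ 4))
      ((finPolylog p 1 (-1) ^ 3 - 4 * b) / 3) := by
  have h2 : (2 : k) ≠ 0 := two_ne_zero_of_three_lt (p := p) hp3
  have h3 : (3 : k) ≠ 0 := three_ne_zero_of_three_lt (p := p) hp3
  have hint : ∀ m, ∃ a, Red ρ (binomSum K (p - 1) 3 m) a := fun m =>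
    ⟨_, (Red.one.neg.pow m).mul (Red.sum fun j hj => by
      have hj' := mem_range.mp hj
      exact ((Red.natCast (j.choose m)).mul (Red.one_div_pow (k := k) (p := p) (i := j + 1)
        (by omega) (by omega) 3)).congr (by push_cast; rw [mul_one_div]) rfl)⟩
  choose a ha using hint
  have h4 : Red ρ (∑ m ∈ (range p).erase n, binomSum K (p - 1) 3 m / (2 * m + 1))
      (∑ m ∈ (range p).erase n, a m / (2 * m + 1)) := Red.sum fun m hm => by
    have hm' := mem_erase.mp hm
    exact (ha m).div (((Red.ofNat 2).mul (Red.natCast m)).add Red.one)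
      (odd_cast_ne_zero hp3 hn (mem_range.mp hm'.2) hm'.1)
  have h5 : Red ρ (binomSum K (p - 1) 3 n) (harmonicEsymmThree k n) := by
    rw [binomSum_eq, ← sum_range_esymm_two_div h2 h3]
    have h6 : Red ρ (∑ l ∈ range n, binomSum K (p - 1) 2 l / ((l : K) + 1))
        (∑ l ∈ range n, (-((harmonicSum k 1 l ^ 2 - harmonicSum k 2 l) / 2)) *
          (1 / ((l : k) + 1))) := by
      refine Red.sum fun l hl => ?_
      have hl' := mem_range.mp hl
      obtain ⟨R, hR, e⟩ := exists_binomSum_two (K := K) (ρ := ρ) (k := k) (m := l) hp3 (by omega)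
      have g1 := Red.harmonicSum (K := K) (ρ := ρ) (p := p) (m := l) (by omega) 1
      have g2 := Red.harmonicSum (K := K) (ρ := ρ) (p := p) (m := l) (by omega) 2
      have g3 := Red.harmonicSum (K := K) (ρ := ρ) (p := p) (m := p - 1) (by omega) 1
      have g4 := Red.harmonicSum (K := K) (ρ := ρ) (p := p) (m := p - 1) (by omega) 2
      rw [harmonicSum_prime_sub_one (k := k) hp3 one_pos (by omega)] at g3
      rw [harmonicSum_prime_sub_one (k := k) hp3 two_pos (by omega)] at g4
      refine Red.congr (((((g4.sub (g3.mul g1)).sub (((g1.pow 2).sub g2).div (Red.ofNat 2) h2)).add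
        ((Red.prime p).mul hR))).mul (Red.one_div_succ (p := p) (show l + 1 < p by omega))) ?_ ?_
      · rw [e]; ring
      · ring
    have g5 := Red.harmonicSum (K := K) (ρ := ρ) (p := p) (m := p - 1) (by omega) 3
    rw [harmonicSum_prime_sub_one (k := k) hp3 three_pos (three_lt_prime_sub_one_of_three_lt hp3)] at g5
    refine (g5.sub h6).congr rfl ?_
    rw [zero_sub, ← sum_neg_distrib]
    exact sum_congr rfl fun l _ => by ring
  rw [prime_mul_sum_four_pow_div hn]
  refine (((Red.ofNat 2).mul h5).add ((Red.prime p).mul ((Red.ofNat 2).mul h4))).congr rfl ?_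
  rw [harmonicEsymmThree_half hp3 hn hf, show (6 : k) = 2 * 3 by norm_num]
  field_simp
  ring

/-- Under m ↦ p - 1 - m the square H_m(1)² is invariant and 2m + 1 changes sign, so that part
cancels. The part with H_m(2) is the interpolation sum of f(X+1) around n, where f'(1/2) = 7b. -/
theorem sum_erase_esymm_two_div_odd (hf : IsFaulhaber p f b) :
    ∑ m ∈ (range p).erase n, (harmonicSum k 1 m ^ 2 - harmonicSum k 2 m) / 2 / (2 * m + 1) =
      7 / 4 * b := by
  have h2 : (2 : k) ≠ 0 := two_ne_zero_of_three_lt (p := p) hp3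
  have h4 : (4 : k) = 2 * 2 := by norm_num
  have hn0 : 2 * (n : k) = -1 := by
    have := CharP.cast_eq_zero k p
    rw [hn] at this
    push_cast at this
    linear_combination this
  have h1 : ∑ m ∈ (range p).erase n, harmonicSum k 1 m ^ 2 / (2 * m + 1) = 0 := by
    have h5 : ∑ m ∈ (range p).erase n, harmonicSum k 1 m ^ 2 / (2 * (m : k) + 1) =
        ∑ m ∈ (range p).erase n, -(harmonicSum k 1 m ^ 2 / (2 * (m : k) + 1)) := by
      refine sum_nbij' (fun m => p - 1 - m) (fun m => p - 1 - m) ?_ ?_ ?_ ?_ ?_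
      · intro m hm; simp only [mem_erase, mem_range] at hm ⊢; omega
      · intro m hm; simp only [mem_erase, mem_range] at hm ⊢; omega
      · intro m hm; simp only [mem_erase, mem_range] at hm ⊢; omega
      · intro m hm; simp only [mem_erase, mem_range] at hm ⊢; omega
      · intro m hm
        simp only [mem_erase, mem_range] at hm
        rw [harmonicSum_reflect hp3 one_pos (by omega) hm.2, show p - 1 - m = p - (m + 1) by omega,
          natCast_prime_sub (by omega)]
        push_cast
        rw [show 2 * -((m : k) + 1) + 1 = -(2 * m + 1) by ring, div_neg, neg_neg]
        ring
    rw [sum_neg_distrib] at h5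
    have h6 : 2 * ∑ m ∈ (range p).erase n, harmonicSum k 1 m ^ 2 / (2 * (m : k) + 1) = 0 := by
      linear_combination h5
    exact (mul_eq_zero.mp h6).resolve_left h2
  have h3 : ∑ m ∈ (range p).erase n, harmonicSum k 2 m / (2 * m + 1) = -(7 / 2) * b := by
    have hdeg : (f.comp (X + 1)).natDegree < p := by
      refine natDegree_comp_le.trans_lt ?_
      have h6 : (X + 1 : k[X]).natDegree ≤ 1 := by simpa using (natDegree_X_add_C (1 : k)).le
      have := hf.natDegree_le
      have : f.natDegree * (X + 1 : k[X]).natDegree ≤ f.natDegree * 1 := Nat.mul_le_mul_left _ h6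
      omega
    have h5 := sum_eval_div_sub hp3 hdeg (show n < p by omega)
    rw [derivative_comp, eval_mul, eval_comp] at h5
    simp only [eval_comp, eval_add, eval_X, eval_one, derivative_add, derivative_X, derivative_one,
      add_zero] at h5
    rw [show (n : k) + 1 = 1 / 2 by field_simp; linear_combination hn0,
      hf.eval_derivative_half hp3] at h5
    have h6 : ∀ m ∈ (range p).erase n, harmonicSum k 2 m / (2 * (m : k) + 1) =
        1 / 2 * (f.eval ((m : k) + 1) / ((m : k) - n)) := by
      intro m hm
      simp only [mem_erase, mem_range] at hm
      have h7 := odd_cast_ne_zero (k := k) hp3 hn hm.2 hm.1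
      rw [hf.eval_succ hp3 hm.2, show (2 * (m : k) + 1) = 2 * (m - n) by linear_combination hn0]
      rw [show (2 * (m : k) + 1) = 2 * (m - n) by linear_combination hn0] at h7
      have h8 := right_ne_zero_of_mul h7
      field_simp
    rw [sum_congr rfl h6, ← mul_sum, h5]
    field_simp
  have h5 : ∀ m ∈ (range p).erase n, (harmonicSum k 1 m ^ 2 - harmonicSum k 2 m) / 2 / (2 * m + 1) =
      1 / 2 * (harmonicSum k 1 m ^ 2 / (2 * m + 1)) - 1 / 2 * (harmonicSum k 2 m / (2 * m + 1)) := by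
    intro m _; ring
  rw [sum_congr rfl h5, sum_sub_distrib, ← mul_sum, ← mul_sum, h1, h3, h4]
  field_simp
  ring

/-- The leading term is -H_n(1)² with H_n(1) = σ + O(p). The first-order corrections come from
H_n(1), H_n(2), H_{p-1}(2), the remainder `R` at n and the terms with m ≠ n. -/
theorem exists_sum_four_pow_div_cube (hf : IsFaulhaber p f b) {σ : K} (hσ : p * σ = 2 - 2 ^ p) :
    ∃ z, Red ρ z (-(finPolylog p 1 (-1) ^ 3 + b) / 6) ∧
      ∑ i ∈ Ico 1 p, p * (4 : K) ^ i / (i.centralBinom : K) * (1 / (i : K) ^ 3) =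
        -σ ^ 2 + p * z := by
  have h2 : (2 : k) ≠ 0 := two_ne_zero_of_three_lt (p := p) hp3
  have h3 : (3 : k) ≠ 0 := three_ne_zero_of_three_lt (p := p) hp3
  obtain ⟨z1, hz1, e1⟩ := exists_harmonicSum_one_half (ρ := ρ) (k := k) hp3 hn hσ
  obtain ⟨z2, hz2, e2⟩ := exists_harmonicSum_two_half (K := K) (ρ := ρ) hp3 hn hf
  obtain ⟨z3, hz3, e3⟩ := exists_harmonicSum_one_prime (K := K) (ρ := ρ) (k := k) hp3
  obtain ⟨z4, hz4, e4⟩ := exists_harmonicSum_two_prime (K := K) (ρ := ρ) hp3 hf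
  obtain ⟨R, hR, e5⟩ := exists_binomSum_two (K := K) (ρ := ρ) (k := k) (m := n) hp3 (by omega)
  rw [harmonicEsymmThree_half hp3 hn hf, sum_harmonicSum_two_div_half hp3 hn hf] at hR
  have hσ' : Red ρ σ (finPolylog p 1 (-1 : k)) :=
    Red.one_sub_pow_sub_pow_div hp3 (x := (-1 : K)) Red.one.neg (by
      rw [hσ, neg_one_pow_prime hp3]; norm_num)
  have h6 : Red ρ (∑ m ∈ (range p).erase n, binomSum K (p - 1) 2 m / (2 * m + 1))
      (∑ m ∈ (range p).erase n, -((harmonicSum k 1 m ^ 2 - harmonicSum k 2 m) / 2 / (2 * m + 1))) := by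
    refine Red.sum fun l hl => ?_
    simp only [mem_erase, mem_range] at hl
    obtain ⟨R, hR, e⟩ := exists_binomSum_two (K := K) (ρ := ρ) (k := k) (m := l) hp3 (by omega)
    have g1 := Red.harmonicSum (K := K) (ρ := ρ) (p := p) (m := l) (by omega) 1
    have g2 := Red.harmonicSum (K := K) (ρ := ρ) (p := p) (m := l) (by omega) 2
    rw [e, e3, e4]
    exact Red.congr (((((((Red.prime p).mul hz4).sub (((Red.prime p).mul hz3).mul g1)).sub
      (((g1.pow 2).sub g2).div (Red.ofNat 2) h2)).add ((Red.prime p).mul hR))).div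
      (((Red.ofNat 2).mul (Red.natCast l)).add Red.one) (odd_cast_ne_zero hp3 hn hl.2 hl.1)) rfl
      (by ring)
  rw [sum_neg_distrib, sum_erase_esymm_two_div_odd hp3 hn hf] at h6
  rw [prime_mul_sum_four_pow_div hn, e5, e1, e2, e3, e4]
  generalize ∑ m ∈ (range p).erase n, binomSum K (p - 1) 2 m / (2 * (m : K) + 1) = S at *
  refine ⟨2 * z4 - 2 * z3 * (σ + p * z1) - (2 * σ * z1 + p * z1 ^ 2) + z2 + 2 * R + 2 * S,
    Red.congr ((((((Red.ofNat 2).mul hz4).sub (((Red.ofNat 2).mul hz3).mul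
      (hσ'.add ((Red.prime p).mul hz1)))).sub ((((Red.ofNat 2).mul hσ').mul hz1).add
      ((Red.prime p).mul (hz1.pow 2)))).add hz2).add ((Red.ofNat 2).mul hR) |>.add
      ((Red.ofNat 2).mul h6)) rfl ?_, by ring⟩
  rw [show (6 : k) = 2 * 3 by norm_num, show (4 : k) = 2 * 2 by norm_num]
  field_simp
  ring

end

/-! ### The congruences for t = 2 and t = 4 -/

section

variable {k : Type*} [Field k] {p : ℕ} [hp : Fact p.Prime] [CharP k p]
  {K : Type*} [Field K] [CharZero K] {V : ValuationSubring K} {ρ : V →+* k} [IsLocalHom ρ]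

theorem ratModEq_of_eq_add {x y : ℚ} {w : K} {n : ℕ} (h : (x : K) = (y : K) + (p : K) ^ n * w)
    (hw : Red ρ w 0) : RatModEq p (n + 1) x y := by
  have hpQ : (p : ℚ) ≠ 0 := Nat.cast_ne_zero.mpr hp.out.ne_zero
  have hpK : (p : K) ≠ 0 := Nat.cast_ne_zero.mpr hp.out.ne_zero
  refine ratModEq_of_red (ρ := ρ) (d := (x - y) / (p : ℚ) ^ n)
    (by rw [mul_div_cancel₀ _ (pow_ne_zero n hpQ)]) (hw.congr ?_ rfl)
  push_cast
  rw [h, add_sub_cancel_left, mul_div_cancel_left₀ _ (pow_ne_zero n hpK)]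

omit hp in
theorem Icc_one_sub_one (hp0 : 0 < p) : Icc 1 (p - 1) = Ico 1 p := by
  ext i; simp only [mem_Icc, mem_Ico]; omega

theorem cast_fermatQuotient_two :
    (p : K) * ((fermatQuotient p 2 : ℚ) : K) = 2 ^ (p - 1) - 1 := by
  have hpK : (p : K) ≠ 0 := Nat.cast_ne_zero.mpr hp.out.ne_zero
  rw [fermatQuotient]
  push_cast
  rw [mul_div_cancel₀ _ hpK]

theorem two_pow_prime_eq :
    (2 : K) ^ p = 2 + 2 * p * ((fermatQuotient p 2 : ℚ) : K) := by
  have h := cast_fermatQuotient_two (p := p) (K := K)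
  have h1 : (2 : K) ^ p = 2 ^ (p - 1) * 2 := by rw [← pow_succ, Nat.sub_add_cancel hp.out.one_le]
  rw [h1]
  linear_combination -2 * h

variable (hp3 : 3 < p)
include hp3

/-- At x = -1 the quotient (1 - x^p - (1-x)^p)/p equals (2 - 2^p)/p = -2 q_p(2), and its residue is
£_1(-1). -/
theorem exists_red_fermatQuotient : ∃ q : k, Red ρ ((fermatQuotient p 2 : ℚ) : K) q ∧
    finPolylog p 1 (-1 : k) = -2 * q := by
  have h2 : (2 : k) ≠ 0 := two_ne_zero_of_three_lt (p := p) hp3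
  have h := Red.one_sub_pow_sub_pow_div (ρ := ρ) (k := k) hp3 (x := (-1 : K))
    (σ := -2 * ((fermatQuotient p 2 : ℚ) : K)) Red.one.neg (by
      rw [neg_one_pow_prime hp3, show (1 : K) - -1 = 2 by norm_num, two_pow_prime_eq]; ring)
  refine ⟨-finPolylog p 1 (-1) / 2, ((h.neg.div (Red.ofNat 2) h2)).congr (by ring) rfl, ?_⟩
  field_simp

theorem exists_sq_eq_neg_one [IsAlgClosed K] : ∃ (α : K) (a : k), Red ρ α a ∧ α ^ 2 = -1 ∧ a ^ 2 = -1 := by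
  obtain ⟨α, hα⟩ := IsAlgClosed.exists_pow_nat_eq (-1 : K) two_pos
  obtain ⟨a, ha⟩ := Red.exists_of_quadratic (ρ := ρ) (x := α) V.zero_mem (V.neg_mem _ V.one_mem)
    (by linear_combination hα)
  exact ⟨α, a, ha, hα, (ha.pow 2).unique (hα ▸ Red.one.neg)⟩

theorem ratModEq_sum_two_pow_div (ρ : V →+* k) [IsLocalHom ρ] [IsAlgClosed K] : RatModEq p 3
    (p * ∑ k ∈ Icc 1 (p - 1), (2 : ℚ) ^ k / (k * k.centralBinom))
    ((legendreSym p (-1) : ℚ) - 1 - p * fermatQuotient p 2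
      + (p : ℚ) ^ 2 * eulerNumber (p - 3)) := by
  have h2 : (2 : k) ≠ 0 := two_ne_zero_of_three_lt (p := p) hp3
  obtain ⟨α, a, hα, hα2, ha2⟩ := exists_sq_eq_neg_one (ρ := ρ) (p := p) hp3
  have ha0 : a ≠ 0 := by rintro rfl; simp at ha2
  have hα0 : α ≠ 0 := by rintro rfl; simp at hα2
  have ha1 : 1 + a ≠ 0 := by
    intro h
    apply h2
    linear_combination (1 - a) * h + ha2
  have hinv : α⁻¹ = -α := inv_eq_of_mul_eq_one_right (by linear_combination -hα2)
  -- t = 2 means α + α⁻¹ = 0, that is α² = -1.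
  have ht : (2 : K) = 2 - α - α⁻¹ := by rw [hinv]; ring
  have hT := red_sum_harmonicSum_div hp3 hα ha0 ha1 ht
  obtain ⟨Y, hY, e⟩ := exists_sum_div_eq hp3 (Red.ofNat 2) hT
  have hE := red_eulerNumber (K := K) (ρ := ρ) hp3 ha2
  obtain ⟨n, hn⟩ : ∃ n, p = 2 * n + 1 := hp.out.odd_of_ne_two (by omega)
  have hu : lucasSum (2 : K) (p + 1) p = (-1) ^ n := by
    have h := lucasSum_mul hα0 ht (N := p + 1) (n := p) (by omega) (by omega)
    have h3 : α ^ p = (-1) ^ n * α := by rw [hn, pow_succ, pow_mul, hα2]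
    rw [hinv, neg_pow, neg_one_pow_prime hp3, h3] at h
    refine mul_left_cancel₀ (mul_ne_zero two_ne_zero hα0) ?_
    linear_combination h
  have hleg : legendreSym p (-1) = (-1) ^ n := by
    rw [legendreSym.at_neg_one (by omega), ZMod.χ₄_eq_neg_one_pow (by omega),
      show p / 2 = n by omega]
  rw [hu, two_pow_prime_eq] at e
  refine ratModEq_of_eq_add (w := Y - ((eulerNumber (p - 3) : ℚ) : K)) ?_
    ((hY.sub hE).congr rfl (by ring))
  rw [Icc_one_sub_one hp.out.pos, hleg]
  push_cast
  have h4 : (p : K) * ∑ i ∈ Ico 1 p, (2 : K) ^ i / (i * i.centralBinom) =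
      ∑ i ∈ Ico 1 p, p * (2 : K) ^ i / (i.centralBinom : K) * (1 / (i : K)) := by
    rw [mul_sum]; exact sum_congr rfl fun i _ => by ring
  rw [h4, e]
  ring

theorem prime_mul_sum_pow_div_eq (t : K) (d : ℕ) :
    (p : K) * ∑ i ∈ Ico 1 p, t ^ i / ((i : K) ^ d * i.centralBinom) =
      ∑ i ∈ Ico 1 p, p * t ^ i / (i.centralBinom : K) * (1 / (i : K) ^ d) := by
  rw [mul_sum]; exact sum_congr rfl fun i _ => by ring

theorem ratModEq_sum_two_pow_div_sq (ρ : V →+* k) [IsLocalHom ρ] [IsAlgClosed K] : RatModEq p 3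
    (p * ∑ k ∈ Icc 1 (p - 1), (2 : ℚ) ^ k / ((k : ℚ) ^ 2 * k.centralBinom))
    (-fermatQuotient p 2 + (p : ℚ) ^ 2 / 16 * bernoulli (p - 3)) := by
  have h2 : (2 : k) ≠ 0 := two_ne_zero_of_three_lt (p := p) hp3
  have h16 : (16 : k) ≠ 0 := by
    rw [show (16 : k) = 2 ^ 4 by norm_num]; exact pow_ne_zero 4 h2
  have hpK : (p : K) ≠ 0 := Nat.cast_ne_zero.mpr hp.out.ne_zero
  obtain ⟨α, a, hα, hα2, ha2⟩ := exists_sq_eq_neg_one (ρ := ρ) (p := p) hp3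
  have ha0 : a ≠ 0 := by rintro rfl; simp at ha2
  have hinv : α⁻¹ = -α := inv_eq_of_mul_eq_one_right (by linear_combination -hα2)
  have ht : (2 : K) = 2 - α - α⁻¹ := by rw [hinv]; ring
  obtain ⟨f, b, hf, hb, -⟩ := exists_isFaulhaber (K := K) (ρ := ρ) hp3
  obtain ⟨Y, hY, e⟩ := exists_sum_div_sq_eq hp3 hα ha0 ht
  rw [finPolylog_three_add_inv_of_sq_eq_neg_one hp3 hf ha2] at hY
  rw [hinv, neg_pow, neg_one_pow_prime hp3, two_pow_prime_eq] at e
  refine ratModEq_of_eq_add (w := Y - 1 / 16 * ((bernoulli (p - 3) : ℚ) : K)) ?_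
    ((hY.sub ((Red.one.div (Red.ofNat 16) h16).mul hb)).congr rfl (by ring))
  rw [Icc_one_sub_one hp.out.pos]
  push_cast
  rw [prime_mul_sum_pow_div_eq hp3, e]
  field_simp
  ring

theorem ratModEq_sum_four_pow_div_sq (ρ : V →+* k) [IsLocalHom ρ] : RatModEq p 3
    (p * ∑ k ∈ Icc 1 (p - 1), (4 : ℚ) ^ k / ((k : ℚ) ^ 2 * k.centralBinom))
    (-4 * fermatQuotient p 2 - 2 * p * fermatQuotient p 2 ^ 2
      + (p : ℚ) ^ 2 * bernoulli (p - 3)) := by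
  have h2 : (2 : k) ≠ 0 := two_ne_zero_of_three_lt (p := p) hp3
  have hpK : (p : K) ≠ 0 := Nat.cast_ne_zero.mpr hp.out.ne_zero
  obtain ⟨f, b, hf, hb, -⟩ := exists_isFaulhaber (K := K) (ρ := ρ) hp3
  -- t = 4 is the degenerate parameter α = α⁻¹ = -1.
  obtain ⟨Y, hY, e⟩ := exists_sum_div_sq_eq (ρ := ρ) (k := k) hp3 (α := (-1 : K)) (a := -1) (t := 4)
    Red.one.neg (neg_ne_zero.mpr one_ne_zero) (by norm_num)
  rw [inv_neg, inv_one, finPolylog_three_neg_one hp3 hf] at hY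
  rw [inv_neg, inv_one, neg_one_pow_prime hp3, show (4 : K) ^ p = (2 ^ p) ^ 2 by
    rw [← pow_mul, mul_comm, pow_mul]; norm_num, two_pow_prime_eq] at e
  refine ratModEq_of_eq_add (w := Y - ((bernoulli (p - 3) : ℚ) : K)) ?_
    ((hY.sub hb).congr rfl (by field_simp; ring))
  rw [Icc_one_sub_one hp.out.pos]
  push_cast
  rw [prime_mul_sum_pow_div_eq hp3, e]
  field_simp
  ring

theorem ratModEq_sum_four_pow_div_cube (ρ : V →+* k) [IsLocalHom ρ] : RatModEq p 2
    (p * ∑ k ∈ Icc 1 (p - 1), (4 : ℚ) ^ k / ((k : ℚ) ^ 3 * k.centralBinom))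
    (-4 * fermatQuotient p 2 ^ 2
      + p * (4 / 3 * fermatQuotient p 2 ^ 3 - 1 / 6 * bernoulli (p - 3))) := by
  have h2 : (2 : k) ≠ 0 := two_ne_zero_of_three_lt (p := p) hp3
  have h3 : (3 : k) ≠ 0 := three_ne_zero_of_three_lt (p := p) hp3
  have h6 : (6 : k) = 2 * 3 := by norm_num
  have h60 : (6 : k) ≠ 0 := by rw [h6]; exact mul_ne_zero h2 h3
  obtain ⟨f, b, hf, hb, -⟩ := exists_isFaulhaber (K := K) (ρ := ρ) hp3
  obtain ⟨q, hq, hq1⟩ := exists_red_fermatQuotient (K := K) (ρ := ρ) hp3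
  obtain ⟨n, hn⟩ : ∃ n, p = 2 * n + 1 := hp.out.odd_of_ne_two (by omega)
  obtain ⟨z, hz, e⟩ := exists_sum_four_pow_div_cube (ρ := ρ) hp3 hn hf
    (σ := -2 * ((fermatQuotient p 2 : ℚ) : K)) (by rw [two_pow_prime_eq]; ring)
  rw [hq1] at hz
  refine ratModEq_of_eq_add (w := z - (4 / 3 * ((fermatQuotient p 2 : ℚ) : K) ^ 3
    - 1 / 6 * ((bernoulli (p - 3) : ℚ) : K))) ?_
    ((hz.sub ((((Red.ofNat 4).div (Red.ofNat 3) h3).mul (hq.pow 3)).sub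
      ((Red.one.div (Red.ofNat 6) h60).mul hb))).congr rfl ?_)
  · rw [Icc_one_sub_one hp.out.pos]
    push_cast
    rw [prime_mul_sum_pow_div_eq hp3, e]
    ring
  · rw [h6]
    field_simp
    ring

theorem ratModEq_sum_four_pow_div_pow_four (ρ : V →+* k) [IsLocalHom ρ] : RatModEq p 1
    (p * ∑ k ∈ Icc 1 (p - 1), (4 : ℚ) ^ k / ((k : ℚ) ^ 4 * k.centralBinom))
    (-(4 / 3) * (2 * fermatQuotient p 2 ^ 3 + bernoulli (p - 3))) := by
  have h3 : (3 : k) ≠ 0 := three_ne_zero_of_three_lt (p := p) hp3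
  obtain ⟨f, b, hf, hb, -⟩ := exists_isFaulhaber (K := K) (ρ := ρ) hp3
  obtain ⟨q, hq, hq1⟩ := exists_red_fermatQuotient (K := K) (ρ := ρ) hp3
  obtain ⟨n, hn⟩ : ∃ n, p = 2 * n + 1 := hp.out.odd_of_ne_two (by omega)
  have h := red_sum_four_pow_div_pow_four (K := K) (ρ := ρ) hp3 hn hf
  rw [hq1] at h
  refine ratModEq_of_eq_add (n := 0)
    (w := ∑ i ∈ Ico 1 p, (p : K) * 4 ^ i / (i.centralBinom : K) * (1 / (i : K) ^ 4)
      - -(4 / 3) * (2 * ((fermatQuotient p 2 : ℚ) : K) ^ 3 + ((bernoulli (p - 3) : ℚ) : K))) ?_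
    ((h.sub ((((Red.ofNat 4).div (Red.ofNat 3) h3).neg).mul
      (((Red.ofNat 2).mul (hq.pow 3)).add hb))).congr rfl ?_)
  · rw [Icc_one_sub_one hp.out.pos]
    push_cast
    rw [prime_mul_sum_pow_div_eq hp3]
    ring
  · field_simp
    ring

end

/-! ### The congruences with central binomial coefficients in the numerator -/

section

theorem legendreSym_three_cases {p : ℕ} [hp : Fact p.Prime] (hp3 : 3 < p) :
    (p % 3 = 1 ∧ legendreSym 3 p = 1) ∨ (p % 3 = 2 ∧ legendreSym 3 p = -1) := by
  have h0 : p % 3 ≠ 0 := fun h => by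
    have := (Nat.prime_dvd_prime_iff_eq Nat.prime_three hp.out).mp (Nat.dvd_of_mod_eq_zero h)
    omega
  have h1 : legendreSym 3 (1 : ℤ) = 1 := legendreSym.at_one _
  have h2 : legendreSym 3 (2 : ℤ) = -1 := by
    rw [legendreSym.at_two (by norm_num)]; decide
  rcases (by omega : p % 3 = 1 ∨ p % 3 = 2) with h | h
  · refine Or.inl ⟨h, ?_⟩
    rw [legendreSym.mod, show ((p : ℤ) % (3 : ℕ)) = 1 by omega, h1]
  · refine Or.inr ⟨h, ?_⟩
    rw [legendreSym.mod, show ((p : ℤ) % (3 : ℕ)) = 2 by omega, h2]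

theorem lucasNumber_eq {R : Type*} [CommRing R] {φ : R} (hφ : φ ^ 2 = φ + 1) (n : ℕ) :
    (lucasNumber n : R) = φ ^ n + (1 - φ) ^ n := by
  induction n using Nat.twoStepInduction with
  | zero => simp [lucasNumber]; norm_num
  | one => simp [lucasNumber]
  | more n h1 h2 =>
    rw [lucasNumber, Nat.cast_add, h1, h2]
    linear_combination (-φ ^ n - (1 - φ) ^ n) * hφ

theorem fib_mul_eq {R : Type*} [CommRing R] {φ : R} (hφ : φ ^ 2 = φ + 1) (n : ℕ) :
    (Nat.fib n : R) * (2 * φ - 1) = φ ^ n - (1 - φ) ^ n := by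
  induction n using Nat.twoStepInduction with
  | zero => simp
  | one => simp; ring
  | more n h1 h2 =>
    rw [Nat.fib_add_two, Nat.cast_add, add_mul, h1, h2]
    linear_combination (-φ ^ n + (1 - φ) ^ n) * hφ

variable {k : Type*} [Field k] {p : ℕ} [hp : Fact p.Prime] [CharP k p]
  {K : Type*} [Field K] [CharZero K] {V : ValuationSubring K} {ρ : V →+* k} [IsLocalHom ρ]

theorem prime_mul_lucasQuotient {φ : K} (hφ : φ ^ 2 = φ + 1) :
    (p : K) * ((lucasQuotient p : ℚ) : K) = φ ^ p + (1 - φ) ^ p - 1 := by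
  have hpK : (p : K) ≠ 0 := Nat.cast_ne_zero.mpr hp.out.ne_zero
  rw [lucasQuotient]
  push_cast
  rw [mul_div_cancel₀ _ hpK, lucasNumber_eq hφ]

variable (hp3 : 3 < p)
include hp3

theorem exists_sq_eq_sub_one [IsAlgClosed K] :
    ∃ (ζ : K) (z : k), Red ρ ζ z ∧ ζ ^ 2 = ζ - 1 ∧ z ^ 2 = z - 1 ∧ 1 - 2 * ζ ≠ 0 ∧ 1 - 2 * z ≠ 0 := by
  have h3 : (3 : k) ≠ 0 := three_ne_zero_of_three_lt (p := p) hp3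
  obtain ⟨α, hα⟩ := IsAlgClosed.exists_pow_nat_eq (-3 : K) two_pos
  obtain ⟨ζ, hζ⟩ : ∃ ζ : K, ζ ^ 2 = ζ - 1 := ⟨(1 + α) / 2, by
    field_simp; linear_combination hα⟩
  obtain ⟨z, hz⟩ := Red.exists_of_quadratic (ρ := ρ) (x := ζ) V.one_mem (V.neg_mem _ V.one_mem)
    (by linear_combination hζ)
  have hz2 : z ^ 2 = z - 1 := (hz.pow 2).unique (hζ ▸ hz.sub Red.one)
  refine ⟨ζ, z, hz, hζ, hz2, fun h => ?_, fun h => ?_⟩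
  · exact three_ne_zero (α := K) (by linear_combination 4 * hζ - (1 - 2 * ζ) * h)
  · exact h3 (by linear_combination 4 * hz2 - (1 - 2 * z) * h)

theorem ratModEq_sum_centralBinom (ρ : V →+* k) [IsLocalHom ρ] [IsAlgClosed K] : RatModEq p 3
    (∑ k ∈ range p, (k.centralBinom : ℚ))
    ((legendreSym 3 p : ℚ) - (p : ℚ) ^ 2 / 3 * bernoulliThird (p - 2)) := by
  have h3 : (3 : k) ≠ 0 := three_ne_zero_of_three_lt (p := p) hp3
  obtain ⟨f, b, hf, -, hB⟩ := exists_isFaulhaber (K := K) (ρ := ρ) hp3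
  obtain ⟨ζ, z, hz, hζ, hz2, hζ0, hz0⟩ := exists_sq_eq_sub_one (ρ := ρ) (p := p) hp3
  have hl := legendreSym_three_cases hp3
  set l : ℤ := legendreSym 3 p
  have hl' : (p % 3 = 1 ∧ (l : k) = 1) ∨ (p % 3 = 2 ∧ (l : k) = -1) := by
    rcases hl with ⟨h, e⟩ | ⟨h, e⟩ <;> simp [h, e]
  have hA := (finPolylog_two_eisenstein hp3 hz2 hf hl').1
  obtain ⟨w, hw, e⟩ := exists_sum_centralBinom_eq hp3 hz
  have h1 := pow_prime_of_sq_eq_sub_one hp3 hζ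
  have h2 := pow_prime_of_sq_eq_sub_one hp3 (show (1 - ζ) ^ 2 = (1 - ζ) - 1 by
    linear_combination hζ)
  -- Raising to the p-th power fixes or exchanges the roots ζ and 1 - ζ according to p modulo 3,
  -- that is, by the sign l.
  have hs : ζ ^ p + (1 - ζ) ^ p = 1 ∧ 2 * (1 - ζ) ^ p - 1 = l * (1 - 2 * ζ) := by
    rcases hl with ⟨h, e⟩ | ⟨h, e⟩
    · rw [h1.1 h, h2.1 h, e]; push_cast; constructor <;> ring
    · rw [h1.2 h, h2.2 h, e]; push_cast; constructor <;> ring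
  have ha := ((Red.one (ρ := ρ)).sub hz).pow p
  rw [sub_pow_char (1 : k), one_pow] at ha
  rw [show ζ * (1 - ζ) = 1 by linear_combination -hζ] at e
  generalize (1 - ζ) ^ p = a at *
  refine ratModEq_of_eq_add (w := -4 * a * w / (1 - 2 * ζ)
    + 1 / 3 * ((bernoulliThird (p - 2) : ℚ) : K)) ?_
    (((((((Red.ofNat 4).neg).mul ha).mul hw).div (Red.one.sub ((Red.ofNat 2).mul hz)) hz0).add
      ((Red.one.div (Red.ofNat 3) h3).mul hB)).congr rfl ?_)
  · push_cast
    simp only [one_pow, mul_one] at e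
    have e' : ∑ i ∈ range p, (i.centralBinom : K) = l + p ^ 2 * (-4 * a * w / (1 - 2 * ζ)) := by
      refine mul_left_cancel₀ hζ0 ?_
      rw [e]
      field_simp
      linear_combination hs.2 - 2 * a * hs.1
    rw [e']
    ring
  · have hq : 3 * (-4 * (1 - z ^ p) * finPolylog p 2 (1 - z) / (1 - 2 * z)) =
        2 * f.eval (1 / 3) := by
      rw [mul_div_assoc', div_eq_iff hz0]
      linear_combination -2 * hA
    refine mul_left_cancel₀ h3 ?_
    rw [mul_add, hq]
    field_simp
    ring

theorem ratModEq_sum_centralBinom_div_three_pow (ρ : V →+* k) [IsLocalHom ρ] [IsAlgClosed K] :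
    RatModEq p 3
    (∑ k ∈ range p, (k.centralBinom : ℚ) / 3 ^ k)
    ((legendreSym 3 p : ℚ) - 2 * (p : ℚ) ^ 2 / 9 * bernoulliThird (p - 2)) := by
  have h3 : (3 : k) ≠ 0 := three_ne_zero_of_three_lt (p := p) hp3
  have h9 : (9 : k) ≠ 0 := by rw [show (9 : k) = 3 * 3 by norm_num]; exact mul_ne_zero h3 h3
  have hpK : (p : K) ≠ 0 := Nat.cast_ne_zero.mpr hp.out.ne_zero
  obtain ⟨f, b, hf, -, hB⟩ := exists_isFaulhaber (K := K) (ρ := ρ) hp3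
  obtain ⟨ζ, z, hz, hζ, hz2, hζ0, hz0⟩ := exists_sq_eq_sub_one (ρ := ρ) (p := p) hp3
  have hl := legendreSym_three_cases hp3
  set l : ℤ := legendreSym 3 p
  have hl' : (p % 3 = 1 ∧ (l : k) = 1) ∨ (p % 3 = 2 ∧ (l : k) = -1) := by
    rcases hl with ⟨h, e⟩ | ⟨h, e⟩ <;> simp [h, e]
  have hC := (finPolylog_two_eisenstein hp3 hz2 hf hl').2.2
  -- the point `x` with `x * (1 - x) = 1 / 3`
  obtain ⟨x, hx⟩ : ∃ x : K, 3 * x = 1 + ζ := ⟨(1 + ζ) / 3, by field_simp⟩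
  obtain ⟨y, hy⟩ : ∃ y : k, 3 * y = 1 + z := ⟨(1 + z) / 3, by field_simp⟩
  have hxy : Red ρ x y := (((Red.one.add hz).div (Red.ofNat 3) h3)).congr
    (by rw [← hx]; field_simp) (by rw [← hy]; field_simp)
  have hx3 : 3 * (x * (1 - x)) = 1 := by
    refine mul_left_cancel₀ (three_ne_zero (α := K)) ?_
    linear_combination (2 - 3 * x - ζ) * hx - hζ
  have hx1 : x = ζ * (1 - x) := by
    refine mul_left_cancel₀ (three_ne_zero (α := K)) ?_
    linear_combination (1 + ζ) * hx + hζ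
  have hy1 : 1 - 1 / y = z ^ 2 := by
    have hy0 : y ≠ 0 := by
      rintro rfl
      exact h3 (by linear_combination (z - 2) * hy + hz2)
    field_simp
    refine mul_left_cancel₀ h3 ?_
    linear_combination (1 - z ^ 2) * hy - (z + 2) * hz2
  have hd : 3 * (1 - 2 * y) = 1 - 2 * z := by linear_combination -2 * hy
  have hdK : 3 * (1 - 2 * x) = 1 - 2 * ζ := by linear_combination -2 * hx
  have hx0 : 1 - 2 * x ≠ 0 := fun h => hζ0 (by rw [← hdK, h, mul_zero])
  have hy0 : 1 - 2 * y ≠ 0 := fun h => hz0 (by rw [← hd, h, mul_zero])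
  -- powers of `x`
  have h1 := pow_prime_of_sq_eq_sub_one hp3 hζ
  have hxp : x ^ p = ζ ^ p * (1 - x) ^ p := by rw [← mul_pow, ← hx1]
  -- From x^p = ζ^p (1-x)^p the quotient v is 1/(1 + ζ^p), which is 1 - x or x according as ζ^p is ζ
  -- or 1 - ζ.
  obtain ⟨v, c, hv, hva, hvl⟩ : ∃ (v : K) (c : k), Red ρ v c ∧
      (1 - x) ^ p = (x ^ p + (1 - x) ^ p) * v ∧ 2 * v - 1 = l * (1 - 2 * x) := by
    rcases hl with ⟨h, e⟩ | ⟨h, e⟩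
    · refine ⟨_, _, Red.one.sub hxy, ?_, ?_⟩
      · rw [hxp, h1.1 h]
        linear_combination (-(1 - x) ^ p) * (hx3 + (x - 1) * hx)
      · rw [e]; push_cast; ring
    · refine ⟨_, _, hxy, ?_, ?_⟩
      · rw [hxp, h1.2 h]
        linear_combination (-(1 - x) ^ p) * (hx3 + x * hx)
      · rw [e]; push_cast; ring
  -- the residues
  have hX : 3 * y ^ p = 1 + z ^ p := by
    have h3p : (3 : k) ^ p = 3 := by
      have := map_natCast (frobenius k p) 3
      simpa [frobenius_def] using this
    have := congrArg (· ^ p) hy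
    simp only [mul_pow, add_pow_char (1 : k) z, one_pow, h3p] at this
    exact this
  have hZ : (z ^ p) ^ 2 = z ^ p - 1 := by
    rw [← pow_mul, mul_comm, pow_mul, hz2, sub_pow_char z 1, one_pow]
  have ha := ((Red.one (ρ := ρ)).sub hxy).pow p
  rw [sub_pow_char (1 : k), one_pow] at ha
  have hc : c = 1 - y ^ p := by
    have := (((hxy.pow p).add ha).mul hv).unique (ha.congr hva.symm rfl)
    linear_combination this
  have hL := finPolylog_two_one_sub (k := k) (p := p) hp3 (x := y) (by
    rintro rfl
    exact h3 (by linear_combination (z - 2) * hy + hz2))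
  rw [hy1] at hL
  have hG := sq_finPolylog_one (k := k) (p := p) hp3 y
  obtain ⟨σ, hσ⟩ : ∃ σ : K, p * σ = 1 - x ^ p - (1 - x) ^ p :=
    ⟨(1 - x ^ p - (1 - x) ^ p) / p, by rw [mul_div_cancel₀ _ hpK]⟩
  have hσr := Red.one_sub_pow_sub_pow_div hp3 hxy hσ
  obtain ⟨w, hw, e⟩ := exists_sum_centralBinom_eq hp3 hxy
  rw [show x * (1 - x) = 1 / 3 by
    rw [eq_div_iff three_ne_zero]; linear_combination hx3] at e
  generalize (1 - x) ^ p = a at *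
  generalize x ^ p = a' at *
  generalize y ^ p = X at *
  generalize z ^ p = Z at *
  refine ratModEq_of_eq_add (w := (-2 * σ ^ 2 * v - 4 * a * w) / (1 - 2 * x)
    + 2 / 9 * ((bernoulliThird (p - 2) : ℚ) : K)) ?_
    (((((((Red.ofNat 2).neg.mul (hσr.pow 2)).mul hv).sub (((Red.ofNat 4).mul ha).mul hw)).div
      (Red.one.sub ((Red.ofNat 2).mul hxy)) hy0).add
      (((Red.ofNat 2).div (Red.ofNat 9) h9).mul hB)).congr rfl ?_)
  · push_cast
    have e' : ∑ i ∈ range p, (i.centralBinom : K) / 3 ^ i =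
        l + p ^ 2 * ((-2 * σ ^ 2 * v - 4 * a * w) / (1 - 2 * x)) := by
      refine mul_left_cancel₀ hx0 ?_
      rw [sum_congr rfl fun i _ => show (i.centralBinom : K) / 3 ^ i =
        i.centralBinom * (1 / 3) ^ i by rw [one_div, inv_pow, div_eq_mul_inv], e]
      field_simp
      have hs : a' + a = 1 - p * σ := by linear_combination hσ
      rw [hs] at hva
      linear_combination hvl + 2 * (1 + p * σ) * hva - 2 * a * hσ
    rw [e']
    ring
  · rw [show (9 : k) = 3 * 3 by norm_num]
    have hXX : 3 * (X * (1 - X)) = 1 := by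
      refine mul_left_cancel₀ h3 ?_
      linear_combination (2 - 3 * X - Z) * hX - hZ
    -- £_2(1-y) is reached from the cube root of unity z² = 1 - 1/y by the reflection relation, and
    -- the square relation removes £_1(y)².
    have hN : 3 * 3 * (-2 * finPolylog p 1 y ^ 2 * c - 4 * (1 - X) * finPolylog p 2 (1 - y)) =
        4 * (1 - 2 * y) * f.eval (1 / 3) := by
      refine mul_left_cancel₀ h3 ?_
      rw [hc]
      linear_combination (4 * f.eval (1 / 3)) * -hd + 4 * hC + 12 * finPolylog p 2 (z ^ 2) * hX
        + (36 * X * finPolylog p 2 (z ^ 2)) * hXX - 54 * (1 - X) * hG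
        - 108 * X * (1 - X) * hL
    field_simp
    linear_combination -hN

theorem ratModEq_sum_neg_two_pow_mul_centralBinom (ρ : V →+* k) [IsLocalHom ρ] : RatModEq p 3
    (∑ k ∈ Icc 1 (p - 1), (-2 : ℚ) ^ k * k.centralBinom)
    (-(4 * p / 3) * fermatQuotient p 2) := by
  have h2 : (2 : k) ≠ 0 := two_ne_zero_of_three_lt (p := p) hp3
  have h3 : (3 : k) ≠ 0 := three_ne_zero_of_three_lt (p := p) hp3
  obtain ⟨q, hq, hq1⟩ := exists_red_fermatQuotient (K := K) (ρ := ρ) hp3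
  -- At x = -1 one has x(1-x) = -2 and 1 - 2x = 3.
  obtain ⟨w, hw, e⟩ := exists_sum_centralBinom_eq (ρ := ρ) (k := k) hp3 (x := (-1 : K))
    Red.one.neg
  rw [show (1 : k) - -1 = 2 by norm_num, finPolylog_two_two hp3, hq1] at hw
  have ha := (Red.ofNat (ρ := ρ) 2).pow p
  have h2p : (2 : k) ^ p = 2 := by
    have := map_natCast (frobenius k p) 2
    simpa [frobenius_def] using this
  rw [h2p] at ha
  have hpp := two_pow_prime_eq (p := p) (K := K)
  rw [show (1 : K) - -1 = 2 by norm_num, neg_one_pow_prime hp3, range_eq_Ico,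
    sum_eq_sum_Ico_succ_bot hp.out.pos] at e
  norm_num only [Nat.centralBinom_zero, pow_zero, zero_add, Nat.cast_one] at e
  generalize (2 : K) ^ p = a at *
  refine ratModEq_of_eq_add (w := (-8 * ((fermatQuotient p 2 : ℚ) : K) ^ 2 - 4 * a * w) / 3) ?_
    ((((((Red.ofNat 8).neg).mul (hq.pow 2)).sub (((Red.ofNat 4).mul ha).mul hw)).div
      (Red.ofNat 3) h3).congr rfl ?_)
  · rw [Icc_one_sub_one hp.out.pos]
    push_cast
    rw [sum_congr rfl fun i _ => mul_comm _ _]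
    refine mul_left_cancel₀ (three_ne_zero (α := K)) ?_
    field_simp
    linear_combination e + (6 - 2 * (a + 2 + 2 * p * ((fermatQuotient p 2 : ℚ) : K))) * hpp
  · rw [show (4 : k) = 2 * 2 by norm_num, show (8 : k) = 2 * 2 * 2 by norm_num]
    field_simp
    ring

theorem exists_sq_eq_add_one [IsAlgClosed K] :
    ∃ (φ : K) (a : k), Red ρ φ a ∧ φ ^ 2 = φ + 1 ∧ a ^ 2 = a + 1 := by
  obtain ⟨α, hα⟩ := IsAlgClosed.exists_pow_nat_eq (5 : K) two_pos
  obtain ⟨φ, hφ⟩ : ∃ φ : K, φ ^ 2 = φ + 1 := ⟨(1 + α) / 2, by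
    field_simp; linear_combination hα⟩
  obtain ⟨a, ha⟩ := Red.exists_of_quadratic (ρ := ρ) (x := φ) V.one_mem V.one_mem
    (by linear_combination hφ)
  exact ⟨φ, a, ha, hφ, (ha.pow 2).unique (hφ ▸ ha.add Red.one)⟩

theorem ratModEq_sum_neg_one_pow_div_mul_centralBinom (ρ : V →+* k) [IsLocalHom ρ]
    [IsAlgClosed K] : RatModEq p 2
    (∑ k ∈ Icc 1 (p - 1), (-1 : ℚ) ^ k / k * k.centralBinom)
    (-2 * lucasQuotient p + p * lucasQuotient p ^ 2) := by
  obtain ⟨φ, a, ha, hφ, -⟩ := exists_sq_eq_add_one (ρ := ρ) (p := p) hp3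
  have hq := prime_mul_lucasQuotient (p := p) hφ
  -- For the golden ratio φ(1-φ) = -1, and 1 - φ^p - (1-φ)^p = 1 - L_p.
  obtain ⟨z, hz, e⟩ := exists_sum_centralBinom_div_eq ρ hp3 (x := φ)
    (σ := -((lucasQuotient p : ℚ) : K)) ha.mem (by linear_combination -hq)
  obtain ⟨c, hc⟩ := Red.of_mem (ρ := ρ) hz
  refine ratModEq_of_eq_add (w := p * z) ?_ (((Red.prime p).mul hc).congr rfl (by ring))
  rw [Icc_one_sub_one hp.out.pos]
  push_cast
  rw [show φ * (1 - φ) = -1 by linear_combination -hφ] at e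
  rw [sum_congr rfl fun (i : ℕ) _ => show (-1 : K) ^ i / (i : K) * (i.centralBinom : K) =
    i.centralBinom * (-1) ^ i / (i : K) by ring, e]
  ring

theorem ratModEq_sum_centralBinom_div_sq (ρ : V →+* k) [IsLocalHom ρ] [IsAlgClosed K] :
    RatModEq p 1
    (∑ k ∈ Icc 1 (p - 1), (k.centralBinom : ℚ) / (k : ℚ) ^ 2)
    (1 / 2 * (legendreSym 3 p : ℚ) * bernoulliThird (p - 2)) := by
  have h2 : (2 : k) ≠ 0 := two_ne_zero_of_three_lt (p := p) hp3
  obtain ⟨f, b, hf, -, hB⟩ := exists_isFaulhaber (K := K) (ρ := ρ) hp3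
  obtain ⟨ζ, z, hz, hζ, hz2, hζ0, hz0⟩ := exists_sq_eq_sub_one (K := K) (ρ := ρ) (p := p) hp3
  have hl := legendreSym_three_cases hp3
  set l : ℤ := legendreSym 3 p
  have hl' : (p % 3 = 1 ∧ (l : k) = 1) ∨ (p % 3 = 2 ∧ (l : k) = -1) := by
    rcases hl with ⟨h, e⟩ | ⟨h, e⟩ <;> simp [h, e]
  have hb := (finPolylog_two_eisenstein hp3 hz2 hf hl').2.1
  have h := sum_centralBinom_div_sq (k := k) (p := p) hp3 z
  rw [hb, show z * (1 - z) = 1 by linear_combination -hz2] at h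
  have hs : Red ρ (∑ i ∈ Ico 1 p, (i.centralBinom : K) * (1 / (i : K) ^ 2))
      (∑ i ∈ Ico 1 p, (i.centralBinom : k) * (1 / (i : k) ^ 2)) :=
    Red.sum fun i hi => (Red.natCast _).mul
      (Red.one_div_pow (mem_Ico.mp hi).1 (mem_Ico.mp hi).2 2)
  refine ratModEq_of_eq_add (n := 0) (w := ∑ i ∈ Ico 1 p, (i.centralBinom : K) * (1 / (i : K) ^ 2)
    - 1 / 2 * l * ((bernoulliThird (p - 2) : ℚ) : K)) ?_
    ((hs.sub (((Red.one.div (Red.ofNat 2) h2).mul (Red.intCast l)).mul hB)).congr rfl ?_)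
  · rw [Icc_one_sub_one hp.out.pos]
    push_cast
    simp only [mul_one_div]
    ring
  · simp only [one_pow, mul_one] at h
    simp only [mul_one_div, h]
    field_simp
    ring

end

/-! ### The congruences for t = -1: Fibonacci and Lucas numbers -/

section

theorem legendreSym_five_sq {p : ℕ} [hp : Fact p.Prime] (hp5 : 5 < p) :
    legendreSym 5 p ^ 2 = 1 := by
  refine legendreSym.sq_one _ ?_
  rw [Int.cast_natCast, Ne, CharP.cast_eq_zero_iff (ZMod 5) 5]
  intro h
  have := (Nat.prime_dvd_prime_iff_eq Nat.prime_five hp.out).mp h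
  omega

theorem inv_sq_of_sq_eq_add_one {F : Type*} [Field F] {φ : F} (hφ : φ ^ 2 = φ + 1) :
    (φ ^ 2)⁻¹ = (1 - φ) ^ 2 :=
  inv_eq_of_mul_eq_one_right (by linear_combination (φ ^ 2 - φ + 1) * hφ)

theorem ne_zero_of_sq_eq_add_one {F : Type*} [Field F] {φ : F} (hφ : φ ^ 2 = φ + 1) : φ ≠ 0 := by
  rintro rfl; simp at hφ

theorem two_mul_sub_one_ne_zero {F : Type*} [Field F] {φ : F} (hφ : φ ^ 2 = φ + 1)
    (h5 : (5 : F) ≠ 0) : 2 * φ - 1 ≠ 0 := fun h =>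
  h5 (by linear_combination (2 * φ - 1) * h - 4 * hφ)

theorem one_add_sq_ne_zero {F : Type*} [Field F] {φ : F} (hφ : φ ^ 2 = φ + 1)
    (h5 : (5 : F) ≠ 0) : 1 + φ ^ 2 ≠ 0 := fun h =>
  h5 (by linear_combination (3 - φ) * h + (φ - 2) * hφ)

variable {k : Type*} [Field k] {p : ℕ} [hp : Fact p.Prime] [CharP k p]
  {K : Type*} [Field K] [CharZero K] {V : ValuationSubring K} {ρ : V →+* k} [IsLocalHom ρ]

theorem five_ne_zero_of_five_lt (hp5 : 5 < p) : (5 : k) ≠ 0 := by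
  simpa using natCast_ne_zero_of_lt (k := k) (p := p) (i := 5) (by omega) hp5

/-- Frobenius acts on 2a - 1, a square root of 5, by Euler's criterion for 5 modulo p; quadratic
reciprocity exchanges the two entries of the symbol. -/
theorem two_mul_pow_prime_sub_one (hp5 : 5 < p) {a : k} (ha : a ^ 2 = a + 1) :
    2 * a ^ p - 1 = (legendreSym 5 p : k) * (2 * a - 1) := by
  obtain ⟨n, hn⟩ : ∃ n, p = 2 * n + 1 := hp.out.odd_of_ne_two (by omega)
  have h1 : legendreSym 5 p = legendreSym p 5 :=
    (legendreSym.quadratic_reciprocity_one_mod_four (p := 5) (q := p) (by norm_num)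
      (by omega)).symm
  have h2 := congrArg (ZMod.castHom dvd_rfl k) (legendreSym.eq_pow p 5)
  rw [map_pow, map_intCast, map_intCast, show p / 2 = n by omega] at h2
  rw [h1, h2]
  have h3 : (2 * a - 1) ^ p = 2 * a ^ p - 1 := by
    have h2p : (2 : k) ^ p = 2 := by
      have := map_natCast (frobenius k p) 2
      simpa [frobenius_def] using this
    rw [sub_pow_char (2 * a) 1, mul_pow, h2p, one_pow]
  rw [← h3, show (2 * a - 1) ^ p = ((2 * a - 1) ^ 2) ^ n * (2 * a - 1) by
    rw [← pow_mul, ← pow_succ, ← hn], show (2 * a - 1) ^ 2 = 5 by linear_combination 4 * ha]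
  push_cast
  rfl

theorem cast_genHarmonic (n d : ℕ) : ((genHarmonic n d : ℚ) : K) = harmonicSum K d n := by
  rw [harmonicSum_eq_sum_Ico, genHarmonic]
  push_cast
  rfl

theorem cast_lucasNumber_prime : (lucasNumber p : K) = 1 + p * ((lucasQuotient p : ℚ) : K) := by
  have hpK : (p : K) ≠ 0 := Nat.cast_ne_zero.mpr hp.out.ne_zero
  rw [lucasQuotient]
  push_cast
  rw [mul_div_cancel₀ _ hpK]
  ring

section Golden

variable (hp5 : 5 < p) {φ : K} {a : k} (h : Red ρ φ a) (hφ : φ ^ 2 = φ + 1) (ha : a ^ 2 = a + 1)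
include hp5 h hφ

theorem red_lucasQuotient : Red ρ ((lucasQuotient p : ℚ) : K) (-finPolylog p 1 a) := by
  have hq := prime_mul_lucasQuotient (p := p) hφ
  exact (Red.one_sub_pow_sub_pow_div (by omega) h
    (σ := -((lucasQuotient p : ℚ) : K)) (by linear_combination -hq)).neg.congr
    (neg_neg _).symm rfl

include ha

theorem red_sum_harmonicSum_div_golden :
    Red ρ (∑ i ∈ Ico 1 p, p * (-1) ^ i / (i.centralBinom : K) * (harmonicSum K 2 (i - 1))
      * (1 / (i : K))) (1 / 5 * legendreSym 5 p * finPolylog p 1 a ^ 2) := by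
  have hp3 : 3 < p := by omega
  have h5 : (5 : k) ≠ 0 := five_ne_zero_of_five_lt hp5
  rw [← golden_ratio_two hp3 ha h5 (two_mul_pow_prime_sub_one hp5 ha)]
  exact red_sum_harmonicSum_div hp3 (h.pow 2) (pow_ne_zero 2 (ne_zero_of_sq_eq_add_one ha))
    (one_add_sq_ne_zero ha h5)
    (by rw [inv_sq_of_sq_eq_add_one hφ]; linear_combination 2 * hφ)

theorem exists_sum_div_sq_golden {f : Polynomial k} {b : k} (hf : IsFaulhaber p f b) :
    ∃ Y, Red ρ Y (4 / 15 * (-finPolylog p 1 a ^ 3 / 2 + b)) ∧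
      ∑ i ∈ Ico 1 p, p * (-1) ^ i / (i.centralBinom : K) * (1 / (i : K) ^ 2) =
        (1 - (lucasNumber p : K) ^ 2) / (2 * p) + (p : K) ^ 2 * Y := by
  have hp3 : 3 < p := by omega
  have h5 : (5 : k) ≠ 0 := five_ne_zero_of_five_lt hp5
  rw [← finPolylog_three_golden hp3 ha h5 hf]
  obtain ⟨Y, hY, e⟩ := exists_sum_div_sq_eq hp3 (h.pow 2)
    (pow_ne_zero 2 (ne_zero_of_sq_eq_add_one ha)) (t := -1)
    (by rw [inv_sq_of_sq_eq_add_one hφ]; linear_combination 2 * hφ)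
  refine ⟨Y, hY, ?_⟩
  rw [e, inv_sq_of_sq_eq_add_one hφ, neg_one_pow_prime hp3, lucasNumber_eq hφ]
  have h1 : φ ^ p * (1 - φ) ^ p = -1 := by
    rw [← mul_pow, show φ * (1 - φ) = -1 by linear_combination -hφ, neg_one_pow_prime hp3]
  rw [show 2 - (φ ^ 2) ^ p - ((1 - φ) ^ 2) ^ p - -1 = 1 - (φ ^ p + (1 - φ) ^ p) ^ 2 by
    rw [← pow_mul, ← pow_mul, mul_comm 2 p, pow_mul, pow_mul]; linear_combination 2 * h1]

omit h ha in
-- For α = φ² the closed form is F_{2p}, and F_{2p} = L_p F_p by the difference of two squares.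
theorem lucasSum_neg_one : lucasSum (-1 : K) (p + 1) p = lucasNumber p * Nat.fib p := by
  have h1 := lucasSum_mul (pow_ne_zero 2 (ne_zero_of_sq_eq_add_one hφ)) (t := -1) (N := p + 1)
    (n := p) (by rw [inv_sq_of_sq_eq_add_one hφ]; linear_combination 2 * hφ) (by omega) (by omega)
  have h2 := two_mul_sub_one_ne_zero hφ (OfNat.ofNat_ne_zero 5)
  have h3 := fib_mul_eq hφ p
  refine mul_left_cancel₀ h2 ?_
  rw [inv_sq_of_sq_eq_add_one hφ] at h1
  rw [show 2 * φ - 1 = φ ^ 2 - (1 - φ) ^ 2 by ring, h1, lucasNumber_eq hφ, ← pow_mul, ← pow_mul,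
    mul_comm 2 p, pow_mul, pow_mul]
  linear_combination (-(φ ^ p + (1 - φ) ^ p)) * h3

theorem red_sum_harmonicSum_golden :
    Red ρ (∑ i ∈ Ico 1 p, p * (-1) ^ i / (i.centralBinom : K) * (harmonicSum K 2 (i - 1)))
      (-1 / 5 * finPolylog p 1 a + 2 / 25 * legendreSym 5 p * finPolylog p 1 a ^ 2) := by
  have hp3 : 3 < p := by omega
  have h2 : (2 : k) ≠ 0 := two_ne_zero_of_three_lt (p := p) hp3
  have h5 : (5 : k) ≠ 0 := five_ne_zero_of_five_lt hp5
  have hpK : (p : K) ≠ 0 := Nat.cast_ne_zero.mpr hp.out.ne_zero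
  obtain ⟨f, b, hf, -⟩ := exists_isFaulhaber (K := K) (ρ := ρ) hp3
  obtain ⟨Y, hY, e⟩ := exists_sum_div_sq_golden hp5 h hφ ha hf
  have hQ := red_lucasQuotient hp5 h hφ
  -- With L_p = 1 + pQ the main term (1 - L_p²)/(2p) is -Q(2 + pQ)/2, whose residue is that of -Q.
  have hD : Red ρ (∑ i ∈ Ico 1 p, p * (-1) ^ i / (i.centralBinom : K) * (1 / (i : K) ^ 2))
      (finPolylog p 1 a) := by
    refine ((((hQ.neg.mul ((Red.ofNat 2).add ((Red.prime p).mul hQ))).div (Red.ofNat 2) h2).add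
      (((Red.prime p).pow 2).mul hY))).congr ?_ ?_
    · rw [e, cast_lucasNumber_prime]
      field_simp
      ring
    · field_simp
      ring
  have h1 := (red_sum_harmonicSum hp3 Red.one.neg (red_sum_harmonicSum_div_golden hp5 h hφ ha)
    hD).div (Red.ofNat 5) h5
  refine h1.congr ?_ ?_
  · rw [show (4 : K) - -1 = 5 by norm_num]
    field_simp
  · rw [show (25 : k) = 5 * 5 by norm_num]
    field_simp
    ring

end Golden

variable [IsAlgClosed K] (hp5 : 5 < p)
include hp5

theorem ratModEq_sum_neg_one_pow_mul_genHarmonic_div (ρ : V →+* k) [IsLocalHom ρ] :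
    RatModEq p 1
      (p * ∑ k ∈ Icc 1 (p - 1), (-1 : ℚ) ^ k * genHarmonic (k - 1) 2 / (k * k.centralBinom))
      (1 / 5 * (legendreSym 5 p : ℚ) * lucasQuotient p ^ 2) := by
  have h5 : (5 : k) ≠ 0 := five_ne_zero_of_five_lt hp5
  obtain ⟨φ, a, h, hφ, ha⟩ := exists_sq_eq_add_one (ρ := ρ) (p := p) (by omega)
  have hQ := red_lucasQuotient hp5 h hφ
  refine ratModEq_of_eq_add (n := 0) (w := ∑ i ∈ Ico 1 p, p * (-1) ^ i / (i.centralBinom : K) *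
    (harmonicSum K 2 (i - 1)) * (1 / (i : K))
    - 1 / 5 * legendreSym 5 p * ((lucasQuotient p : ℚ) : K) ^ 2) ?_
    (((red_sum_harmonicSum_div_golden hp5 h hφ ha).sub
      (((Red.one.div (Red.ofNat 5) h5).mul (Red.intCast _)).mul (hQ.pow 2))).congr rfl (by ring))
  rw [Icc_one_sub_one hp.out.pos]
  push_cast
  simp only [cast_genHarmonic]
  rw [pow_zero, one_mul, add_sub_cancel, mul_sum]
  exact sum_congr rfl fun i _ => by ring

theorem ratModEq_sum_neg_one_pow_mul_genHarmonic_div_sq (ρ : V →+* k) [IsLocalHom ρ] :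
    RatModEq p 1
      (p * ∑ k ∈ Icc 1 (p - 1),
        (-1 : ℚ) ^ k * genHarmonic (k - 1) 2 / ((k : ℚ) ^ 2 * k.centralBinom))
      (4 / 15 * (1 / 2 * lucasQuotient p ^ 3 + bernoulli (p - 3))) := by
  have hp3 : 3 < p := by omega
  have h2 : (2 : k) ≠ 0 := two_ne_zero_of_three_lt (p := p) hp3
  have h3 : (3 : k) ≠ 0 := three_ne_zero_of_three_lt (p := p) hp3
  have h5 : (5 : k) ≠ 0 := five_ne_zero_of_five_lt hp5
  have h15 : (15 : k) ≠ 0 := by rw [show (15 : k) = 3 * 5 by norm_num]; exact mul_ne_zero h3 h5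
  obtain ⟨φ, a, h, hφ, ha⟩ := exists_sq_eq_add_one (ρ := ρ) (p := p) (by omega)
  obtain ⟨f, b, hf, hb, -⟩ := exists_isFaulhaber (K := K) (ρ := ρ) hp3
  have hQ := red_lucasQuotient hp5 h hφ
  have hm := red_sum_harmonicSum_div_sq hp3 (h.pow 2)
    (pow_ne_zero 2 (ne_zero_of_sq_eq_add_one ha)) (t := -1)
    (by rw [inv_sq_of_sq_eq_add_one hφ]; linear_combination 2 * hφ)
  rw [finPolylog_three_golden hp3 ha h5 hf] at hm
  refine ratModEq_of_eq_add (n := 0) (w := ∑ i ∈ Ico 1 p, p * (-1) ^ i / (i.centralBinom : K) *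
    (harmonicSum K 2 (i - 1)) * (1 / (i : K) ^ 2)
    - 4 / 15 * (1 / 2 * ((lucasQuotient p : ℚ) : K) ^ 3 + ((bernoulli (p - 3) : ℚ) : K))) ?_
    ((hm.sub (((Red.ofNat 4).div (Red.ofNat 15) h15).mul
      (((Red.one.div (Red.ofNat 2) h2).mul (hQ.pow 3)).add hb))).congr rfl (by ring))
  rw [Icc_one_sub_one hp.out.pos]
  push_cast
  simp only [cast_genHarmonic]
  rw [pow_zero, one_mul, add_sub_cancel, mul_sum]
  exact sum_congr rfl fun i _ => by ring

theorem ratModEq_sum_neg_one_pow_mul_genHarmonic (ρ : V →+* k) [IsLocalHom ρ] :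
    RatModEq p 1
      (p * ∑ k ∈ Icc 1 (p - 1), (-1 : ℚ) ^ k * genHarmonic (k - 1) 2 / k.centralBinom)
      (1 / 5 * lucasQuotient p + 2 / 25 * (legendreSym 5 p : ℚ) * lucasQuotient p ^ 2) := by
  have h5 : (5 : k) ≠ 0 := five_ne_zero_of_five_lt hp5
  have h25 : (25 : k) ≠ 0 := by rw [show (25 : k) = 5 * 5 by norm_num]; exact mul_ne_zero h5 h5
  obtain ⟨φ, a, h, hφ, ha⟩ := exists_sq_eq_add_one (ρ := ρ) (p := p) (by omega)
  have hQ := red_lucasQuotient hp5 h hφ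
  refine ratModEq_of_eq_add (n := 0) (w := ∑ i ∈ Ico 1 p, p * (-1) ^ i / (i.centralBinom : K) *
    (harmonicSum K 2 (i - 1))
    - (1 / 5 * ((lucasQuotient p : ℚ) : K)
      + 2 / 25 * legendreSym 5 p * ((lucasQuotient p : ℚ) : K) ^ 2)) ?_
    (((red_sum_harmonicSum_golden hp5 h hφ ha).sub
      (((Red.one.div (Red.ofNat 5) h5).mul hQ).add
      ((((Red.ofNat 2).div (Red.ofNat 25) h25).mul (Red.intCast _)).mul (hQ.pow 2)))).congr
      rfl (by ring))
  rw [Icc_one_sub_one hp.out.pos]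
  push_cast
  simp only [cast_genHarmonic]
  rw [pow_zero, one_mul, add_sub_cancel, mul_sum]
  exact sum_congr rfl fun i _ => by ring

theorem ratModEq_sum_neg_one_pow_div (ρ : V →+* k) [IsLocalHom ρ] :
    RatModEq p 3
      (p * ∑ k ∈ Icc 1 (p - 1), (-1 : ℚ) ^ k / (k * k.centralBinom))
      ((1 - (lucasNumber p : ℚ) * Nat.fib p) / 2
        + (p : ℚ) ^ 2 / 5 * (legendreSym 5 p : ℚ) * lucasQuotient p ^ 2) := by
  have hp3 : 3 < p := by omega
  have h5 : (5 : k) ≠ 0 := five_ne_zero_of_five_lt hp5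
  obtain ⟨φ, a, h, hφ, ha⟩ := exists_sq_eq_add_one (ρ := ρ) (p := p) (by omega)
  have hQ := red_lucasQuotient hp5 h hφ
  obtain ⟨Y, hY, e⟩ := exists_sum_div_eq hp3 Red.one.neg
    (red_sum_harmonicSum_div_golden hp5 h hφ ha)
  rw [lucasSum_neg_one hp5 hφ, neg_one_pow_prime hp3] at e
  refine ratModEq_of_eq_add
    (w := Y - 1 / 5 * legendreSym 5 p * ((lucasQuotient p : ℚ) : K) ^ 2) ?_
    ((hY.sub (((Red.one.div (Red.ofNat 5) h5).mul (Red.intCast _)).mul (hQ.pow 2))).congr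
      rfl (by ring))
  have h1 := prime_mul_sum_pow_div_eq (K := K) hp3 (-1) 1
  simp only [pow_one] at h1
  rw [Icc_one_sub_one hp.out.pos]
  push_cast
  rw [h1, e]
  ring

theorem ratModEq_sum_neg_one_pow_div_sq (ρ : V →+* k) [IsLocalHom ρ] :
    RatModEq p 3
      (p * ∑ k ∈ Icc 1 (p - 1), (-1 : ℚ) ^ k / ((k : ℚ) ^ 2 * k.centralBinom))
      ((1 - (lucasNumber p : ℚ) ^ 2) / (2 * p)
        + 4 * (p : ℚ) ^ 2 / 15 * (1 / 2 * lucasQuotient p ^ 3 + bernoulli (p - 3))) := by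
  have hp3 : 3 < p := by omega
  have h2 : (2 : k) ≠ 0 := two_ne_zero_of_three_lt (p := p) hp3
  have h3 : (3 : k) ≠ 0 := three_ne_zero_of_three_lt (p := p) hp3
  have h5 : (5 : k) ≠ 0 := five_ne_zero_of_five_lt hp5
  have h15 : (15 : k) ≠ 0 := by rw [show (15 : k) = 3 * 5 by norm_num]; exact mul_ne_zero h3 h5
  obtain ⟨φ, a, h, hφ, ha⟩ := exists_sq_eq_add_one (ρ := ρ) (p := p) (by omega)
  obtain ⟨f, b, hf, hb, -⟩ := exists_isFaulhaber (K := K) (ρ := ρ) hp3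
  have hQ := red_lucasQuotient hp5 h hφ
  obtain ⟨Y, hY, e⟩ := exists_sum_div_sq_golden hp5 h hφ ha hf
  refine ratModEq_of_eq_add (w := Y
    - 4 / 15 * (1 / 2 * ((lucasQuotient p : ℚ) : K) ^ 3 + ((bernoulli (p - 3) : ℚ) : K))) ?_
    ((hY.sub (((Red.ofNat 4).div (Red.ofNat 15) h15).mul
      (((Red.one.div (Red.ofNat 2) h2).mul (hQ.pow 3)).add hb))).congr rfl (by ring))
  rw [Icc_one_sub_one hp.out.pos]
  push_cast
  rw [prime_mul_sum_pow_div_eq hp3, e]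
  ring

theorem ratModEq_sum_neg_one_pow_div_centralBinom (ρ : V →+* k) [IsLocalHom ρ] :
    RatModEq p 3
      (p * ∑ k ∈ Icc 1 (p - 1), (-1 : ℚ) ^ k / k.centralBinom)
      ((p - (lucasNumber p : ℚ) * Nat.fib p) / 5
        + 2 * (p : ℚ) ^ 2 / 25 * (legendreSym 5 p : ℚ) * lucasQuotient p ^ 2) := by
  have hp3 : 3 < p := by omega
  have h2 : (2 : k) ≠ 0 := two_ne_zero_of_three_lt (p := p) hp3
  have h5 : (5 : k) ≠ 0 := five_ne_zero_of_five_lt hp5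
  have h25 : (25 : k) ≠ 0 := by rw [show (25 : k) = 5 * 5 by norm_num]; exact mul_ne_zero h5 h5
  have h10 : (10 : k) ≠ 0 := by rw [show (10 : k) = 2 * 5 by norm_num]; exact mul_ne_zero h2 h5
  obtain ⟨φ, a, h, hφ, ha⟩ := exists_sq_eq_add_one (ρ := ρ) (p := p) (by omega)
  have hQ := red_lucasQuotient hp5 h hφ
  obtain ⟨Y, hY, e⟩ := exists_sum_eq hp3 (h.pow 2)
    (pow_ne_zero 2 (ne_zero_of_sq_eq_add_one ha)) (t := -1)
    (by rw [inv_sq_of_sq_eq_add_one hφ]; linear_combination 2 * hφ)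
    (red_sum_harmonicSum_golden hp5 h hφ ha)
  have h1 : φ ^ p * (1 - φ) ^ p = -1 := by
    rw [← mul_pow, show φ * (1 - φ) = -1 by linear_combination -hφ, neg_one_pow_prime hp3]
  rw [lucasSum_neg_one hp5 hφ, neg_one_pow_prime hp3, inv_sq_of_sq_eq_add_one hφ,
    show 2 - (φ ^ 2) ^ p - ((1 - φ) ^ 2) ^ p = -(φ ^ p + (1 - φ) ^ p) ^ 2 by
    rw [← pow_mul, ← pow_mul, mul_comm 2 p, pow_mul, pow_mul]; linear_combination 2 * h1,
    ← lucasNumber_eq hφ] at e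
  have hL := cast_lucasNumber_prime (p := p) (K := K)
  -- As L_p² = 1 + pQ(2 + pQ), the contribution p(1 - L_p²)/10 is p² times -Q(2 + pQ)/10; its
  -- residue cancels the linear term Q/5 of Y.
  refine ratModEq_of_eq_add
    (w := Y - 2 / 25 * legendreSym 5 p * ((lucasQuotient p : ℚ) : K) ^ 2
      - ((lucasQuotient p : ℚ) : K) * (2 + p * ((lucasQuotient p : ℚ) : K)) / 10) ?_
    (((hY.sub ((((Red.ofNat 2).div (Red.ofNat 25) h25).mul (Red.intCast _)).mul (hQ.pow 2))).sub
      ((hQ.mul ((Red.ofNat 2).add ((Red.prime p).mul hQ))).div (Red.ofNat 10) h10)).congr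
      rfl ?_)
  · have h1 := prime_mul_sum_pow_div_eq (K := K) hp3 (-1) 0
    simp only [pow_zero, div_one, mul_one, one_mul] at h1
    rw [Icc_one_sub_one hp.out.pos]
    push_cast
    rw [h1]
    refine mul_left_cancel₀ (OfNat.ofNat_ne_zero 5 : (5 : K) ≠ 0) ?_
    rw [show (4 : K) - -1 = 5 by norm_num] at e
    rw [e]
    field_simp
    generalize (lucasNumber p : K) = L at *
    rw [hL]
    ring
  · rw [show (10 : k) = 2 * 5 by norm_num, show (25 : k) = 5 * 5 by norm_num]
    field_simp
    ring

end

/-! ### The congruences with Fibonacci and Lucas numbers of index 3k - (p/5) -/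

section

/-- The factor φ^(-l) is φ for l = -1 and φ⁻¹ = φ - 1 for l = 1, hence φ - m in both cases. As i ≥ 1
the exponent 3i - l is at least 2, so `toNat` is harmless. -/
theorem pow_three_mul_sub_toNat {R : Type*} [CommRing R] {φ : R} (hφ : φ ^ 2 = φ + 1) {m : ℕ}
    {l : ℤ} (hl : (m = 0 ∧ l = -1) ∨ (m = 1 ∧ l = 1)) {i : ℕ} (hi : 1 ≤ i) :
    φ ^ (3 * (i : ℤ) - l).toNat = φ ^ (3 * i) * (φ - m) := by
  rcases hl with ⟨rfl, rfl⟩ | ⟨rfl, rfl⟩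
  · rw [show (3 * (i : ℤ) - -1).toNat = 3 * i + 1 by omega, pow_succ]
    simp
  · obtain ⟨j, hj⟩ : ∃ j, 3 * i = j + 1 := ⟨3 * i - 1, by omega⟩
    rw [show (3 * (i : ℤ) - 1).toNat = j by omega, hj, pow_succ]
    push_cast
    linear_combination (-φ ^ j) * hφ

variable {k : Type*} [Field k] {p : ℕ} [hp : Fact p.Prime] [CharP k p]
  {K : Type*} [Field K] [CharZero K] {V : ValuationSubring K} {ρ : V →+* k} [IsLocalHom ρ]

theorem exists_legendreSym_five_eq (hp5 : 5 < p) :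
    ∃ m : ℕ, (m = 0 ∧ legendreSym 5 p = -1) ∨ (m = 1 ∧ legendreSym 5 p = 1) := by
  rcases mul_self_eq_one_iff.mp ((pow_two _).symm.trans (legendreSym_five_sq hp5)) with h | h
  · exact ⟨1, Or.inr ⟨rfl, h⟩⟩
  · exact ⟨0, Or.inl ⟨rfl, h⟩⟩

section Golden

variable (hp5 : 5 < p) {φ : K} {a : k} (h : Red ρ φ a) (hφ : φ ^ 2 = φ + 1) (ha : a ^ 2 = a + 1)
include hp5

include hφ in
/-- The sum `∑ binom(2i, i) (-φ ^ 3) ^ i / i` modulo `p ^ 2`. -/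
theorem exists_sum_centralBinom_mul_neg_cube_pow_div (ρ : V →+* k) [IsLocalHom ρ]
    (hV : φ ∈ V) :
    ∃ z ∈ V, ∑ i ∈ Ico 1 p, (i.centralBinom : K) * ((-1) ^ i * φ ^ (3 * i)) / (i : K) =
      -2 * ((lucasQuotient p : ℚ) : K) * φ ^ p + p * ((lucasQuotient p : ℚ) : K) ^ 2 * (φ ^ p) ^ 2
        + (p : K) ^ 2 * z := by
  have hp3 : 3 < p := by omega
  have h1 : φ ^ p * (1 - φ) ^ p = -1 := by
    rw [← mul_pow, show φ * (1 - φ) = -1 by linear_combination -hφ, neg_one_pow_prime hp3]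
  have hq := prime_mul_lucasQuotient (p := p) hφ
  have hx : 1 - φ ^ 2 = -φ := by linear_combination -hφ
  -- At x = φ² one has 1 - x = -φ and x(1-x) = -φ³. The relation φ^p (1-φ)^p = -1 turns 1 - φ^(2p) +
  -- φ^p into -pQ φ^p.
  obtain ⟨z, hz, e⟩ := exists_sum_centralBinom_div_eq ρ hp3 (x := φ ^ 2)
    (σ := -(((lucasQuotient p : ℚ) : K) * φ ^ p)) (by rw [pow_two]; exact V.mul_mem _ _ hV hV) (by
      rw [hx, neg_pow, neg_one_pow_prime hp3, ← pow_mul, mul_comm 2 p, pow_mul]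
      linear_combination (-φ ^ p) * hq - h1)
  refine ⟨z, hz, ?_⟩
  rw [hx] at e
  rw [sum_congr rfl fun (i : ℕ) _ => show (i.centralBinom : K) * ((-1) ^ i * φ ^ (3 * i)) / (i : K)
    = (i.centralBinom : K) * (φ ^ 2 * -φ) ^ i / (i : K) by
      rw [pow_mul, ← mul_pow, show φ ^ 2 * -φ = -1 * φ ^ 3 by ring], e]
  ring

omit [IsLocalHom ρ] in
include ha in
theorem sum_centralBinom_mul_neg_cube_pow_div_sq :
    ∑ i ∈ Ico 1 p, (i.centralBinom : k) * ((-1) ^ i * a ^ (3 * i)) / (i : k) ^ 2 =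
      -(3 / 5) * (a ^ p + 2) * finPolylog p 1 a ^ 2 := by
  have hp3 : 3 < p := by omega
  have h2 : (2 : k) ≠ 0 := two_ne_zero_of_three_lt (p := p) hp3
  have h5 : (5 : k) ≠ 0 := five_ne_zero_of_five_lt hp5
  have e := sum_centralBinom_div_sq hp3 (a ^ 2)
  obtain ⟨e1, e2⟩ := finPolylog_two_golden hp3 ha h5
  rw [show 1 - a ^ 2 = -a by linear_combination -ha, e1, e2] at e
  rw [sum_congr rfl fun (i : ℕ) _ => show (i.centralBinom : k) * ((-1) ^ i * a ^ (3 * i)) /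
    (i : k) ^ 2 = (i.centralBinom : k) * (a ^ 2 * -a) ^ i / (i : k) ^ 2 by
      rw [pow_mul, ← mul_pow, show a ^ 2 * -a = -1 * a ^ 3 by ring], e,
    show (10 : k) = 2 * 5 by norm_num]
  field_simp
  ring

end Golden

variable [IsAlgClosed K] (hp5 : 5 < p)
include hp5

theorem ratModEq_sum_centralBinom_mul_fib (ρ : V →+* k) [IsLocalHom ρ] :
    RatModEq p 2
      (∑ k ∈ Icc 1 (p - 1), (k.centralBinom : ℚ) *
        ((-1 : ℚ) ^ k * Nat.fib (3 * (k : ℤ) - legendreSym 5 p).toNat / k))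
      (1 / 5 * p * lucasQuotient p ^ 2) := by
  have hp3 : 3 < p := by omega
  have h2 : (2 : k) ≠ 0 := two_ne_zero_of_three_lt (p := p) hp3
  have h5 : (5 : k) ≠ 0 := five_ne_zero_of_five_lt hp5
  obtain ⟨φ, a, h, hφ, ha⟩ := exists_sq_eq_add_one (ρ := ρ) (p := p) hp3
  have hψ : (1 - φ) ^ 2 = (1 - φ) + 1 := by linear_combination hφ
  have hQ := red_lucasQuotient hp5 h hφ
  have hs := two_mul_sub_one_ne_zero hφ (OfNat.ofNat_ne_zero 5)
  have hsk := two_mul_sub_one_ne_zero ha h5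
  have hU := golden_pow_prime hp3 ha
  have hl := two_mul_pow_prime_sub_one hp5 ha
  obtain ⟨m, hm⟩ := exists_legendreSym_five_eq hp5
  have hlm : legendreSym 5 p = 2 * m - 1 := by
    rcases hm with ⟨rfl, e⟩ | ⟨rfl, e⟩ <;> rw [e] <;> norm_num
  have hl2 := legendreSym_five_sq hp5
  set l : ℤ := legendreSym 5 p
  have hlK : (l : K) = 2 * m - 1 := by rw [hlm]; push_cast; ring
  have hlk : (l : k) = 2 * m - 1 := by rw [hlm]; push_cast; ring
  have hl2K : (l : K) ^ 2 = 1 := by exact_mod_cast congrArg (Int.cast (R := K)) hl2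
  have hl2k : (l : k) ^ 2 = 1 := by exact_mod_cast congrArg (Int.cast (R := k)) hl2
  obtain ⟨z, hz, e1⟩ := exists_sum_centralBinom_mul_neg_cube_pow_div hp5 hφ ρ h.mem
  obtain ⟨z', hz', e2⟩ := exists_sum_centralBinom_mul_neg_cube_pow_div hp5 hψ ρ
    (V.toSubring.sub_mem V.one_mem h.mem)
  obtain ⟨y, hy⟩ := Red.of_mem (ρ := ρ) hz
  obtain ⟨y', hy'⟩ := Red.of_mem (ρ := ρ) hz'
  have hF := fib_mul_eq hφ p
  have hL := lucasNumber_eq hφ p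
  have hLQ := cast_lucasNumber_prime (p := p) (K := K)
  have hV : (1 - a) ^ p = 1 - a ^ p := by rw [sub_pow_char (1 : k) a, one_pow]
  have hLk : Red ρ (lucasNumber p : K) 1 := (Red.natCast _).congr rfl (by
    rw [lucasNumber_eq ha, hV]; ring)
  have hFk : Red ρ (Nat.fib p : K) (l : k) := (Red.natCast _).congr rfl (by
    refine mul_right_cancel₀ hsk ?_
    rw [fib_mul_eq ha, hV, ← hl]; ring)
  have huk := h.pow p
  have hvk := (Red.one.sub h).pow p
  rw [hV] at hvk
  have h1 : φ ^ p * (1 - φ) ^ p = -1 := by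
    rw [← mul_pow, show φ * (1 - φ) = -1 by linear_combination -hφ, neg_one_pow_prime hp3]
  have hS : ∑ i ∈ Ico 1 p, (i.centralBinom : K) *
      ((-1) ^ i * (Nat.fib (3 * (i : ℤ) - l).toNat : K) / (i : K)) * (2 * φ - 1) =
      (∑ i ∈ Ico 1 p, (i.centralBinom : K) * ((-1) ^ i * φ ^ (3 * i)) / (i : K)) * (φ - m) -
      (∑ i ∈ Ico 1 p, (i.centralBinom : K) * ((-1) ^ i * (1 - φ) ^ (3 * i)) / (i : K))
        * (1 - φ - m) := by
    rw [sum_mul, sum_mul, ← sum_sub_distrib]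
    refine sum_congr rfl fun i hi => ?_
    have hf := fib_mul_eq hφ (3 * (i : ℤ) - l).toNat
    rw [pow_three_mul_sub_toNat hφ hm (mem_Ico.mp hi).1,
      pow_three_mul_sub_toNat hψ hm (mem_Ico.mp hi).1] at hf
    linear_combination (i.centralBinom * (-1) ^ i / (i : K)) * hf
  rw [e1, e2] at hS
  generalize φ ^ p = u at *
  generalize (1 - φ) ^ p = v at *
  generalize (lucasNumber p : K) = L at *
  generalize (Nat.fib p : K) = F at *
  generalize hQQ : ((lucasQuotient p : ℚ) : K) = Q at *
  have hLF : Red ρ (L + l * F) 2 := (hLk.add ((Red.intCast l).mul hFk)).congr rfl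
    (by linear_combination -hl2k)
  have hLF0 : L + l * F ≠ 0 := fun h0 => h2 (hLF.unique (h0 ▸ Red.zero))
  -- The leading term is proportional to L_p - l F_p, which must be divisible by p. Since 5F_p² =
  -- L_p² + 4 and l² = 1, (L_p - l F_p)(L_p + l F_p) = 4(L_p² - 1)/5 = 4pQ(L_p + 1)/5, and L_p + l
  -- F_p is a unit with residue 2.
  obtain ⟨d, hd⟩ : ∃ d, d = 4 * (Q * (L + 1)) / 5 / (L + l * F) := ⟨_, rfl⟩
  have hdk : Red ρ d (-4 * finPolylog p 1 a / 5) := by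
    refine (((((Red.ofNat 4).mul (hQ.mul (hLk.add Red.one))).div (Red.ofNat 5) h5).div
      hLF h2)).congr hd ?_
    field_simp
    ring
  have hpd : L - l * F = p * d := by
    refine mul_right_cancel₀ hLF0 ?_
    have hF2 : 5 * F ^ 2 = L ^ 2 + 4 := by
      rw [hL]
      linear_combination (F * (2 * φ - 1) + (u - v)) * hF - 4 * h1 - 4 * F ^ 2 * hφ
    rw [hd, mul_assoc, div_mul_cancel₀ _ hLF0]
    refine mul_left_cancel₀ (OfNat.ofNat_ne_zero 5 : (5 : K) ≠ 0) ?_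
    field_simp
    linear_combination (-5 * F ^ 2) * hl2K - hF2 + 4 * (L + 1) * hLQ
  have hcu : (φ - m) * u - (1 - φ - m) * v = (2 * φ - 1) * (p * d) / 2 := by
    rw [← hpd]
    field_simp
    linear_combination l * hF - (2 * φ - 1) * hL + (u - v) * hlK
  -- The residues are multiples of Q² with coefficients -4/5, 1 and -1/5, which add up to 0.
  have hw : Red ρ (-Q * d + (Q ^ 2 * ((φ - m) * u ^ 2 - (1 - φ - m) * v ^ 2)
      + p * ((φ - m) * z - (1 - φ - m) * z')) / (2 * φ - 1) - 1 / 5 * Q ^ 2) 0 := by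
    have hc := h.sub (Red.natCast m)
    have hc' := (Red.one.sub h).sub (Red.natCast m)
    refine (((hQ.neg.mul hdk).add ((((hQ.pow 2).mul ((hc.mul (huk.pow 2)).sub
      (hc'.mul (hvk.pow 2)))).add ((Red.prime p).mul ((hc.mul hy).sub (hc'.mul hy')))).div
      (((Red.ofNat 2).mul h).sub Red.one) hsk)).sub
      ((Red.one.div (Red.ofNat 5) h5).mul (hQ.pow 2))).congr rfl ?_
    generalize a ^ p = U at *
    have hG : (a - m) * U ^ 2 - (1 - a - m) * (1 - U) ^ 2 = 2 * a - 1 := by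
      refine mul_left_cancel₀ h2 ?_
      linear_combination
        (2 * (2 * a - 1)) * hU - l * hl + 2 * U * hlk - (2 * a - 1) * hl2k - hlk
    rw [hG, zero_mul, add_zero, mul_div_cancel_right₀ _ hsk]
    field_simp
    ring
  refine ratModEq_of_eq_add (n := 1) ?_ hw
  rw [Icc_one_sub_one hp.out.pos]
  push_cast
  refine mul_right_cancel₀ hs ?_
  have hD := div_mul_cancel₀ (Q ^ 2 * ((φ - m) * u ^ 2 - (1 - φ - m) * v ^ 2)
      + p * ((φ - m) * z - (1 - φ - m) * z')) hs
  rw [sum_mul, hS, hQQ]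
  linear_combination (-2 * Q) * hcu - p * hD

theorem ratModEq_sum_centralBinom_mul_lucasNumber (ρ : V →+* k) [IsLocalHom ρ] :
    RatModEq p 1
      (∑ k ∈ Icc 1 (p - 1), (k.centralBinom : ℚ) *
        ((-1 : ℚ) ^ k * lucasNumber (3 * (k : ℤ) - legendreSym 5 p).toNat / (k : ℚ) ^ 2))
      0 := by
  have hp3 : 3 < p := by omega
  have h2 : (2 : k) ≠ 0 := two_ne_zero_of_three_lt (p := p) hp3
  have h5 : (5 : k) ≠ 0 := five_ne_zero_of_five_lt hp5
  obtain ⟨φ, a, h, hφ, ha⟩ := exists_sq_eq_add_one (K := K) (ρ := ρ) (p := p) hp3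
  have ha' : (1 - a) ^ 2 = (1 - a) + 1 := by linear_combination ha
  have hl := two_mul_pow_prime_sub_one hp5 ha
  obtain ⟨m, hm⟩ := exists_legendreSym_five_eq hp5
  have hlm : legendreSym 5 p = 2 * m - 1 := by
    rcases hm with ⟨rfl, e⟩ | ⟨rfl, e⟩ <;> rw [e] <;> norm_num
  set l : ℤ := legendreSym 5 p
  have hlk : (l : k) = 2 * m - 1 := by rw [hlm]; push_cast; ring
  have e1 := sum_centralBinom_mul_neg_cube_pow_div_sq hp5 ha
  have e2 := sum_centralBinom_mul_neg_cube_pow_div_sq hp5 ha'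
  rw [finPolylog_one_one_sub hp3, sub_pow_char (1 : k) a, one_pow] at e2
  have hk : ∑ i ∈ Ico 1 p, (i.centralBinom : k) *
      ((-1) ^ i * (lucasNumber (3 * (i : ℤ) - l).toNat : k) * (1 / (i : k) ^ 2)) = 0 := by
    have : ∑ i ∈ Ico 1 p, (i.centralBinom : k) *
        ((-1) ^ i * (lucasNumber (3 * (i : ℤ) - l).toNat : k) * (1 / (i : k) ^ 2)) =
        (∑ i ∈ Ico 1 p, (i.centralBinom : k) * ((-1) ^ i * a ^ (3 * i)) / (i : k) ^ 2) * (a - m) +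
        (∑ i ∈ Ico 1 p, (i.centralBinom : k) * ((-1) ^ i * (1 - a) ^ (3 * i)) / (i : k) ^ 2)
          * (1 - a - m) := by
      rw [sum_mul, sum_mul, ← sum_add_distrib]
      refine sum_congr rfl fun i hi => ?_
      rw [lucasNumber_eq ha, pow_three_mul_sub_toNat ha hm (mem_Ico.mp hi).1,
        pow_three_mul_sub_toNat ha' hm (mem_Ico.mp hi).1]
      ring
    rw [this, e1, e2]
    generalize a ^ p = U at *
    -- The shift by (p/5) in the index is exactly what makes the two conjugate contributions cancel.
    have hG : (U + 2) * (a - m) + (1 - U + 2) * (1 - a - m) = 0 := by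
      refine mul_left_cancel₀ h2 ?_
      linear_combination (2 * a - 1) * hl + (4 * l) * ha + 5 * hlk
    linear_combination (-(3 / 5) * finPolylog p 1 a ^ 2) * hG
  refine ratModEq_of_eq_add (n := 0) ?_ ((Red.sum fun i hi => (Red.natCast (ρ := ρ) i.centralBinom).mul
    ((Red.one.neg.pow i).mul (Red.natCast _) |>.mul
      (Red.one_div_pow (mem_Ico.mp hi).1 (mem_Ico.mp hi).2 2))).congr rfl hk.symm)
  rw [Icc_one_sub_one hp.out.pos]
  push_cast
  simp only [mul_one_div]
  ring

end

/-! ### The algebraic closure of ℚ_p and the final assembly -/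

/-- The valuation ring of the algebraic closure of `ℚ_[p]`. -/
noncomputable abbrev padicAlgInt (p : ℕ) [Fact p.Prime] : ValuationSubring (PadicAlgCl p) :=
  (PadicAlgCl.valued p).v.valuationSubring

/-- The valuation of p is 1/p < 1, so p is not a unit and lies in the maximal ideal. -/
instance charP_residueField_padicAlgInt (p : ℕ) [hp : Fact p.Prime] :
    CharP (IsLocalRing.ResidueField (padicAlgInt p)) p := by
  refine (CharP.charP_iff_prime_eq_zero hp.out).mpr ?_
  rw [← map_natCast (IsLocalRing.residue (padicAlgInt p)), IsLocalRing.residue_eq_zero_iff,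
    IsLocalRing.mem_maximalIdeal, mem_nonunits_iff]
  intro hu
  obtain ⟨y, hy⟩ := hu.exists_right_inv
  have h1 : Valued.v (p : PadicAlgCl p) * Valued.v (y : PadicAlgCl p) = 1 := by
    rw [← map_mul, ← map_one (PadicAlgCl.valued p).v]
    congr 1
    simpa using congrArg Subtype.val hy
  have h2 : Valued.v (y : PadicAlgCl p) ≤ 1 := y.2
  have h3 : Valued.v (p : PadicAlgCl p) < 1 := by
    rw [PadicAlgCl.valuation_p, one_div]
    exact inv_lt_one_of_one_lt₀ (by exact_mod_cast hp.out.one_lt)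
  exact absurd h1 (mul_lt_one_of_lt_of_le h3 h2).ne

theorem mainTheorem8 (p : ℕ) [Fact p.Prime] (hp : 3 < p) :
    -- `t = 2` and `t = 4`, central binomial coefficients in the denominators
    RatModEq p 3
      (p * ∑ k ∈ Icc 1 (p - 1), (2 : ℚ) ^ k / (k * k.centralBinom))
      ((legendreSym p (-1) : ℚ) - 1 - p * fermatQuotient p 2
        + (p : ℚ) ^ 2 * eulerNumber (p - 3)) ∧
    RatModEq p 3
      (p * ∑ k ∈ Icc 1 (p - 1), (2 : ℚ) ^ k / ((k : ℚ) ^ 2 * k.centralBinom))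
      (-fermatQuotient p 2 + (p : ℚ) ^ 2 / 16 * bernoulli (p - 3)) ∧
    RatModEq p 3
      (p * ∑ k ∈ Icc 1 (p - 1), (4 : ℚ) ^ k / ((k : ℚ) ^ 2 * k.centralBinom))
      (-4 * fermatQuotient p 2 - 2 * p * fermatQuotient p 2 ^ 2
        + (p : ℚ) ^ 2 * bernoulli (p - 3)) ∧
    RatModEq p 2
      (p * ∑ k ∈ Icc 1 (p - 1), (4 : ℚ) ^ k / ((k : ℚ) ^ 3 * k.centralBinom))
      (-4 * fermatQuotient p 2 ^ 2
        + p * (4 / 3 * fermatQuotient p 2 ^ 3 - 1 / 6 * bernoulli (p - 3))) ∧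
    RatModEq p 1
      (p * ∑ k ∈ Icc 1 (p - 1), (4 : ℚ) ^ k / ((k : ℚ) ^ 4 * k.centralBinom))
      (-(4 / 3) * (2 * fermatQuotient p 2 ^ 3 + bernoulli (p - 3))) ∧
    -- central binomial coefficients in the numerators
    RatModEq p 3
      (∑ k ∈ range p, (k.centralBinom : ℚ))
      ((legendreSym 3 p : ℚ) - (p : ℚ) ^ 2 / 3 * bernoulliThird (p - 2)) ∧
    RatModEq p 3
      (∑ k ∈ range p, (k.centralBinom : ℚ) / 3 ^ k)
      ((legendreSym 3 p : ℚ) - 2 * (p : ℚ) ^ 2 / 9 * bernoulliThird (p - 2)) ∧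
    RatModEq p 3
      (∑ k ∈ Icc 1 (p - 1), (-2 : ℚ) ^ k * k.centralBinom)
      (-(4 * p / 3) * fermatQuotient p 2) ∧
    RatModEq p 2
      (∑ k ∈ Icc 1 (p - 1), (-1 : ℚ) ^ k / k * k.centralBinom)
      (-2 * lucasQuotient p + p * lucasQuotient p ^ 2) ∧
    RatModEq p 1
      (∑ k ∈ Icc 1 (p - 1), (k.centralBinom : ℚ) / (k : ℚ) ^ 2)
      (1 / 2 * (legendreSym 3 p : ℚ) * bernoulliThird (p - 2)) ∧
    (5 < p →
      -- `t = -1`, central binomial coefficients in the denominators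
      RatModEq p 1
        (p * ∑ k ∈ Icc 1 (p - 1),
          (-1 : ℚ) ^ k * genHarmonic (k - 1) 2 / (k * k.centralBinom))
        (1 / 5 * (legendreSym 5 p : ℚ) * lucasQuotient p ^ 2) ∧
      RatModEq p 1
        (p * ∑ k ∈ Icc 1 (p - 1),
          (-1 : ℚ) ^ k * genHarmonic (k - 1) 2 / ((k : ℚ) ^ 2 * k.centralBinom))
        (4 / 15 * (1 / 2 * lucasQuotient p ^ 3 + bernoulli (p - 3))) ∧
      RatModEq p 1
        (p * ∑ k ∈ Icc 1 (p - 1),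
          (-1 : ℚ) ^ k * genHarmonic (k - 1) 2 / k.centralBinom)
        (1 / 5 * lucasQuotient p
          + 2 / 25 * (legendreSym 5 p : ℚ) * lucasQuotient p ^ 2) ∧
      RatModEq p 3
        (p * ∑ k ∈ Icc 1 (p - 1), (-1 : ℚ) ^ k / (k * k.centralBinom))
        ((1 - (lucasNumber p : ℚ) * Nat.fib p) / 2
          + (p : ℚ) ^ 2 / 5 * (legendreSym 5 p : ℚ) * lucasQuotient p ^ 2) ∧
      RatModEq p 3
        (p * ∑ k ∈ Icc 1 (p - 1), (-1 : ℚ) ^ k / ((k : ℚ) ^ 2 * k.centralBinom))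
        ((1 - (lucasNumber p : ℚ) ^ 2) / (2 * p)
          + 4 * (p : ℚ) ^ 2 / 15 * (1 / 2 * lucasQuotient p ^ 3 + bernoulli (p - 3))) ∧
      RatModEq p 3
        (p * ∑ k ∈ Icc 1 (p - 1), (-1 : ℚ) ^ k / k.centralBinom)
        ((p - (lucasNumber p : ℚ) * Nat.fib p) / 5
          + 2 * (p : ℚ) ^ 2 / 25 * (legendreSym 5 p : ℚ) * lucasQuotient p ^ 2) ∧
      -- `t = 2 ∓ √5`; the index `3k - (p/5)` is an integer that is at least `2`
      RatModEq p 2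
        (∑ k ∈ Icc 1 (p - 1), (k.centralBinom : ℚ) *
          ((-1 : ℚ) ^ k * Nat.fib (3 * (k : ℤ) - legendreSym 5 p).toNat / k))
        (1 / 5 * p * lucasQuotient p ^ 2) ∧
      RatModEq p 1
        (∑ k ∈ Icc 1 (p - 1), (k.centralBinom : ℚ) *
          ((-1 : ℚ) ^ k * lucasNumber (3 * (k : ℤ) - legendreSym 5 p).toNat / (k : ℚ) ^ 2))
        0) := by
  -- The residue map is a local homomorphism, and the algebraically closed source contains √-1, ζ
  -- and φ at once.
  let ρ := IsLocalRing.residue (padicAlgInt p)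
  exact ⟨ratModEq_sum_two_pow_div hp ρ,
    ratModEq_sum_two_pow_div_sq hp ρ,
    ratModEq_sum_four_pow_div_sq hp ρ,
    ratModEq_sum_four_pow_div_cube hp ρ,
    ratModEq_sum_four_pow_div_pow_four hp ρ,
    ratModEq_sum_centralBinom hp ρ,
    ratModEq_sum_centralBinom_div_three_pow hp ρ,
    ratModEq_sum_neg_two_pow_mul_centralBinom hp ρ,
    ratModEq_sum_neg_one_pow_div_mul_centralBinom hp ρ,
    ratModEq_sum_centralBinom_div_sq hp ρ,
    fun hp5 => ⟨ratModEq_sum_neg_one_pow_mul_genHarmonic_div hp5 ρ,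
      ratModEq_sum_neg_one_pow_mul_genHarmonic_div_sq hp5 ρ,
      ratModEq_sum_neg_one_pow_mul_genHarmonic hp5 ρ,
      ratModEq_sum_neg_one_pow_div hp5 ρ,
      ratModEq_sum_neg_one_pow_div_sq hp5 ρ,
      ratModEq_sum_neg_one_pow_div_centralBinom hp5 ρ,
      ratModEq_sum_centralBinom_mul_fib hp5 ρ,
      ratModEq_sum_centralBinom_mul_lucasNumber hp5 ρ⟩⟩
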